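/- Let $K$ be a field and $V$ a $K$-vector space. A braiding on a vector space $A$ is an invertible linear map $\sigma\in\mathrm{End}(A\otimes A)$ with $\sigma_1\sigma_2\sigma_1=\sigma_2\sigma_1\sigma_2$ on $A^{\otimes 3}$, where $\sigma_1=\sigma\otimes\mathrm{id}$ and $\sigma_2=\mathrm{id}\otimes\sigma$. A Yang-Baxter (YB) algebra is an associative unital algebra $(A,m,1)$ with a braiding $\sigma$ such that $\sigma(m\otimes\mathrm{id})=(\mathrm{id}\otimes m)\sigma_1\sigma_2$, $\sigma(\mathrm{id}\otimes m)=(m\otimes\mathrm{id})\sigma_2\sigma_1$, $\sigma(1\otimes a)=a\otimes 1$ and $\sigma(a\otimes 1)=1\otimes a$ for all $a\in A$. Let $\sigma$ be a braiding on $V$, and let $\sigma_i$ denote $\sigma$ acting on the factors $i,i+1$ of a tensor power of $V$. Let $\beta$ be the endomorphism of $T(V)\underline{\otimes}T(V)$ given on $V^{\otimes k}\underline{\otimes}V^{\otimes l}$ ($k,l\ge 1$) by $$\beta_{kl}=(\sigma_l\cdots\sigma_1)(\sigma_{l+1}\cdots\sigma_2)\cdots(\sigma_{l+k-1}\cdots\sigma_k):V^{\otimes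 k}\underline{\otimes}V^{\otimes l}\to V^{\otimes l}\underline{\otimes}V^{\otimes k},$$ i.e. by the lift to the braid group of the permutation $a\mapsto l+a$ ($1\le a\le k$), $k+b\mapsto b$ ($1\le b\le l$), and with $\beta_{0l},\beta_{k0}$ the flips. Let $\delta$ be the deconcatenation coproduct of $T(V)$, $\varepsilon:T(V)\to K$ the projection, $\Delta_\beta=(\mathrm{id}\otimes\beta\otimes\mathrm{id})(\delta\otimes\delta)$ the twisted coproduct of $C=T(V)\underline{\otimes}T(V)$, and $\overline{\Delta_\beta}(x)=\Delta_\beta(x)-x\otimes(1\underline{\otimes}1)-(1\underline{\otimes}1)\otimes x$, with iterates $\overline{\Delta_\beta}^{(0)}=\mathrm{id}$ and $\overline{\Delta_\beta}^{(n)}=(\overline{\Delta_\beta}\otimes\mathrm{id}^{\otimes n-1})\overline{\Delta_\beta}^{(n-1)}:C\to C^{\otimes n+1}$. A quantum $\mathbf{B}_\infty$-algebra $(V,M,\sigma)$ is a vector space $V$ with a braiding $\sigma$ and a linear map $M=\oplus_{p,q\ge0}M_{pq}$, $M_{pq}:V^{\otimes p}\underline{\otimes}V^{\otimes q}\to V$,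 such that 1. $M_{00}=0$, $M_{10}=\mathrm{id}_V=M_{01}$, and $M_{n0}=0=M_{0n}$ for $n\ge2$; 2. $\beta_{1k}(M_{ij}\otimes\mathrm{id}_V^{\otimes k})=(\mathrm{id}_V^{\otimes k}\otimes M_{ij})\beta_{i+j,k}$ and $\beta_{i1}(\mathrm{id}_V^{\otimes i}\otimes M_{jk})=(M_{jk}\otimes\mathrm{id}_V^{\otimes i})\beta_{i,j+k}$ for all $i,j,k\ge1$; 3. for all $i,j,k\ge1$, on $V^{\otimes i}\underline{\otimes}V^{\otimes j}\underline{\otimes}V^{\otimes k}$, $$\sum_{r=1}^{i+j}M_{rk}\circ\big((M^{\otimes r}\overline{\Delta_\beta}^{(r-1)})\otimes\mathrm{id}_V^{\otimes k}\big)=\sum_{l=1}^{j+k}M_{il}\circ\big(\mathrm{id}_V^{\otimes i}\otimes(M^{\otimes l}\overline{\Delta_\beta}^{(l-1)})\big).$$ Let $(V,M,\sigma)$ be a quantum $\mathbf{B}_\infty$-algebra and define a product on $T(V)$ by $\ast=\varepsilon\otimes\varepsilon+\sum_{n\ge1}M^{\otimes n}\overline{\Delta_\beta}^{(n-1)}$;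 on $V^{\otimes i}\underline{\otimes}V^{\otimes j}$ only the terms with $n\le i+j$ contribute. Then $\ast$ is associative with unit $1$. Let $Q_\sigma(V)$ be the unital subalgebra of $(T(V),\ast)$ generated by $V$, and for $n\ge 0$ let $\ast^n:V^{\otimes n+1}\to T(V)$ be the linear map $v_1\otimes\cdots\otimes v_{n+1}\mapsto v_1\ast\cdots\ast v_{n+1}$. Then: (a) for all $k,l\ge0$, $\beta(\ast^k\otimes\ast^l)=(\ast^l\otimes\ast^k)\beta_{k+1,l+1}$ on $V^{\otimes k+1}\underline{\otimes}V^{\otimes l+1}$; (b) $\beta$ restricts to a linear endomorphism of $Q_\sigma(V)\otimes Q_\sigma(V)$, and with this restriction as braiding, the product $\ast$ and the unit $1$, $Q_\sigma(V)$ is a YB algebra. -/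

import Mathlib

open scoped TensorProduct

noncomputable section

namespace QuantumBInf

universe u v w

section Braiding

variable {K : Type u} [Field K] {A : Type w} [AddCommGroup A] [Module K A]

/-- The operator `σ₁ = σ ⊗ id` on `A ⊗ A ⊗ A` (bracketed to the right). -/
def op₁ (σ : A ⊗[K] A →ₗ[K] A ⊗[K] A) : A ⊗[K] (A ⊗[K] A) →ₗ[K] A ⊗[K] (A ⊗[K] A) :=
  (TensorProduct.assoc K A A A).toLinearMap ∘ₗ σ.rTensor A ∘ₗ
    (TensorProduct.assoc K A A A).symm.toLinearMap

/-- The operator `σ₂ = id ⊗ σ` on `A ⊗ A ⊗ A` (bracketed to the right). -/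
def op₂ (σ : A ⊗[K] A →ₗ[K] A ⊗[K] A) : A ⊗[K] (A ⊗[K] A) →ₗ[K] A ⊗[K] (A ⊗[K] A) :=
  σ.lTensor A

/-- A braiding on `A`: an invertible endomorphism of `A ⊗ A` satisfying the quantum
Yang-Baxter equation `σ₁ σ₂ σ₁ = σ₂ σ₁ σ₂`. -/
structure IsBraiding (σ : A ⊗[K] A →ₗ[K] A ⊗[K] A) : Prop where
  bijective : Function.Bijective σ
  yang_baxter : op₁ σ ∘ₗ op₂ σ ∘ₗ op₁ σ = op₂ σ ∘ₗ op₁ σ ∘ₗ op₂ σ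

/-- `(A, mul, one)` is an associative algebra with unit `one`. -/
structure IsUnitalAlgebra (mul : A ⊗[K] A →ₗ[K] A) (one : A) : Prop where
  assoc : ∀ a b c : A, mul (mul (a ⊗ₜ b) ⊗ₜ c) = mul (a ⊗ₜ mul (b ⊗ₜ c))
  one_mul : ∀ a : A, mul (one ⊗ₜ a) = a
  mul_one : ∀ a : A, mul (a ⊗ₜ one) = a

/-- The map `m ⊗ id : A ⊗ A ⊗ A → A ⊗ A`. -/
def mulLeft (mul : A ⊗[K] A →ₗ[K] A) : A ⊗[K] (A ⊗[K] A) →ₗ[K] A ⊗[K] A :=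
  mul.rTensor A ∘ₗ (TensorProduct.assoc K A A A).symm.toLinearMap

/-- The map `id ⊗ m : A ⊗ A ⊗ A → A ⊗ A`. -/
def mulRight (mul : A ⊗[K] A →ₗ[K] A) : A ⊗[K] (A ⊗[K] A) →ₗ[K] A ⊗[K] A :=
  mul.lTensor A

/-- `(A, mul, one, σ)` is a Yang-Baxter algebra. -/
structure IsYBAlgebra (mul : A ⊗[K] A →ₗ[K] A) (one : A)
    (σ : A ⊗[K] A →ₗ[K] A ⊗[K] A) : Prop where
  algebra : IsUnitalAlgebra mul one
  braiding : IsBraiding σ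
  braid_mul_left : σ ∘ₗ mulLeft mul = mulRight mul ∘ₗ op₁ σ ∘ₗ op₂ σ
  braid_mul_right : σ ∘ₗ mulRight mul = mulLeft mul ∘ₗ op₂ σ ∘ₗ op₁ σ
  braid_one_left : ∀ a : A, σ (one ⊗ₜ a) = a ⊗ₜ one
  braid_one_right : ∀ a : A, σ (a ⊗ₜ one) = one ⊗ₜ a

/-- The reduced coproduct `x ↦ Δ x - x ⊗ g - g ⊗ x` of a coproduct `Δ` on `A`, with respect to
an element `g`. -/
def reduced (Δ : A →ₗ[K] A ⊗[K] A) (g : A) : A →ₗ[K] A ⊗[K] A :=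
  Δ - (TensorProduct.mk K A A).flip g - TensorProduct.mk K A A g

end Braiding

section TensorSpace

variable {K : Type u} [Field K] {V : Type v} [AddCommGroup V] [Module K V]

variable (K V) in
/-- The tensor space `T(V)`. Its Mathlib multiplication is concatenation. -/
abbrev T : Type _ := TensorAlgebra K V

variable (K V) in
/-- The homogeneous component `V^{⊗ n}` of `T(V)`. -/
abbrev deg (n : ℕ) : Submodule K (T K V) :=
  LinearMap.range (TensorAlgebra.ι K : V →ₗ[K] T K V) ^ n

variable (K V) in
/-- The inclusion `V → T(V)`. -/
abbrev incl : V →ₗ[K] T K V := TensorAlgebra.ι K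

/-- Recursion on tensors from the left: the linear map `r : T(V) → X` with `r 1 = x₀` and
`r (v ⊗ t) = f v (r t)`. -/
def leftRec {X : Type*} [AddCommGroup X] [Module K X] (x₀ : X) (f : V →ₗ[K] Module.End K X) :
    T K V →ₗ[K] X :=
  LinearMap.applyₗ x₀ ∘ₗ (TensorAlgebra.lift K f).toLinearMap

theorem leftRec_one {X : Type*} [AddCommGroup X] [Module K X] (x₀ : X)
    (f : V →ₗ[K] Module.End K X) : leftRec x₀ f 1 = x₀ := by
  simp [leftRec]

theorem leftRec_mul {X : Type*} [AddCommGroup X] [Module K X] (x₀ : X)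
    (f : V →ₗ[K] Module.End K X) (v : V) (t : T K V) :
    leftRec x₀ f (incl K V v * t) = f v (leftRec x₀ f t) := by
  simp [leftRec]

/-- For `g : V → T(V) ⊗ V` and `w : V`, the map `v ↦ ∑ w' · g(v')`, where
`σ (v ⊗ w) = ∑ w' ⊗ v'`. -/
def passStep (σ : V ⊗[K] V →ₗ[K] V ⊗[K] V) :
    V →ₗ[K] Module.End K (V →ₗ[K] T K V ⊗[K] V) :=
  LinearMap.mk₂ K
    (fun w g => (LinearMap.mul' K (T K V)).rTensor V ∘ₗ
      (TensorProduct.assoc K (T K V) (T K V) V).symm.toLinearMap ∘ₗ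
      TensorProduct.map (incl K V) g ∘ₗ σ ∘ₗ (TensorProduct.mk K V V).flip w)
    (by intros; ext; simp)
    (by intros; ext; simp)
    (by intros; ext; simp [TensorProduct.map_add_right])
    (by intros; ext; simp [TensorProduct.map_smul_right])

/-- The braiding `β_{1,•} : V ⊗ T(V) → T(V) ⊗ V` of one vector past a tensor (curried, the tensor
being the first argument). On `V ⊗ V^{⊗ l}` it is `σ_l ⋯ σ_2 σ_1`, i.e.
`β_{1,l+1} = (id_V ⊗ β_{1,l}) (σ ⊗ id)`. -/
def passOne (σ : V ⊗[K] V →ₗ[K] V ⊗[K] V) : T K V →ₗ[K] V →ₗ[K] T K V ⊗[K] V :=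
  leftRec (TensorProduct.mk K (T K V) V 1) (passStep σ)

/-- The same map `β_{1,•}` as a linear map `V ⊗ T(V) → T(V) ⊗ V`. -/
def betaOne (σ : V ⊗[K] V →ₗ[K] V ⊗[K] V) : V ⊗[K] T K V →ₗ[K] T K V ⊗[K] V :=
  TensorProduct.lift (passOne σ).flip

/-- For `v : V` and `g : T(V) → T(V) ⊗ T(V)`, the map `(β_{1,•} ⊗ id)(v ⊗ g(-))`, the result
being read in `T(V) ⊗ T(V)` by concatenating `V ⊗ T(V) → T(V)`. -/
def betaStep (σ : V ⊗[K] V →ₗ[K] V ⊗[K] V) :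
    V →ₗ[K] Module.End K (T K V →ₗ[K] T K V ⊗[K] T K V) :=
  LinearMap.mk₂ K
    (fun v g => (LinearMap.mul' K (T K V)).lTensor (T K V) ∘ₗ
      ((incl K V).rTensor (T K V)).lTensor (T K V) ∘ₗ
      (TensorProduct.assoc K (T K V) V (T K V)).toLinearMap ∘ₗ
      (betaOne σ).rTensor (T K V) ∘ₗ
      (TensorProduct.assoc K V (T K V) (T K V)).symm.toLinearMap ∘ₗ
      TensorProduct.mk K V (T K V ⊗[K] T K V) v ∘ₗ g)
    (by intros; ext; simp)
    (by intros; ext; simp)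
    (by intros; ext; simp [TensorProduct.tmul_add])
    (by intros; ext; simp)

/-- The braiding `β` of `T(V) ⊗ T(V)`. On `V^{⊗ k} ⊗ V^{⊗ l}` it is the lift `T_χ` of the
permutation `χ = χ_{kl}` (`a ↦ l + a` for `a ≤ k`, `k + b ↦ b` for `b ≤ l`), computed along the
reduced expression of length `k * l` given by
`β_{k+1,l} = (β_{1,l} ⊗ id_V^{⊗ k}) (id_V ⊗ β_{k,l})`, that is
`(σ_l ⋯ σ_1) (σ_{l+1} ⋯ σ_2) ⋯ (σ_{l+k-1} ⋯ σ_k)`; `β_{0,l}` and `β_{k,0}` are flips. -/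
def beta (σ : V ⊗[K] V →ₗ[K] V ⊗[K] V) : T K V ⊗[K] T K V →ₗ[K] T K V ⊗[K] T K V :=
  TensorProduct.lift (leftRec ((TensorProduct.mk K (T K V) (T K V)).flip 1) (betaStep σ))

variable (K V) in
/-- One step in the recursion for deconcatenation:
`(p, t) ↦ (1 ⊗ v t + (v ⊗ 1) p, v t)`. -/
def deltaStep : V →ₗ[K] Module.End K ((T K V ⊗[K] T K V) ×
    T K V) :=
  LinearMap.mk₂ K
    (fun v q => ((1 : T K V) ⊗ₜ[K] (incl K V v * q.2) + (incl K V v ⊗ₜ[K] (1 : T K V)) * q.1,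
      incl K V v * q.2))
    (by intros; ext <;> simp [add_mul, TensorProduct.tmul_add, TensorProduct.add_tmul]; abel)
    (by intros; ext <;> simp [← TensorProduct.smul_tmul'])
    (by intros; ext <;> simp [mul_add, TensorProduct.tmul_add]; abel)
    (by intros; ext <;> simp)

variable (K V) in
/-- The deconcatenation coproduct
`δ (v₁ ⊗ ⋯ ⊗ vₙ) = ∑ᵢ (v₁ ⊗ ⋯ ⊗ vᵢ) ⊗ (vᵢ₊₁ ⊗ ⋯ ⊗ vₙ)` (`0 ≤ i ≤ n`) of `T^c(V)`. -/
def delta : T K V →ₗ[K] T K V ⊗[K] T K V :=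
  LinearMap.fst K _ _ ∘ₗ leftRec ((1 : T K V) ⊗ₜ[K] (1 : T K V), (1 : T K V)) (deltaStep K V)

variable (K V) in
/-- The projection of `T(V)` onto its component `V^{⊗ n}`. -/
def projDeg (n : ℕ) : T K V →ₗ[K] T K V :=
  GradedAlgebra.proj (deg K V) n

variable (K V) in
/-- The component `V^{⊗ (i+j)} → V^{⊗ i} ⊗ V^{⊗ j}` of deconcatenation, i.e. the canonical
identification of these two spaces (extended by `0` to the other degrees). -/
def split (i j : ℕ) : T K V →ₗ[K] T K V ⊗[K] T K V :=
  TensorProduct.map (projDeg K V i) (projDeg K V j) ∘ₗ delta K V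

/-- The twisted coproduct `Δ_β = (id ⊗ β ⊗ id) (δ ⊗ δ)` of `T^c(V) ⊗ T^c(V)`. -/
def coprod (σ : V ⊗[K] V →ₗ[K] V ⊗[K] V) :
    T K V ⊗[K] T K V →ₗ[K] (T K V ⊗[K] T K V) ⊗[K] (T K V ⊗[K] T K V) :=
  (TensorProduct.assoc K (T K V) (T K V) (T K V ⊗[K] T K V)).symm.toLinearMap ∘ₗ
    (op₁ (beta σ)).lTensor (T K V) ∘ₗ
    (TensorProduct.assoc K (T K V) (T K V) (T K V ⊗[K] T K V)).toLinearMap ∘ₗ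
    TensorProduct.map (delta K V) (delta K V)

/-- The reduced coproduct of `Δ_β`, with respect to the group-like element `1 ⊗ 1`. -/
def redCoprod (σ : V ⊗[K] V →ₗ[K] V ⊗[K] V) :
    T K V ⊗[K] T K V →ₗ[K] (T K V ⊗[K] T K V) ⊗[K] (T K V ⊗[K] T K V) :=
  reduced (coprod σ) ((1 : T K V) ⊗ₜ[K] (1 : T K V))

/-- The map `M^{⊗ n} ∘ Δ̄_β^{(n-1)} : T(V) ⊗ T(V) → V^{⊗ n}` for `n ≥ 1` (and `0` for `n = 0`),
where `Δ̄_β` is the reduced coproduct. Since `Δ̄^{(n)} = (Δ̄^{(n-1)} ⊗ id) Δ̄`, one has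
`M^{⊗ (n+1)} Δ̄^{(n)} = (M^{⊗ n} Δ̄^{(n-1)} ⊗ M) Δ̄`. -/
def multiM (σ : V ⊗[K] V →ₗ[K] V ⊗[K] V) (M : T K V ⊗[K] T K V →ₗ[K] V) :
    ℕ → (T K V ⊗[K] T K V →ₗ[K] T K V)
  | 0 => 0
  | 1 => incl K V ∘ₗ M
  | n + 2 => LinearMap.mul' K (T K V) ∘ₗ
      TensorProduct.map (multiM σ M (n + 1)) (incl K V ∘ₗ M) ∘ₗ redCoprod σ

/-- The restriction of the product `∗` to `V^{⊗ i} ⊗ V^{⊗ j}`: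
`x ∗ y = ε(x) ε(y) 1 + ∑_{n ≥ 1} M^{⊗ n} Δ̄_β^{(n-1)} (x ⊗ y)`,
where the terms with `n > i + j` vanish and are left out. -/
def starHom (σ : V ⊗[K] V →ₗ[K] V ⊗[K] V) (M : T K V ⊗[K] T K V →ₗ[K] V) (i j : ℕ) :
    deg K V i →ₗ[K] deg K V j →ₗ[K] T K V :=
  (TensorProduct.mk K (T K V) (T K V)).compr₂
      (LinearMap.mul' K (T K V) ∘ₗ TensorProduct.map
          (Algebra.linearMap K (T K V) ∘ₗ TensorAlgebra.algebraMapInv.toLinearMap)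
          (Algebra.linearMap K (T K V) ∘ₗ TensorAlgebra.algebraMapInv.toLinearMap)
        + ∑ n ∈ Finset.Icc 1 (i + j), multiM σ M n)
    |>.compl₁₂ (deg K V i).subtype (deg K V j).subtype

/-- The product `∗ = ε ⊗ ε + ∑_{n ≥ 1} M^{⊗ n} Δ̄_β^{(n-1)}` on `T(V)`, assembled from its
restrictions to the components `V^{⊗ i} ⊗ V^{⊗ j}`. -/
def starProd (σ : V ⊗[K] V →ₗ[K] V ⊗[K] V) (M : T K V ⊗[K] T K V →ₗ[K] V) :
    T K V ⊗[K] T K V →ₗ[K] T K V :=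
  TensorProduct.lift <|
    (DirectSum.toModule K ℕ (T K V →ₗ[K] T K V) fun i =>
      ((DirectSum.toModule K ℕ (deg K V i →ₗ[K] T K V) fun j => (starHom σ M i j).flip) ∘ₗ
        (DirectSum.decomposeLinearEquiv (deg K V)).toLinearMap).flip) ∘ₗ
      (DirectSum.decomposeLinearEquiv (deg K V)).toLinearMap

/-- A quantum B-infinity algebra `(V, M, σ)`. The family `M_{pq} : V^{⊗ p} ⊗ V^{⊗ q} → V` is
given as the single map `M = ⊕ M_{pq}` on `T(V) ⊗ T(V)`; in the Yang-Baxter conditions `M_{ij}`,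
read on `V^{⊗ (i+j)}`, is `M ∘ split i j`. -/
structure IsQuantumBInf (σ : V ⊗[K] V →ₗ[K] V ⊗[K] V) (M : T K V ⊗[K] T K V →ₗ[K] V) :
    Prop where
  braiding : IsBraiding σ
  M_zero_zero : M ((1 : T K V) ⊗ₜ (1 : T K V)) = 0
  M_one_zero : ∀ v : V, M (incl K V v ⊗ₜ (1 : T K V)) = v
  M_zero_one : ∀ v : V, M ((1 : T K V) ⊗ₜ incl K V v) = v
  M_n_zero : ∀ n, 2 ≤ n → ∀ x ∈ deg K V n, M (x ⊗ₜ (1 : T K V)) = 0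
  M_zero_n : ∀ n, 2 ≤ n → ∀ x ∈ deg K V n, M ((1 : T K V) ⊗ₜ x) = 0
  yang_baxter_left : ∀ i j k, 1 ≤ i → 1 ≤ j → 1 ≤ k →
    ∀ x ∈ deg K V (i + j), ∀ z ∈ deg K V k,
      beta σ (incl K V (M (split K V i j x)) ⊗ₜ z) =
        (incl K V ∘ₗ M ∘ₗ split K V i j).lTensor (T K V) (beta σ (x ⊗ₜ z))
  yang_baxter_right : ∀ i j k, 1 ≤ i → 1 ≤ j → 1 ≤ k →
    ∀ x ∈ deg K V i, ∀ z ∈ deg K V (j + k),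
      beta σ (x ⊗ₜ incl K V (M (split K V j k z))) =
        (incl K V ∘ₗ M ∘ₗ split K V j k).rTensor (T K V) (beta σ (x ⊗ₜ z))
  associativity : ∀ i j k, 1 ≤ i → 1 ≤ j → 1 ≤ k →
    ∀ x ∈ deg K V i, ∀ y ∈ deg K V j, ∀ z ∈ deg K V k,
      ∑ r ∈ Finset.Icc 1 (i + j), M (multiM σ M r (x ⊗ₜ y) ⊗ₜ z) =
        ∑ l ∈ Finset.Icc 1 (j + k), M (x ⊗ₜ multiM σ M l (y ⊗ₜ z))

/-- The map `∗^n : V^{⊗ (n+1)} → T(V)`, `v₁ ⊗ ⋯ ⊗ vₙ₊₁ ↦ v₁ ∗ (v₂ ∗ ⋯ ∗ vₙ₊₁)`, with `∗^0` the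
inclusion of `V` (extended by `0` to the other degrees of `T(V)`). -/
def starPow (σ : V ⊗[K] V →ₗ[K] V ⊗[K] V) (M : T K V ⊗[K] T K V →ₗ[K] V) :
    ℕ → (T K V →ₗ[K] T K V)
  | 0 => projDeg K V 1
  | n + 1 => starProd σ M ∘ₗ (starPow σ M n).lTensor (T K V) ∘ₗ split K V 1 (n + 1)

/-- `Q_σ(V)`: the subalgebra of `(T(V), ∗)` generated by `V`, i.e. the smallest subspace which
contains `1` and `V` and is closed under `∗`. -/
def Q (σ : V ⊗[K] V →ₗ[K] V ⊗[K] V) (M : T K V ⊗[K] T K V →ₗ[K] V) : Submodule K (T K V) :=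
  sInf {S | (1 : T K V) ∈ S ∧ (∀ v : V, incl K V v ∈ S) ∧
    ∀ x ∈ S, ∀ y ∈ S, starProd σ M (x ⊗ₜ y) ∈ S}

theorem one_mem_Q (σ : V ⊗[K] V →ₗ[K] V ⊗[K] V) (M : T K V ⊗[K] T K V →ₗ[K] V) :
    (1 : T K V) ∈ Q σ M :=
  Submodule.mem_sInf.2 fun _ hS => hS.1

theorem star_mem_Q (σ : V ⊗[K] V →ₗ[K] V ⊗[K] V) (M : T K V ⊗[K] T K V →ₗ[K] V)
    {x y : T K V} (hx : x ∈ Q σ M) (hy : y ∈ Q σ M) : starProd σ M (x ⊗ₜ y) ∈ Q σ M :=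
  Submodule.mem_sInf.2 fun S hS =>
    hS.2.2 x (Submodule.mem_sInf.1 hx S hS) y (Submodule.mem_sInf.1 hy S hS)

/-- The unit of `Q_σ(V)`. -/
def oneQ (σ : V ⊗[K] V →ₗ[K] V ⊗[K] V) (M : T K V ⊗[K] T K V →ₗ[K] V) : Q σ M :=
  ⟨1, one_mem_Q σ M⟩

/-- The inclusion `Q_σ(V) ⊗ Q_σ(V) → T(V) ⊗ T(V)`. -/
def inclQ (σ : V ⊗[K] V →ₗ[K] V ⊗[K] V) (M : T K V ⊗[K] T K V →ₗ[K] V) :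
    Q σ M ⊗[K] Q σ M →ₗ[K] T K V ⊗[K] T K V :=
  TensorProduct.map (Q σ M).subtype (Q σ M).subtype

/-- The product `∗` of `Q_σ(V)`. -/
def mulQ (σ : V ⊗[K] V →ₗ[K] V ⊗[K] V) (M : T K V ⊗[K] T K V →ₗ[K] V) :
    Q σ M ⊗[K] Q σ M →ₗ[K] Q σ M :=
  (starProd σ M ∘ₗ inclQ σ M).codRestrict (Q σ M) fun t => by
    induction t using TensorProduct.induction_on with
    | zero => rw [map_zero]; exact Submodule.zero_mem _
    | tmul x y => exact star_mem_Q σ M x.2 y.2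
    | add s t hs ht => rw [map_add]; exact Submodule.add_mem _ hs ht

end TensorSpace

end QuantumBInf

end

open scoped TensorProduct

noncomputable section

namespace QuantumBInf

open TensorProduct

/-! ### Maps that commute with moving a third factor `Z` past them. -/

section Crossings

variable {K : Type*} [Field K]
  {A B C D P Q X Y Z : Type*}
  [AddCommGroup A] [Module K A] [AddCommGroup B] [Module K B]
  [AddCommGroup C] [Module K C] [AddCommGroup D] [Module K D]
  [AddCommGroup P] [Module K P] [AddCommGroup Q] [Module K Q]
  [AddCommGroup X] [Module K X] [AddCommGroup Y] [Module K Y]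
  [AddCommGroup Z] [Module K Z]

/-! Everything rests on naturality. A map `f : A → B` is compatible with crossings if moving an
auxiliary factor `Z` past `A` and then applying `f` gives the same as applying `f` first
(`IsCrossL`, `IsCrossR`, according to the side from which `Z` comes). Such maps are closed under
sums, composition, tensor products and reassociation. With `Z = T(V)` and `β` as crossing,
concatenation, deconcatenation and the degree projections are compatible because they are defined by
recursion along `V ⊗ T(V) → T(V)`; `β` itself is compatible because `σ` satisfies the Yang-Baxter
equation; `M` is compatible by the second axiom. Hence so are `Δ_β`, every term of `∗`, then `∗` and
its iterates. Naturality in both factors is part (a), and the compatibility of `∗` gives the two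
mixed Yang-Baxter axioms.

For associativity, `∗` solves `∗ = ε ⊗ ε + m (∗ ⊗ M) Δ_β`, with `m` concatenation and the full
coproduct (`starProd_recursion`). Since `M` vanishes in degree `0`, equations of this shape have a
unique solution on a graded space (`eq_of_recursion`). Uniqueness is applied three times. It gives
the unit laws. It shows that `∗` is a coalgebra map from `Δ_β` to `δ` (`delta_starProd`). Finally,
`∗(∗ ⊗ id)` and `∗(id ⊗ ∗)` solve the same recursion on `T(V)^{⊗ 3}`: the coalgebra property and
naturality turn both into recursions for the same twisted coproduct, with degree-one parts `M(∗ ⊗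
id)` and `M(id ⊗ ∗)`, which agree by the third axiom.

For `Q_σ(V)`, induction over products of generators shows that any crossing compatible with `∗`, the
unit and the projection to `V` preserves `Q ⊗ Q`. This applies to `β` and to `β⁻¹`, so the
restriction is bijective, and the identities descend because `Q^{⊗ n} → T(V)^{⊗ n}` is injective
over a field. -/

/-- The crossing `b : P ⊗ Q → Q ⊗ P` applied to the first two factors of `P ⊗ (Q ⊗ X)`. -/
def slide (b : P ⊗[K] Q →ₗ[K] Q ⊗[K] P) : P ⊗[K] (Q ⊗[K] X) →ₗ[K] Q ⊗[K] (P ⊗[K] X) :=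
  (TensorProduct.assoc K Q P X).toLinearMap ∘ₗ b.rTensor X ∘ₗ
    (TensorProduct.assoc K P Q X).symm.toLinearMap

@[simp]
theorem slide_tmul (b : P ⊗[K] Q →ₗ[K] Q ⊗[K] P) (p : P) (q : Q) (x : X) :
    slide b (p ⊗ₜ (q ⊗ₜ x)) = TensorProduct.assoc K Q P X (b (p ⊗ₜ q) ⊗ₜ x) := by
  simp [slide]

/-- The crossing of `A ⊗ B` with `Z` obtained by moving `B`, then `A`, past `Z`. -/
def crossL (τA : A ⊗[K] Z →ₗ[K] Z ⊗[K] A) (τB : B ⊗[K] Z →ₗ[K] Z ⊗[K] B) :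
    (A ⊗[K] B) ⊗[K] Z →ₗ[K] Z ⊗[K] (A ⊗[K] B) :=
  slide τA ∘ₗ τB.lTensor A ∘ₗ (TensorProduct.assoc K A B Z).toLinearMap

@[simp]
theorem crossL_tmul (τA : A ⊗[K] Z →ₗ[K] Z ⊗[K] A) (τB : B ⊗[K] Z →ₗ[K] Z ⊗[K] B)
    (a : A) (b : B) (z : Z) :
    crossL τA τB ((a ⊗ₜ b) ⊗ₜ z) = slide τA (a ⊗ₜ τB (b ⊗ₜ z)) := by
  simp [crossL]

/-- The crossing of `Z` with `A ⊗ B` obtained by moving `Z` past `A`, then past `B`. -/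
def crossR (ρA : Z ⊗[K] A →ₗ[K] A ⊗[K] Z) (ρB : Z ⊗[K] B →ₗ[K] B ⊗[K] Z) :
    Z ⊗[K] (A ⊗[K] B) →ₗ[K] (A ⊗[K] B) ⊗[K] Z :=
  (TensorProduct.assoc K A B Z).symm.toLinearMap ∘ₗ ρB.lTensor A ∘ₗ slide ρA

theorem crossR_apply (ρA : Z ⊗[K] A →ₗ[K] A ⊗[K] Z) (ρB : Z ⊗[K] B →ₗ[K] B ⊗[K] Z)
    (u : Z ⊗[K] (A ⊗[K] B)) :
    crossR ρA ρB u = (TensorProduct.assoc K A B Z).symm (ρB.lTensor A (slide ρA u)) := rfl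

/-- `f` commutes with moving `Z` from the right to the left. -/
def IsCrossL (τA : A ⊗[K] Z →ₗ[K] Z ⊗[K] A) (τB : B ⊗[K] Z →ₗ[K] Z ⊗[K] B)
    (f : A →ₗ[K] B) : Prop :=
  ∀ a z, τB (f a ⊗ₜ z) = f.lTensor Z (τA (a ⊗ₜ z))

/-- `f` commutes with moving `Z` from the left to the right. -/
def IsCrossR (ρA : Z ⊗[K] A →ₗ[K] A ⊗[K] Z) (ρB : Z ⊗[K] B →ₗ[K] B ⊗[K] Z)
    (f : A →ₗ[K] B) : Prop :=
  ∀ z a, ρB (z ⊗ₜ f a) = f.rTensor Z (ρA (z ⊗ₜ a))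

namespace IsCrossL

variable {τA : A ⊗[K] Z →ₗ[K] Z ⊗[K] A} {τB : B ⊗[K] Z →ₗ[K] Z ⊗[K] B}
  {τC : C ⊗[K] Z →ₗ[K] Z ⊗[K] C} {τD : D ⊗[K] Z →ₗ[K] Z ⊗[K] D}

theorem apply {f : A →ₗ[K] B} (hf : IsCrossL τA τB f) (u : A ⊗[K] Z) :
    τB (f.rTensor Z u) = f.lTensor Z (τA u) := by
  induction u using TensorProduct.induction_on with
  | zero => simp
  | tmul a z => simpa using hf a z
  | add u v hu hv => simp only [map_add, hu, hv]

theorem id : IsCrossL τA τA LinearMap.id := fun a z => by simp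

theorem zero : IsCrossL τA τB 0 := fun a z => by simp

theorem comp {g : B →ₗ[K] C} {f : A →ₗ[K] B} (hg : IsCrossL τB τC g) (hf : IsCrossL τA τB f) :
    IsCrossL τA τC (g ∘ₗ f) := fun a z => by
  rw [LinearMap.lTensor_comp, LinearMap.comp_apply, LinearMap.comp_apply, ← hf, ← hg.apply]
  simp

theorem add {f g : A →ₗ[K] B} (hf : IsCrossL τA τB f) (hg : IsCrossL τA τB g) :
    IsCrossL τA τB (f + g) := fun a z => by
  simp [LinearMap.lTensor_add, add_tmul, hf a z, hg a z]

theorem sum {ι : Type*} (s : Finset ι) {f : ι → A →ₗ[K] B}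
    (hf : ∀ i ∈ s, IsCrossL τA τB (f i)) : IsCrossL τA τB (∑ i ∈ s, f i) := by
  classical
  induction s using Finset.induction_on with
  | empty => simpa using zero
  | insert i s hi ih =>
    rw [Finset.sum_insert hi]
    exact (hf i (by simp)).add (ih fun j hj => hf j (by simp [hj]))

theorem map {f : A →ₗ[K] B} {g : C →ₗ[K] D} (hf : IsCrossL τA τB f) (hg : IsCrossL τC τD g) :
    IsCrossL (crossL τA τC) (crossL τB τD) (TensorProduct.map f g) := fun u z => by
  induction u using TensorProduct.induction_on with
  | zero => simp
  | add u v hu hv => simp only [map_add, add_tmul, hu, hv]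
  | tmul a c =>
    rw [map_tmul, crossL_tmul, crossL_tmul, hg]
    generalize τC (c ⊗ₜ z) = u
    induction u using TensorProduct.induction_on with
    | zero => simp
    | add u v hu hv => simp only [map_add, tmul_add, hu, hv]
    | tmul z c =>
      rw [LinearMap.lTensor_tmul, slide_tmul, slide_tmul, hf]
      generalize τA (a ⊗ₜ z) = u
      induction u using TensorProduct.induction_on with
      | zero => simp
      | add u v hu hv => simp only [map_add, add_tmul, hu, hv]
      | tmul z a => simp

theorem lTensor {g : C →ₗ[K] D} (hg : IsCrossL τC τD g) :
    IsCrossL (crossL τA τC) (crossL τA τD) (g.lTensor A) := id.map hg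

theorem rTensor {f : A →ₗ[K] B} (hf : IsCrossL τA τB f) :
    IsCrossL (crossL τA τC) (crossL τB τC) (f.rTensor C) := hf.map id

theorem assoc : IsCrossL (crossL (crossL τA τB) τC) (crossL τA (crossL τB τC))
    (TensorProduct.assoc K A B C).toLinearMap := fun u z => by
  induction u using TensorProduct.induction_on with
  | zero => simp
  | add u v hu hv => simp only [map_add, add_tmul, hu, hv]
  | tmul u c =>
  induction u using TensorProduct.induction_on with
  | zero => simp
  | add u v hu hv => simp only [map_add, add_tmul, hu, hv]
  | tmul a b =>
    simp only [LinearEquiv.coe_coe, assoc_tmul, crossL_tmul]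
    generalize τC (c ⊗ₜ z) = u
    induction u using TensorProduct.induction_on with
    | zero => simp
    | add u v hu hv => simp only [map_add, tmul_add, hu, hv]
    | tmul z c =>
      simp only [slide_tmul, crossL_tmul]
      generalize τB (b ⊗ₜ z) = u
      induction u using TensorProduct.induction_on with
      | zero => simp
      | add u v hu hv => simp only [map_add, tmul_add, add_tmul, hu, hv]
      | tmul z b =>
        simp only [slide_tmul, assoc_tmul]
        generalize τA (a ⊗ₜ z) = u
        induction u using TensorProduct.induction_on with
        | zero => simp
        | add u v hu hv => simp only [map_add, add_tmul, hu, hv]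
        | tmul z b => simp

/-- This transfers compatibility from an isomorphism to its inverse, as is done for the associator.
-/
theorem of_surjective {g : B →ₗ[K] C} {f : A →ₗ[K] B} (hgf : IsCrossL τA τC (g ∘ₗ f))
    (hf : IsCrossL τA τB f) (hs : Function.Surjective f) : IsCrossL τB τC g := fun b z => by
  obtain ⟨a, rfl⟩ := hs b
  rw [hf, ← LinearMap.lTensor_comp_apply]
  exact hgf a z

theorem assoc_symm : IsCrossL (crossL τA (crossL τB τC)) (crossL (crossL τA τB) τC)
    (TensorProduct.assoc K A B C).symm.toLinearMap :=
  of_surjective (f := (TensorProduct.assoc K A B C).toLinearMap) (by simpa using id) assoc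
    (TensorProduct.assoc K A B C).surjective

theorem slide {b : A ⊗[K] B →ₗ[K] B ⊗[K] A} (hb : IsCrossL (crossL τA τB) (crossL τB τA) b) :
    IsCrossL (crossL τA (crossL τB τC)) (crossL τB (crossL τA τC)) (slide b) :=
  assoc.comp (hb.rTensor.comp assoc_symm)

/-- An element that crosses `Z` trivially may be inserted as an extra factor; the unit of `T(V)` is
the case of interest. -/
theorem mk {a : A} (ha : ∀ z, τA (a ⊗ₜ z) = z ⊗ₜ a) :
    IsCrossL τB (crossL τA τB) (TensorProduct.mk K A B a) := fun b z => by
  rw [mk_apply, crossL_tmul]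
  generalize τB (b ⊗ₜ z) = u
  induction u using TensorProduct.induction_on with
  | zero => simp
  | add u v hu hv => simp only [map_add, tmul_add, hu, hv]
  | tmul z b => simp [ha]

end IsCrossL

namespace IsCrossR

variable {ρA : Z ⊗[K] A →ₗ[K] A ⊗[K] Z} {ρB : Z ⊗[K] B →ₗ[K] B ⊗[K] Z}
  {ρC : Z ⊗[K] C →ₗ[K] C ⊗[K] Z} {ρD : Z ⊗[K] D →ₗ[K] D ⊗[K] Z}

theorem apply {f : A →ₗ[K] B} (hf : IsCrossR ρA ρB f) (u : Z ⊗[K] A) :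
    ρB (f.lTensor Z u) = f.rTensor Z (ρA u) := by
  induction u using TensorProduct.induction_on with
  | zero => simp
  | tmul a z => simpa using hf a z
  | add u v hu hv => simp only [map_add, hu, hv]

theorem id : IsCrossR ρA ρA LinearMap.id := fun a z => by simp

theorem zero : IsCrossR ρA ρB 0 := fun a z => by simp

theorem comp {g : B →ₗ[K] C} {f : A →ₗ[K] B} (hg : IsCrossR ρB ρC g) (hf : IsCrossR ρA ρB f) :
    IsCrossR ρA ρC (g ∘ₗ f) := fun a z => by
  rw [LinearMap.rTensor_comp, LinearMap.comp_apply, LinearMap.comp_apply, ← hf, ← hg.apply]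
  simp

theorem add {f g : A →ₗ[K] B} (hf : IsCrossR ρA ρB f) (hg : IsCrossR ρA ρB g) :
    IsCrossR ρA ρB (f + g) := fun a z => by
  simp [LinearMap.rTensor_add, tmul_add, hf a z, hg a z]

theorem sum {ι : Type*} (s : Finset ι) {f : ι → A →ₗ[K] B}
    (hf : ∀ i ∈ s, IsCrossR ρA ρB (f i)) : IsCrossR ρA ρB (∑ i ∈ s, f i) := by
  classical
  induction s using Finset.induction_on with
  | empty => simpa using zero
  | insert i s hi ih =>
    rw [Finset.sum_insert hi]
    exact (hf i (by simp)).add (ih fun j hj => hf j (by simp [hj]))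

theorem map {f : A →ₗ[K] B} {g : C →ₗ[K] D} (hf : IsCrossR ρA ρB f) (hg : IsCrossR ρC ρD g) :
    IsCrossR (crossR ρA ρC) (crossR ρB ρD) (TensorProduct.map f g) := fun z u => by
  induction u using TensorProduct.induction_on with
  | zero => simp
  | add u v hu hv => simp only [map_add, tmul_add, hu, hv]
  | tmul a c =>
    rw [map_tmul, crossR_apply, crossR_apply, slide_tmul, slide_tmul, hf]
    generalize ρA (z ⊗ₜ a) = u
    induction u using TensorProduct.induction_on with
    | zero => simp
    | add u v hu hv => simp only [map_add, add_tmul, hu, hv]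
    | tmul a z =>
      simp only [LinearMap.rTensor_tmul, assoc_tmul, LinearMap.lTensor_tmul, hg z c]
      generalize ρC (z ⊗ₜ c) = u
      induction u using TensorProduct.induction_on with
      | zero => simp
      | add u v hu hv => simp only [map_add, tmul_add, hu, hv]
      | tmul z a => simp

theorem lTensor {g : C →ₗ[K] D} (hg : IsCrossR ρC ρD g) :
    IsCrossR (crossR ρA ρC) (crossR ρA ρD) (g.lTensor A) := id.map hg

theorem rTensor {f : A →ₗ[K] B} (hf : IsCrossR ρA ρB f) :
    IsCrossR (crossR ρA ρC) (crossR ρB ρC) (f.rTensor C) := hf.map id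

theorem assoc : IsCrossR (crossR (crossR ρA ρB) ρC) (crossR ρA (crossR ρB ρC))
    (TensorProduct.assoc K A B C).toLinearMap := fun z u => by
  induction u using TensorProduct.induction_on with
  | zero => simp
  | add u v hu hv => simp only [map_add, tmul_add, hu, hv]
  | tmul u c =>
  induction u using TensorProduct.induction_on with
  | zero => simp
  | add u v hu hv => simp only [map_add, tmul_add, add_tmul, hu, hv]
  | tmul a b =>
    simp only [LinearEquiv.coe_coe, assoc_tmul, crossR_apply, slide_tmul]
    generalize ρA (z ⊗ₜ a) = u
    induction u using TensorProduct.induction_on with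
    | zero => simp
    | add u v hu hv => simp only [map_add, add_tmul, hu, hv]
    | tmul a z =>
      simp only [assoc_tmul, LinearMap.lTensor_tmul, crossR_apply, slide_tmul]
      generalize ρB (z ⊗ₜ b) = u
      induction u using TensorProduct.induction_on with
      | zero => simp
      | add u v hu hv => simp only [map_add, tmul_add, add_tmul, hu, hv]
      | tmul b z =>
        simp only [assoc_tmul, assoc_symm_tmul, LinearMap.lTensor_tmul]
        generalize ρC (z ⊗ₜ c) = u
        induction u using TensorProduct.induction_on with
        | zero => simp
        | add u v hu hv => simp only [map_add, tmul_add, hu, hv]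
        | tmul z b => simp

theorem of_surjective {g : B →ₗ[K] C} {f : A →ₗ[K] B} (hgf : IsCrossR ρA ρC (g ∘ₗ f))
    (hf : IsCrossR ρA ρB f) (hs : Function.Surjective f) : IsCrossR ρB ρC g := fun z b => by
  obtain ⟨a, rfl⟩ := hs b
  rw [hf, ← LinearMap.rTensor_comp_apply]
  exact hgf z a

theorem assoc_symm : IsCrossR (crossR ρA (crossR ρB ρC)) (crossR (crossR ρA ρB) ρC)
    (TensorProduct.assoc K A B C).symm.toLinearMap :=
  of_surjective (f := (TensorProduct.assoc K A B C).toLinearMap) (by simpa using id) assoc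
    (TensorProduct.assoc K A B C).surjective

theorem slide {b : A ⊗[K] B →ₗ[K] B ⊗[K] A} (hb : IsCrossR (crossR ρA ρB) (crossR ρB ρA) b) :
    IsCrossR (crossR ρA (crossR ρB ρC)) (crossR ρB (crossR ρA ρC)) (slide b) :=
  assoc.comp (hb.rTensor.comp assoc_symm)

theorem mk {a : A} (ha : ∀ z, ρA (z ⊗ₜ a) = a ⊗ₜ z) :
    IsCrossR ρB (crossR ρA ρB) (TensorProduct.mk K A B a) := fun z b => by
  rw [mk_apply, crossR_apply, slide_tmul, ha, assoc_tmul, LinearMap.lTensor_tmul]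
  generalize ρB (z ⊗ₜ b) = u
  induction u using TensorProduct.induction_on with
  | zero => simp
  | add u v hu hv => simp only [map_add, tmul_add, hu, hv]
  | tmul z b => simp

theorem mk_flip {b : B} (hb : ∀ z, ρB (z ⊗ₜ b) = b ⊗ₜ z) :
    IsCrossR ρA (crossR ρA ρB) ((TensorProduct.mk K A B).flip b) := fun z a => by
  rw [LinearMap.flip_apply, mk_apply, crossR_apply, slide_tmul]
  generalize ρA (z ⊗ₜ a) = u
  induction u using TensorProduct.induction_on with
  | zero => simp
  | add u v hu hv => simp only [map_add, add_tmul, hu, hv]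
  | tmul z b => simp [hb]

end IsCrossR

/-- The crossing `b : P ⊗ Q → Q ⊗ P` on the middle factors of `(A ⊗ P) ⊗ (Q ⊗ B)`. -/
def midCross (b : P ⊗[K] Q →ₗ[K] Q ⊗[K] P) :
    (A ⊗[K] P) ⊗[K] (Q ⊗[K] B) →ₗ[K] (A ⊗[K] Q) ⊗[K] (P ⊗[K] B) :=
  (TensorProduct.assoc K A Q (P ⊗[K] B)).symm.toLinearMap ∘ₗ (slide b).lTensor A ∘ₗ
    (TensorProduct.assoc K A P (Q ⊗[K] B)).toLinearMap

theorem midCross_tmul (χ : P ⊗[K] Q →ₗ[K] Q ⊗[K] P) (a : A) (p : P) (q : Q) (b : B) :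
    midCross χ ((a ⊗ₜ p) ⊗ₜ (q ⊗ₜ b)) =
      (TensorProduct.assoc K A Q (P ⊗[K] B)).symm
        (a ⊗ₜ TensorProduct.assoc K Q P B (χ (p ⊗ₜ q) ⊗ₜ b)) := by
  simp [midCross]

theorem crossR_comp_crossL {τA : A ⊗[K] Z →ₗ[K] Z ⊗[K] A} {τB : B ⊗[K] Z →ₗ[K] Z ⊗[K] B}
    {ρA : Z ⊗[K] A →ₗ[K] A ⊗[K] Z} {ρB : Z ⊗[K] B →ₗ[K] B ⊗[K] Z}
    (hA : ∀ u, ρA (τA u) = u) (hB : ∀ u, ρB (τB u) = u) (u : (A ⊗[K] B) ⊗[K] Z) :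
    crossR ρA ρB (crossL τA τB u) = u := by
  have h : ∀ w : A ⊗[K] (Z ⊗[K] B), slide ρA (slide τA w) = w := fun w => by
    have hA' : ρA ∘ₗ τA = LinearMap.id := LinearMap.ext hA
    simp only [slide, LinearMap.comp_apply, LinearEquiv.coe_coe, LinearEquiv.symm_apply_apply]
    rw [← LinearMap.rTensor_comp_apply, hA']
    simp
  have hB' : ρB ∘ₗ τB = LinearMap.id := LinearMap.ext hB
  simp only [crossR_apply, crossL, LinearMap.comp_apply, h]
  rw [← LinearMap.lTensor_comp_apply, hB']
  simp

theorem crossL_comp_crossR {τA : A ⊗[K] Z →ₗ[K] Z ⊗[K] A} {τB : B ⊗[K] Z →ₗ[K] Z ⊗[K] B}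
    {ρA : Z ⊗[K] A →ₗ[K] A ⊗[K] Z} {ρB : Z ⊗[K] B →ₗ[K] B ⊗[K] Z}
    (hA : ∀ u, τA (ρA u) = u) (hB : ∀ u, τB (ρB u) = u) (u : Z ⊗[K] (A ⊗[K] B)) :
    crossL τA τB (crossR ρA ρB u) = u := by
  have h : ∀ w : Z ⊗[K] (A ⊗[K] B), slide τA (slide ρA w) = w := fun w => by
    have hA' : τA ∘ₗ ρA = LinearMap.id := LinearMap.ext hA
    simp only [slide, LinearMap.comp_apply, LinearEquiv.coe_coe, LinearEquiv.symm_apply_apply]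
    rw [← LinearMap.rTensor_comp_apply, hA']
    simp
  have hB' : τB ∘ₗ ρB = LinearMap.id := LinearMap.ext hB
  simp only [crossR_apply, crossL, LinearMap.comp_apply, LinearEquiv.coe_coe,
    LinearEquiv.apply_symm_apply]
  rw [← LinearMap.lTensor_comp_apply, hB']
  simp [h]

/-- Inverting the crossings reverses the direction of travel of `Z`, so left compatibility turns
into right compatibility. This carries what is proved for `β` over to `β⁻¹`. -/
theorem IsCrossL.inv {τA : A ⊗[K] Z →ₗ[K] Z ⊗[K] A} {τB : B ⊗[K] Z →ₗ[K] Z ⊗[K] B}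
    {ρA : Z ⊗[K] A →ₗ[K] A ⊗[K] Z} {ρB : Z ⊗[K] B →ₗ[K] B ⊗[K] Z}
    (hA : ∀ u, τA (ρA u) = u) (hB : ∀ u, ρB (τB u) = u) {f : A →ₗ[K] B}
    (hf : IsCrossL τA τB f) : IsCrossR ρA ρB f := fun z a => by
  have h := hf.apply (ρA (z ⊗ₜ a))
  rw [hA, LinearMap.lTensor_tmul] at h
  rw [← h, hB]

theorem IsCrossR.inv {τA : A ⊗[K] Z →ₗ[K] Z ⊗[K] A} {τB : B ⊗[K] Z →ₗ[K] Z ⊗[K] B}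
    {ρA : Z ⊗[K] A →ₗ[K] A ⊗[K] Z} {ρB : Z ⊗[K] B →ₗ[K] B ⊗[K] Z}
    (hA : ∀ u, ρA (τA u) = u) (hB : ∀ u, τB (ρB u) = u) {f : A →ₗ[K] B}
    (hf : IsCrossR ρA ρB f) : IsCrossL τA τB f := fun a z => by
  have h := hf.apply (τA (a ⊗ₜ z))
  rw [hA, LinearMap.rTensor_tmul] at h
  rw [← h, hB]

end Crossings

/-! ### Extending crossings from `V` to `T(V)` by recursion along concatenation. -/

section ConsCrossings

variable {K : Type*} [Field K] {V : Type*} [AddCommGroup V] [Module K V]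
  {A B S X Y Z : Type*}
  [AddCommGroup A] [Module K A] [AddCommGroup B] [Module K B]
  [AddCommGroup S] [Module K S] [AddCommGroup X] [Module K X]
  [AddCommGroup Y] [Module K Y] [AddCommGroup Z] [Module K Z]

variable (K V) in
/-- Concatenation `V ⊗ T(V) → T(V)`. -/
def cons : V ⊗[K] T K V →ₗ[K] T K V :=
  LinearMap.mul' K (T K V) ∘ₗ (incl K V).rTensor (T K V)

@[simp]
theorem cons_tmul (v : V) (t : T K V) : cons K V (v ⊗ₜ t) = incl K V v * t := by
  simp [cons]

theorem eq_top_of_cons (P : Submodule K (T K V)) (h1 : (1 : T K V) ∈ P)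
    (hc : ∀ v t, t ∈ P → incl K V v * t ∈ P) : P = ⊤ := by
  -- The claim is strengthened to stability under left multiplication by every `a`, since induction
  -- on the tensor algebra passes through arbitrary products.
  suffices h : ∀ a : T K V, ∀ t ∈ P, a * t ∈ P from
    eq_top_iff.2 fun a _ => by simpa using h a 1 h1
  intro a
  induction a using TensorAlgebra.induction with
  | algebraMap r =>
    intro t ht
    rw [← Algebra.smul_def]
    exact P.smul_mem r ht
  | ι v => exact fun t ht => hc v t ht
  | mul a b ha hb =>
    intro t ht
    rw [mul_assoc]
    exact ha _ (hb t ht)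
  | add a b ha hb =>
    intro t ht
    rw [add_mul]
    exact P.add_mem (ha t ht) (hb t ht)

theorem cons_induction {p : T K V → Prop} (one : p 1)
    (cons : ∀ v t, p t → p (incl K V v * t)) (add : ∀ s t, p s → p t → p (s + t))
    (smul : ∀ (r : K) t, p t → p (r • t)) (t : T K V) : p t := by
  let P : Submodule K (T K V) :=
    { carrier := {t | p t}
      add_mem' := fun {a b} ha hb => add a b ha hb
      zero_mem' := by simpa using smul 0 1 one
      smul_mem' := fun r x hx => smul r x hx }
  have h : P = ⊤ := eq_top_of_cons P one cons
  have ht : t ∈ P := h ▸ Submodule.mem_top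
  exact ht

theorem slide_lTensor {P Q : Type*} [AddCommGroup P] [Module K P] [AddCommGroup Q] [Module K Q]
    (b : P ⊗[K] Q →ₗ[K] Q ⊗[K] P) (f : X →ₗ[K] Y) (u : P ⊗[K] (Q ⊗[K] X)) :
    slide b ((f.lTensor Q).lTensor P u) = (f.lTensor P).lTensor Q (slide b u) := by
  induction u using TensorProduct.induction_on with
  | zero => simp
  | add u v hu hv => simp only [map_add, hu, hv]
  | tmul p u =>
  induction u using TensorProduct.induction_on with
  | zero => simp
  | add u v hu hv => simp only [map_add, tmul_add, hu, hv]
  | tmul q x =>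
    simp only [LinearMap.lTensor_tmul, slide_tmul]
    generalize b (p ⊗ₜ q) = u
    induction u using TensorProduct.induction_on with
    | zero => simp
    | add u v hu hv => simp only [map_add, add_tmul, hu, hv]
    | tmul q p => simp

/-- Compatibility is assumed only at the single element `x`: inside an induction it is known for one
element at a time, not yet for the whole map. -/
theorem crossR_tmul_tmul {W : Type*} [AddCommGroup W] [Module K W]
    (τ : Z ⊗[K] W →ₗ[K] W ⊗[K] Z) {ρX : Z ⊗[K] X →ₗ[K] X ⊗[K] Z}
    {ρY : Z ⊗[K] Y →ₗ[K] Y ⊗[K] Z} {f : X →ₗ[K] Y} {x : X}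
    (h : ∀ z, ρY (z ⊗ₜ f x) = f.rTensor Z (ρX (z ⊗ₜ x))) (z : Z) (w : W) :
    crossR τ ρY (z ⊗ₜ (w ⊗ₜ f x)) =
      (f.lTensor W).rTensor Z (crossR τ ρX (z ⊗ₜ (w ⊗ₜ x))) := by
  simp only [crossR_apply, slide_tmul]
  generalize τ (z ⊗ₜ w) = u
  induction u using TensorProduct.induction_on with
  | zero => simp
  | add u v hu hv => simp only [map_add, add_tmul, hu, hv]
  | tmul w z =>
    simp only [assoc_tmul, LinearMap.lTensor_tmul, h]
    generalize ρX (z ⊗ₜ x) = u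
    induction u using TensorProduct.induction_on with
    | zero => simp
    | add u v hu hv => simp only [map_add, tmul_add, hu, hv]
    | tmul q p => simp

/-- Induction for crossings: if `S` is generated from `E` by a map `V ⊗ S → S` which commutes
with a crossing, and `f` satisfies a recursion along this map with data commuting with the
crossings, then so does `f`. -/
theorem IsCrossR.of_recursion {τV : Z ⊗[K] V →ₗ[K] V ⊗[K] Z} {ρS : Z ⊗[K] S →ₗ[K] S ⊗[K] Z}
    {ρX : Z ⊗[K] X →ₗ[K] X ⊗[K] Z} {consS : V ⊗[K] S →ₗ[K] S} {E : Set S}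
    (hgen : ∀ P : Submodule K S, E ⊆ P → (∀ v s, s ∈ P → consS (v ⊗ₜ s) ∈ P) → P = ⊤)
    (hcons : IsCrossR (crossR τV ρS) ρS consS) {f : S →ₗ[K] X} {g : V ⊗[K] S →ₗ[K] X}
    {φ : V ⊗[K] X →ₗ[K] X} (hg : IsCrossR (crossR τV ρS) ρX g)
    (hφ : IsCrossR (crossR τV ρX) ρX φ)
    (hf : ∀ v s, f (consS (v ⊗ₜ s)) = g (v ⊗ₜ s) + φ (v ⊗ₜ f s))
    (hE : ∀ e ∈ E, ∀ z, ρX (z ⊗ₜ f e) = f.rTensor Z (ρS (z ⊗ₜ e))) : IsCrossR ρS ρX f := by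
  have hf' : f ∘ₗ consS = g + φ ∘ₗ f.lTensor V := by
    ext v s
    simpa using hf v s
  let P : Submodule K S :=
    { carrier := {s | ∀ z, ρX (z ⊗ₜ f s) = f.rTensor Z (ρS (z ⊗ₜ s))}
      add_mem' := fun {a b} ha hb z => by simp only [map_add, tmul_add, ha z, hb z]
      zero_mem' := fun z => by simp
      smul_mem' := fun r x hx z => by simp only [map_smul, tmul_smul, hx z] }
  have hP : P = ⊤ := by
    refine hgen P hE fun v s hs z => ?_
    rw [hf, tmul_add, map_add, hg, hφ, crossR_tmul_tmul τV hs, hcons,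
      ← LinearMap.rTensor_comp_apply, ← LinearMap.rTensor_comp_apply, hf',
      LinearMap.rTensor_add, LinearMap.add_apply]
  intro z s
  have hs : s ∈ P := hP ▸ Submodule.mem_top
  exact hs z

theorem IsCrossL.of_recursion {τV : V ⊗[K] Z →ₗ[K] Z ⊗[K] V} {τS : S ⊗[K] Z →ₗ[K] Z ⊗[K] S}
    {τX : X ⊗[K] Z →ₗ[K] Z ⊗[K] X} {consS : V ⊗[K] S →ₗ[K] S} {E : Set S}
    (hgen : ∀ P : Submodule K S, E ⊆ P → (∀ v s, s ∈ P → consS (v ⊗ₜ s) ∈ P) → P = ⊤)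
    (hcons : IsCrossL (crossL τV τS) τS consS) {f : S →ₗ[K] X} {g : V ⊗[K] S →ₗ[K] X}
    {φ : V ⊗[K] X →ₗ[K] X} (hg : IsCrossL (crossL τV τS) τX g)
    (hφ : IsCrossL (crossL τV τX) τX φ)
    (hf : ∀ v s, f (consS (v ⊗ₜ s)) = g (v ⊗ₜ s) + φ (v ⊗ₜ f s))
    (hE : ∀ e ∈ E, ∀ z, τX (f e ⊗ₜ z) = f.lTensor Z (τS (e ⊗ₜ z))) : IsCrossL τS τX f := by
  have hf' : f ∘ₗ consS = g + φ ∘ₗ f.lTensor V := by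
    ext v s
    simpa using hf v s
  let P : Submodule K S :=
    { carrier := {s | ∀ z, τX (f s ⊗ₜ z) = f.lTensor Z (τS (s ⊗ₜ z))}
      add_mem' := fun {a b} ha hb z => by simp only [map_add, add_tmul, ha z, hb z]
      zero_mem' := fun z => by simp
      smul_mem' := fun r x hx z => by simp only [map_smul, ← smul_tmul', hx z] }
  have hP : P = ⊤ := by
    refine hgen P hE fun v s hs z => ?_
    have hs' : τX (f s ⊗ₜ z) = f.lTensor Z (τS (s ⊗ₜ z)) := hs z
    rw [hf, add_tmul, map_add, hg, hφ, crossL_tmul τV τX, hs', ← LinearMap.lTensor_tmul,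
      slide_lTensor, ← crossL_tmul, hcons, ← LinearMap.lTensor_comp_apply, ← LinearMap.lTensor_comp_apply, hf',
      LinearMap.lTensor_add, LinearMap.add_apply]
  intro s z
  have hs : s ∈ P := hP ▸ Submodule.mem_top
  exact hs z

/-- `β : T(V) ⊗ A → A ⊗ T(V)` is the extension of `ρ : V ⊗ A → A ⊗ V` along concatenation. -/
structure IsExtL (ρ : V ⊗[K] A →ₗ[K] A ⊗[K] V) (β : T K V ⊗[K] A →ₗ[K] A ⊗[K] T K V) :
    Prop where
  one : ∀ a, β (1 ⊗ₜ a) = a ⊗ₜ 1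
  cons : IsCrossL (crossL ρ β) β (cons K V)

/-- `β : A ⊗ T(V) → T(V) ⊗ A` is the extension of `τ : A ⊗ V → V ⊗ A` along concatenation. -/
structure IsExtR (τ : A ⊗[K] V →ₗ[K] V ⊗[K] A) (β : A ⊗[K] T K V →ₗ[K] T K V ⊗[K] A) :
    Prop where
  one : ∀ a, β (a ⊗ₜ 1) = 1 ⊗ₜ a
  cons : IsCrossR (crossR τ β) β (cons K V)

theorem IsExtL.cons_tmul {ρ : V ⊗[K] A →ₗ[K] A ⊗[K] V} {β : T K V ⊗[K] A →ₗ[K] A ⊗[K] T K V}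
    (h : IsExtL ρ β) (v : V) (t : T K V) (a : A) :
    β ((incl K V v * t) ⊗ₜ a) =
      (QuantumBInf.cons K V).lTensor A (slide ρ (v ⊗ₜ β (t ⊗ₜ a))) := by
  rw [← QuantumBInf.cons_tmul, h.cons, crossL_tmul]

theorem IsExtR.cons_tmul {τ : A ⊗[K] V →ₗ[K] V ⊗[K] A} {β : A ⊗[K] T K V →ₗ[K] T K V ⊗[K] A}
    (h : IsExtR τ β) (a : A) (v : V) (t : T K V) :
    β (a ⊗ₜ (incl K V v * t)) =
      (QuantumBInf.cons K V).rTensor A (crossR τ β (a ⊗ₜ (v ⊗ₜ t))) := by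
  rw [← QuantumBInf.cons_tmul, h.cons]

/-- A tensor crosses one vector at a time, so compatibility with a single vector implies
compatibility with all of `T(V)`. This reduces statements about `beta` to statements about
`betaOne`. -/
theorem IsExtL.isCrossR {ρA : V ⊗[K] A →ₗ[K] A ⊗[K] V} {βA : T K V ⊗[K] A →ₗ[K] A ⊗[K] T K V}
    {ρB : V ⊗[K] B →ₗ[K] B ⊗[K] V} {βB : T K V ⊗[K] B →ₗ[K] B ⊗[K] T K V}
    (hA : IsExtL ρA βA) (hB : IsExtL ρB βB) {f : A →ₗ[K] B} (hf : IsCrossR ρA ρB f) :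
    IsCrossR βA βB f := fun t a => by
  induction t using cons_induction with
  | one => simp [hA.one, hB.one]
  | add s t hs ht => simp only [map_add, add_tmul, hs, ht]
  | smul r t ht => simp only [map_smul, ← smul_tmul', ht]
  | cons v t ht =>
    rw [hA.cons_tmul, hB.cons_tmul, ht]
    generalize βA (t ⊗ₜ a) = u
    induction u using TensorProduct.induction_on with
    | zero => simp
    | add u v hu hv => simp only [map_add, tmul_add, hu, hv]
    | tmul a t =>
      simp only [LinearMap.rTensor_tmul, slide_tmul, hf v a]
      generalize ρA (v ⊗ₜ a) = u
      induction u using TensorProduct.induction_on with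
      | zero => simp
      | add u v hu hv => simp only [map_add, add_tmul, hu, hv]
      | tmul a t => simp

theorem IsExtR.isCrossL {τA : A ⊗[K] V →ₗ[K] V ⊗[K] A} {βA : A ⊗[K] T K V →ₗ[K] T K V ⊗[K] A}
    {τB : B ⊗[K] V →ₗ[K] V ⊗[K] B} {βB : B ⊗[K] T K V →ₗ[K] T K V ⊗[K] B}
    (hA : IsExtR τA βA) (hB : IsExtR τB βB) {f : A →ₗ[K] B} (hf : IsCrossL τA τB f) :
    IsCrossL βA βB f := fun a t => by
  -- Here `v` is crossed before `t`, which replaces `a` by other elements; the induction hypothesis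
  -- is needed for all of them.
  induction t using cons_induction generalizing a with
  | one => simp [hA.one, hB.one]
  | add s t hs ht => simp only [map_add, tmul_add, hs, ht]
  | smul r t ht => simp only [map_smul, tmul_smul, ht]
  | cons v t ht =>
    rw [hA.cons_tmul, hB.cons_tmul, crossR_apply, crossR_apply, slide_tmul, slide_tmul, hf]
    generalize τA (a ⊗ₜ v) = u
    induction u using TensorProduct.induction_on with
    | zero => simp
    | add u v hu hv => simp only [map_add, add_tmul, hu, hv]
    | tmul v a =>
      simp only [LinearMap.lTensor_tmul, assoc_tmul, ht]
      generalize βA (a ⊗ₜ t) = u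
      induction u using TensorProduct.induction_on with
      | zero => simp
      | add u v hu hv => simp only [map_add, tmul_add, hu, hv]
      | tmul a t => simp

/-- Crossing `A ⊗ B` one factor after the other is again an extension from `V` to `T(V)`. It lets
`IsExtL.isCrossR` be used for maps such as products and coproducts, whose source or target is a
tensor product. -/
theorem IsExtL.crossR {ρA : V ⊗[K] A →ₗ[K] A ⊗[K] V} {βA : T K V ⊗[K] A →ₗ[K] A ⊗[K] T K V}
    {ρB : V ⊗[K] B →ₗ[K] B ⊗[K] V} {βB : T K V ⊗[K] B →ₗ[K] B ⊗[K] T K V}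
    (hA : IsExtL ρA βA) (hB : IsExtL ρB βB) : IsExtL (crossR ρA ρB) (crossR βA βB) where
  one u := by
    induction u using TensorProduct.induction_on with
    | zero => simp
    | add u v hu hv => simp only [map_add, tmul_add, add_tmul, hu, hv]
    | tmul a b => simp [crossR_apply, hA.one, hB.one]
  cons := fun u w => by
    induction u using TensorProduct.induction_on with
    | zero => simp
    | add u v hu hv => simp only [map_add, add_tmul, hu, hv]
    | tmul v t =>
    induction w using TensorProduct.induction_on with
    | zero => simp
    | add u v hu hv => simp only [map_add, tmul_add, hu, hv]
    | tmul a b =>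
      simp only [QuantumBInf.cons_tmul, crossL_tmul, crossR_apply, slide_tmul, hA.cons_tmul]
      generalize βA (t ⊗ₜ a) = u
      induction u using TensorProduct.induction_on with
      | zero => simp
      | add u v hu hv => simp only [map_add, tmul_add, add_tmul, hu, hv]
      | tmul a t =>
        simp only [slide_tmul, assoc_tmul, LinearMap.lTensor_tmul]
        -- The crossings of `v` past `a` and of `t` past `b` involve disjoint factors. Their results
        -- are kept as unexpanded tensors `x` and `w`, so that each can be expanded when convenient.
        have key : ∀ (x : A ⊗[K] V) (w : B ⊗[K] T K V), βB (t ⊗ₜ b) = w →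
            (TensorProduct.assoc K A B (T K V)).symm (βB.lTensor A
              (TensorProduct.assoc K A (T K V) B ((QuantumBInf.cons K V).lTensor A
                (TensorProduct.assoc K A V (T K V) (x ⊗ₜ t)) ⊗ₜ b))) =
            (TensorProduct.assoc K A B (T K V)).symm (((QuantumBInf.cons K V).lTensor B).lTensor A
              ((slide ρB).lTensor A (TensorProduct.assoc K A V (B ⊗[K] T K V) (x ⊗ₜ w)))) := by
          intro x w hw
          induction x using TensorProduct.induction_on with
          | zero => simp
          | add u v hu hv => simp only [map_add, add_tmul, hu, hv]
          | tmul a v => simp [hB.cons_tmul, hw]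
        rw [key _ _ rfl]
        generalize βB (t ⊗ₜ b) = w
        induction w using TensorProduct.induction_on with
        | zero => simp
        | add u v hu hv => simp only [map_add, tmul_add, hu, hv]
        | tmul b t =>
          simp only [assoc_symm_tmul, slide_tmul, crossR_apply]
          generalize ρA (v ⊗ₜ a) = x
          induction x using TensorProduct.induction_on with
          | zero => simp
          | add u v hu hv => simp only [map_add, add_tmul, hu, hv]
          | tmul a v =>
            simp only [assoc_tmul, LinearMap.lTensor_tmul, slide_tmul]
            generalize ρB (v ⊗ₜ b) = x
            induction x using TensorProduct.induction_on with
            | zero => simp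
            | add u v hu hv => simp only [map_add, tmul_add, add_tmul, hu, hv]
            | tmul a v => simp

theorem IsExtR.crossL {τA : A ⊗[K] V →ₗ[K] V ⊗[K] A} {βA : A ⊗[K] T K V →ₗ[K] T K V ⊗[K] A}
    {τB : B ⊗[K] V →ₗ[K] V ⊗[K] B} {βB : B ⊗[K] T K V →ₗ[K] T K V ⊗[K] B}
    (hA : IsExtR τA βA) (hB : IsExtR τB βB) : IsExtR (crossL τA τB) (crossL βA βB) where
  one u := by
    induction u using TensorProduct.induction_on with
    | zero => simp
    | add u v hu hv => simp only [map_add, tmul_add, add_tmul, hu, hv]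
    | tmul a b => simp [hA.one, hB.one]
  cons := fun u w => by
    induction u using TensorProduct.induction_on with
    | zero => simp
    | add u v hu hv => simp only [map_add, add_tmul, hu, hv]
    | tmul a b =>
    induction w using TensorProduct.induction_on with
    | zero => simp
    | add u v hu hv => simp only [map_add, tmul_add, hu, hv]
    | tmul v t =>
      simp only [QuantumBInf.cons_tmul, crossL_tmul, crossR_apply, slide_tmul, hB.cons_tmul]
      generalize τB (b ⊗ₜ v) = u
      induction u using TensorProduct.induction_on with
      | zero => simp
      | add u v hu hv => simp only [map_add, tmul_add, add_tmul, hu, hv]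
      | tmul v b =>
        simp only [slide_tmul, assoc_tmul, LinearMap.lTensor_tmul]
        have key : ∀ (w : T K V ⊗[K] B),
            slide βA (a ⊗ₜ ((QuantumBInf.cons K V).rTensor B
              ((TensorProduct.assoc K V (T K V) B).symm (v ⊗ₜ w)))) =
            (QuantumBInf.cons K V).rTensor (A ⊗[K] B)
              ((TensorProduct.assoc K V (T K V) (A ⊗[K] B)).symm
                ((slide βA).lTensor V (TensorProduct.assoc K V A (T K V ⊗[K] B)
                  (τA (a ⊗ₜ v) ⊗ₜ w)))) := by
          intro w
          induction w using TensorProduct.induction_on with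
          | zero => simp
          | add u v hu hv => simp only [map_add, tmul_add, hu, hv]
          | tmul t b =>
            simp only [assoc_symm_tmul, LinearMap.rTensor_tmul, QuantumBInf.cons_tmul, slide_tmul,
              hA.cons_tmul, crossR_apply]
            generalize τA (a ⊗ₜ v) = x
            induction x using TensorProduct.induction_on with
            | zero => simp
            | add u v hu hv => simp only [map_add, add_tmul, hu, hv]
            | tmul v a =>
              simp only [assoc_tmul, LinearMap.lTensor_tmul, slide_tmul]
              generalize βA (a ⊗ₜ t) = x
              induction x using TensorProduct.induction_on with
              | zero => simp
              | add u v hu hv => simp only [map_add, tmul_add, add_tmul, hu, hv]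
              | tmul v a => simp
        rw [key]
        generalize τA (a ⊗ₜ v) = x
        induction x using TensorProduct.induction_on with
        | zero => simp
        | add u v hu hv => simp only [map_add, add_tmul, hu, hv]
        | tmul v a => simp

/-- The extension on the left moves `t` first and `v` last; the extension on the right brings back
`v` first and `t` last. The crossings therefore cancel from the inside out. -/
theorem IsExtR.comp_isExtL {b : V ⊗[K] A →ₗ[K] A ⊗[K] V} {c : A ⊗[K] V →ₗ[K] V ⊗[K] A}
    {β : T K V ⊗[K] A →ₗ[K] A ⊗[K] T K V} {γ : A ⊗[K] T K V →ₗ[K] T K V ⊗[K] A}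
    (hβ : IsExtL b β) (hγ : IsExtR c γ) (hcb : ∀ u, c (b u) = u) (u : T K V ⊗[K] A) :
    γ (β u) = u := by
  have hs : ∀ w : V ⊗[K] (A ⊗[K] T K V), slide c (slide b w) = w := fun w => by
    have h : c ∘ₗ b = LinearMap.id := LinearMap.ext hcb
    simp only [slide, LinearMap.comp_apply, LinearEquiv.coe_coe, LinearEquiv.symm_apply_apply]
    rw [← LinearMap.rTensor_comp_apply, h]
    simp
  induction u using TensorProduct.induction_on with
  | zero => simp
  | add u v hu hv => simp only [map_add, hu, hv]
  | tmul t a =>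
  induction t using cons_induction with
  | one => simp [hβ.one, hγ.one]
  | add s t hs ht => simp only [map_add, add_tmul, hs, ht]
  | smul r t ht => simp only [map_smul, ← smul_tmul', ht]
  | cons v t ht =>
    rw [hβ.cons_tmul, hγ.cons.apply, crossR_apply, hs, LinearMap.lTensor_tmul, ht]
    simp

theorem IsExtL.comp_isExtR {b : V ⊗[K] A →ₗ[K] A ⊗[K] V} {c : A ⊗[K] V →ₗ[K] V ⊗[K] A}
    {β : T K V ⊗[K] A →ₗ[K] A ⊗[K] T K V} {γ : A ⊗[K] T K V →ₗ[K] T K V ⊗[K] A}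
    (hβ : IsExtL b β) (hγ : IsExtR c γ) (hbc : ∀ u, b (c u) = u) (u : A ⊗[K] T K V) :
    β (γ u) = u := by
  induction u using TensorProduct.induction_on with
  | zero => simp
  | add u v hu hv => simp only [map_add, hu, hv]
  | tmul a t =>
  induction t using cons_induction generalizing a with
  | one => simp [hβ.one, hγ.one]
  | add s t hs ht => simp only [map_add, tmul_add, hs, ht]
  | smul r t ht => simp only [map_smul, tmul_smul, ht]
  | cons v t ht =>
    rw [hγ.cons_tmul, hβ.cons.apply]
    have key : ∀ x : V ⊗[K] A, QuantumBInf.crossL b β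
        ((TensorProduct.assoc K V (T K V) A).symm (γ.lTensor V (TensorProduct.assoc K V A (T K V)
          (x ⊗ₜ t)))) = TensorProduct.assoc K A V (T K V) (b x ⊗ₜ t) := by
      intro x
      induction x using TensorProduct.induction_on with
      | zero => simp
      | add u v hu hv => simp only [map_add, add_tmul, hu, hv]
      | tmul v a =>
        simp only [QuantumBInf.crossL, LinearMap.comp_apply, LinearEquiv.coe_coe, LinearEquiv.apply_symm_apply,
          assoc_tmul, LinearMap.lTensor_tmul, ht, slide_tmul]
    rw [crossR_apply, slide_tmul, key, hbc]
    simp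

/-- The extension of `b : V ⊗ A → A ⊗ V` along concatenation. -/
def extL (b : V ⊗[K] A →ₗ[K] A ⊗[K] V) : T K V ⊗[K] A →ₗ[K] A ⊗[K] T K V :=
  TensorProduct.lift (leftRec ((TensorProduct.mk K A (T K V)).flip 1)
    (LinearMap.mk₂ K
      (fun v g => (cons K V).lTensor A ∘ₗ slide b ∘ₗ TensorProduct.mk K V (A ⊗[K] T K V) v ∘ₗ g)
      (by intros; ext; simp)
      (by intros; ext; simp)
      (by intros; ext; simp [tmul_add])
      (by intros; ext; simp)))

theorem isExtL_extL (b : V ⊗[K] A →ₗ[K] A ⊗[K] V) : IsExtL b (extL b) where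
  one a := by simp [extL, leftRec_one]
  cons u a := by
    induction u using TensorProduct.induction_on with
    | zero => simp
    | add u v hu hv => simp only [map_add, add_tmul, hu, hv]
    | tmul v t =>
      rw [crossL_tmul, QuantumBInf.cons_tmul, extL, lift.tmul, leftRec_mul]
      rfl

/-- The extension of `c : A ⊗ V → V ⊗ A` along concatenation. -/
def extR (c : A ⊗[K] V →ₗ[K] V ⊗[K] A) : A ⊗[K] T K V →ₗ[K] T K V ⊗[K] A :=
  TensorProduct.lift (leftRec (TensorProduct.mk K (T K V) A 1)
    (LinearMap.mk₂ K
      (fun w g => (cons K V).rTensor A ∘ₗ (TensorProduct.assoc K V (T K V) A).symm.toLinearMap ∘ₗ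
        g.lTensor V ∘ₗ c ∘ₗ (TensorProduct.mk K A V).flip w)
      (by intros; ext; simp)
      (by intros; ext; simp)
      (by intros; ext; simp [LinearMap.lTensor_add])
      (by intros; ext; simp [LinearMap.lTensor_smul]))).flip

theorem isExtR_extR (c : A ⊗[K] V →ₗ[K] V ⊗[K] A) : IsExtR c (extR c) where
  one a := by simp [extR, leftRec_one]
  cons a u := by
    induction u using TensorProduct.induction_on with
    | zero => simp
    | add u v hu hv => simp only [map_add, tmul_add, hu, hv]
    | tmul v t =>
      rw [crossR_apply, QuantumBInf.cons_tmul, slide_tmul, extR, lift.tmul, LinearMap.flip_apply,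
        leftRec_mul]
      simp only [LinearMap.mk₂_apply, LinearMap.comp_apply, LinearMap.flip_apply, mk_apply,
        LinearEquiv.coe_coe]
      generalize c (a ⊗ₜ v) = x
      congr 2
      induction x using TensorProduct.induction_on with
      | zero => simp
      | add u v hu hv => simp only [map_add, add_tmul, hu, hv]
      | tmul v a => simp

/-- Together with `isExtL_beta` this exhibits `β` as a double extension of `σ`, first in the right
factor and then in the left one; later arguments use these two facts in place of the recursive
definitions. -/
theorem isExtR_betaOne (σ : V ⊗[K] V →ₗ[K] V ⊗[K] V) : IsExtR σ (betaOne σ) where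
  one a := by simp [betaOne, passOne, leftRec_one]
  cons a u := by
    induction u using TensorProduct.induction_on with
    | zero => simp
    | add u v hu hv => simp only [map_add, tmul_add, hu, hv]
    | tmul v t =>
      rw [crossR_apply, cons_tmul, slide_tmul, betaOne, lift.tmul, LinearMap.flip_apply,
        passOne, leftRec_mul]
      simp only [passStep, LinearMap.mk₂_apply, LinearMap.comp_apply, LinearMap.flip_apply,
        mk_apply, LinearEquiv.coe_coe]
      generalize σ (a ⊗ₜ v) = x
      induction x using TensorProduct.induction_on with
      | zero => simp
      | add u v hu hv => simp only [map_add, add_tmul, hu, hv]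
      | tmul v a =>
        simp only [map_tmul, assoc_tmul, LinearMap.lTensor_tmul, lift.tmul, LinearMap.flip_apply]
        generalize leftRec ((mk K (T K V) V) 1) _ t a = y
        induction y using TensorProduct.induction_on with
        | zero => simp
        | add u v hu hv => simp only [map_add, tmul_add, hu, hv]
        | tmul t v => simp

theorem isExtL_beta (σ : V ⊗[K] V →ₗ[K] V ⊗[K] V) : IsExtL (betaOne σ) (beta σ) where
  one a := by simp [beta, leftRec_one]
  cons u z := by
    induction u using TensorProduct.induction_on with
    | zero => simp
    | add u v hu hv => simp only [map_add, add_tmul, hu, hv]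
    | tmul v t =>
      rw [crossL_tmul, QuantumBInf.cons_tmul, beta, lift.tmul, lift.tmul, leftRec_mul]
      simp only [betaStep, LinearMap.mk₂_apply, LinearMap.comp_apply, slide, cons,
        LinearMap.lTensor_comp, LinearEquiv.coe_coe, mk_apply]

end ConsCrossings

/-! ### The Yang-Baxter equation as naturality of a crossing. -/

section Rotation

variable {K : Type*} [Field K] {A B C : Type*}
  [AddCommGroup A] [Module K A] [AddCommGroup B] [Module K B] [AddCommGroup C] [Module K C]
  {χAB : A ⊗[K] B →ₗ[K] B ⊗[K] A} {χAC : A ⊗[K] C →ₗ[K] C ⊗[K] A}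
  {χBC : B ⊗[K] C →ₗ[K] C ⊗[K] B}

theorem crossR_braid (a : A) (u : B ⊗[K] C) :
    crossR χAC χAB (a ⊗ₜ χBC u) = (TensorProduct.assoc K C B A).symm (χAB.lTensor C
      (crossL χAC χBC ((TensorProduct.assoc K A B C).symm (a ⊗ₜ u)))) := by
  simp [crossR_apply, crossL]

theorem braid_crossR (a : A) (u : B ⊗[K] C) :
    χBC.rTensor A (crossR χAB χAC (a ⊗ₜ u)) = (TensorProduct.assoc K C B A).symm
      (crossL χBC χAC (χAB.rTensor C ((TensorProduct.assoc K A B C).symm (a ⊗ₜ u)))) := by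
  induction u using TensorProduct.induction_on with
  | zero => simp
  | add u v hu hv => simp only [map_add, tmul_add, hu, hv]
  | tmul b c =>
    simp only [crossR_apply, slide_tmul, assoc_symm_tmul, LinearMap.rTensor_tmul]
    generalize χAB (a ⊗ₜ b) = u
    induction u using TensorProduct.induction_on with
    | zero => simp
    | add u v hu hv => simp only [map_add, add_tmul, hu, hv]
    | tmul b a =>
      simp only [assoc_tmul, LinearMap.lTensor_tmul, crossL_tmul]
      generalize χAC (a ⊗ₜ c) = u
      induction u using TensorProduct.induction_on with
      | zero => simp
      | add u v hu hv => simp only [map_add, tmul_add, hu, hv]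
      | tmul c a => simp

/-- The two readings of the Yang-Baxter equation on `A ⊗ B ⊗ C`. -/
theorem isCrossR_iff_isCrossL :
    IsCrossR (crossR χAB χAC) (crossR χAC χAB) χBC ↔
      IsCrossL (crossL χAC χBC) (crossL χBC χAC) χAB := by
  constructor
  · intro h u c
    induction u using TensorProduct.induction_on with
    | zero => simp
    | add u v hu hv => simp only [map_add, add_tmul, hu, hv]
    | tmul a b =>
      have := h a (b ⊗ₜ c)
      rw [crossR_braid, braid_crossR] at this
      simpa using this.symm
  · intro h a u
    rw [crossR_braid, braid_crossR, h.apply]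

/-- Sliding the first factor past `σ` applied to the other two is the composite `σ₂ σ₁ σ₂` or `σ₁ σ₂
σ₁`, according to whether `σ` acts before or after. -/
theorem isCrossR_iff_yang_baxter (σ : A ⊗[K] A →ₗ[K] A ⊗[K] A) :
    IsCrossR (crossR σ σ) (crossR σ σ) σ ↔
      op₁ σ ∘ₗ op₂ σ ∘ₗ op₁ σ = op₂ σ ∘ₗ op₁ σ ∘ₗ op₂ σ := by
  have h1 : ∀ (z : A) u, crossR σ σ (z ⊗ₜ σ u) =
      (TensorProduct.assoc K A A A).symm ((op₂ σ ∘ₗ op₁ σ ∘ₗ op₂ σ) (z ⊗ₜ u)) := fun z u => rfl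
  have h2 : ∀ (z : A) u, σ.rTensor A (crossR σ σ (z ⊗ₜ u)) =
      (TensorProduct.assoc K A A A).symm ((op₁ σ ∘ₗ op₂ σ ∘ₗ op₁ σ) (z ⊗ₜ u)) := fun z u => by
    rw [crossR_apply, op₁, op₂]
    simp [slide]
  constructor
  · intro h
    refine TensorProduct.ext' fun z u => ?_
    have := h z u
    rw [h1, h2] at this
    exact ((TensorProduct.assoc K A A A).symm.injective this).symm
  · intro h z u
    rw [h1, h2, h]

end Rotation

/-! ### Naturality of `β` for concatenation, deconcatenation, projections and `β` itself. -/

section TensorSpace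

variable {K : Type*} [Field K] {V : Type*} [AddCommGroup V] [Module K V]
  {Z : Type*} [AddCommGroup Z] [Module K Z]
  (σ : V ⊗[K] V →ₗ[K] V ⊗[K] V)

@[simp]
theorem beta_one_tmul (z : T K V) : beta σ (1 ⊗ₜ z) = z ⊗ₜ 1 := (isExtL_beta σ).one z

@[simp]
theorem beta_tmul_one (z : T K V) : beta σ (z ⊗ₜ 1) = 1 ⊗ₜ z := by
  induction z using cons_induction with
  | one => simp
  | cons v t ht => simp [(isExtL_beta σ).cons_tmul, ht, (isExtR_betaOne σ).one]
  | add s t hs ht => simp only [add_tmul, tmul_add, map_add, hs, ht]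
  | smul r t ht => simp only [← smul_tmul', tmul_smul, map_smul, ht]

theorem deltaStep_apply (v : V) (q : (T K V ⊗[K] T K V) × T K V) :
    deltaStep K V v q = ((1 : T K V) ⊗ₜ[K] (incl K V v * q.2) +
      (incl K V v ⊗ₜ[K] (1 : T K V)) * q.1, incl K V v * q.2) := rfl

/-- The second component of the recursion merely remembers the tensor read so far; hence the clean
recursion `delta_cons`. -/
theorem leftRec_deltaStep_snd (t : T K V) :
    (leftRec ((1 : T K V) ⊗ₜ[K] (1 : T K V), (1 : T K V)) (deltaStep K V) t).2 = t := by
  induction t using cons_induction with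
  | one => simp [leftRec_one]
  | cons v t ht => rw [leftRec_mul, deltaStep_apply, ht]
  | add s t hs ht => simp [hs, ht]
  | smul r t ht => simp [ht]

@[simp]
theorem delta_one : delta K V 1 = 1 ⊗ₜ 1 := by simp [delta, leftRec_one]

variable (K V) in
/-- Concatenation of a vector with the first factor of `T(V) ⊗ A`. -/
def consFst (A : Type*) [AddCommGroup A] [Module K A] :
    V ⊗[K] (T K V ⊗[K] A) →ₗ[K] T K V ⊗[K] A :=
  (cons K V).rTensor A ∘ₗ (TensorProduct.assoc K V (T K V) A).symm.toLinearMap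

@[simp]
theorem consFst_tmul {A : Type*} [AddCommGroup A] [Module K A] (v : V) (t : T K V) (a : A) :
    consFst K V A (v ⊗ₜ (t ⊗ₜ a)) = (incl K V v * t) ⊗ₜ a := by
  simp [consFst]

theorem delta_cons (v : V) (t : T K V) :
    delta K V (incl K V v * t) =
      1 ⊗ₜ (incl K V v * t) + consFst K V (T K V) (v ⊗ₜ delta K V t) := by
  have h : ∀ u : T K V ⊗[K] T K V,
      (incl K V v ⊗ₜ[K] (1 : T K V)) * u = consFst K V (T K V) (v ⊗ₜ u) := fun u => by
    induction u using TensorProduct.induction_on with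
    | zero => simp
    | add u v hu hv => simp only [tmul_add, map_add, mul_add, hu, hv]
    | tmul s t => simp
  rw [delta, LinearMap.comp_apply, leftRec_mul, deltaStep_apply, leftRec_deltaStep_snd, ← h]
  rfl

theorem incl_mem_deg (v : V) : incl K V v ∈ deg K V 1 := by
  rw [deg, pow_one]; exact ⟨v, rfl⟩

theorem projDeg_apply (n : ℕ) (t : T K V) :
    projDeg K V n t = (DirectSum.decompose (deg K V) t n : T K V) := rfl

@[simp]
theorem projDeg_zero_one : projDeg K V 0 1 = 1 := by
  rw [projDeg_apply]
  exact DirectSum.decompose_of_mem_same _ SetLike.GradedOne.one_mem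

@[simp]
theorem projDeg_succ_one (n : ℕ) : projDeg K V (n + 1) 1 = 0 := by
  rw [projDeg_apply]
  exact DirectSum.decompose_of_mem_ne _ SetLike.GradedOne.one_mem (by omega)

@[simp]
theorem projDeg_zero_cons (v : V) (t : T K V) : projDeg K V 0 (incl K V v * t) = 0 := by
  rw [projDeg_apply]
  exact DirectSum.coe_decompose_mul_of_left_mem_of_not_le _ (incl_mem_deg v) (by omega)

@[simp]
theorem projDeg_succ_cons (n : ℕ) (v : V) (t : T K V) :
    projDeg K V (n + 1) (incl K V v * t) = incl K V v * projDeg K V n t := by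
  rw [projDeg_apply, add_comm, DirectSum.coe_decompose_mul_add_of_left_mem _ (incl_mem_deg v)]
  rfl

theorem eq_top_of_consFst {A : Type*} [AddCommGroup A] [Module K A]
    (P : Submodule K (T K V ⊗[K] A)) (h1 : Set.range (fun a : A => (1 : T K V) ⊗ₜ[K] a) ⊆ P)
    (hc : ∀ v u, u ∈ P → consFst K V A (v ⊗ₜ u) ∈ P) : P = ⊤ := by
  refine (Submodule.eq_top_iff').2 fun u => ?_
  induction u using TensorProduct.induction_on with
  | zero => exact P.zero_mem
  | add u v hu hv => exact P.add_mem hu hv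
  | tmul t a =>
    induction t using cons_induction with
    | one => exact h1 ⟨a, rfl⟩
    | cons v t ht => simpa using hc v _ ht
    | add s t hs ht => rw [add_tmul]; exact P.add_mem hs ht
    | smul r t ht => rw [← smul_tmul']; exact P.smul_mem _ ht

theorem eq_top_of_cons_singleton (P : Submodule K (T K V)) (h1 : {(1 : T K V)} ⊆ (P : Set (T K V)))
    (hc : ∀ v t, t ∈ P → cons K V (v ⊗ₜ t) ∈ P) : P = ⊤ :=
  eq_top_of_cons P (h1 rfl) fun v t ht => by simpa using hc v t ht

section CrossL

variable {τV : V ⊗[K] Z →ₗ[K] Z ⊗[K] V} {τ : T K V ⊗[K] Z →ₗ[K] Z ⊗[K] T K V}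
  (one : ∀ z, τ (1 ⊗ₜ z) = z ⊗ₜ 1) (hcons : IsCrossL (crossL τV τ) τ (cons K V))

include one hcons

/-- Concatenation is determined by `1 · t = t` and `(v s) t = v (s t)`, a recursion with no
inhomogeneous term and with step `cons`. -/
theorem IsCrossL.mul_of_cons : IsCrossL (crossL τ τ) τ (LinearMap.mul' K (T K V)) := by
  refine IsCrossL.of_recursion (consS := consFst K V (T K V)) eq_top_of_consFst
    (hcons.rTensor.comp .assoc_symm) (g := 0) .zero hcons ?_ ?_
  · intro v s
    rw [LinearMap.zero_apply, zero_add]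
    induction s using TensorProduct.induction_on with
    | zero => simp
    | add u v hu hv => simp only [map_add, tmul_add, hu, hv]
    | tmul s t => simp [mul_assoc]
  · rintro _ ⟨t, rfl⟩ z
    have h := IsCrossL.mk (τA := τ) (τB := τ) one t z
    rw [mk_apply] at h
    rw [h, ← LinearMap.lTensor_comp_apply, LinearMap.mul'_apply, one_mul]
    have : LinearMap.mul' K (T K V) ∘ₗ TensorProduct.mk K (T K V) (T K V) 1 = LinearMap.id := by
      ext; simp
    simp [this]

theorem IsCrossL.delta_of_cons : IsCrossL τ (crossL τ τ) (delta K V) := by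
  refine IsCrossL.of_recursion (consS := cons K V) eq_top_of_cons_singleton
    hcons (g := TensorProduct.mk K (T K V) (T K V) 1 ∘ₗ cons K V) (φ := consFst K V (T K V))
    ((IsCrossL.mk one).comp hcons) (hcons.rTensor.comp .assoc_symm) ?_ ?_
  · intro v s
    simp [delta_cons]
  · rintro _ rfl z
    simp [one]

theorem IsCrossL.projDeg_of_cons (n : ℕ) : IsCrossL τ τ (projDeg K V n) := by
  induction n with
  | zero =>
    refine IsCrossL.of_recursion (consS := cons K V) eq_top_of_cons_singleton hcons (g := 0)
      (φ := 0) .zero .zero (by simp) ?_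
    rintro _ rfl z
    simp [one]
  | succ n ih =>
    refine IsCrossL.of_recursion (consS := cons K V) eq_top_of_cons_singleton hcons
      (g := cons K V ∘ₗ (projDeg K V n).lTensor V)
      (φ := 0) (hcons.comp ih.lTensor) .zero (by simp) ?_
    rintro _ rfl z
    simp [one]

end CrossL

section CrossR

variable {τV : Z ⊗[K] V →ₗ[K] V ⊗[K] Z} {τ : Z ⊗[K] T K V →ₗ[K] T K V ⊗[K] Z}
  (one : ∀ z, τ (z ⊗ₜ 1) = 1 ⊗ₜ z) (hcons : IsCrossR (crossR τV τ) τ (cons K V))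

include one hcons

theorem IsCrossR.mul_of_cons : IsCrossR (crossR τ τ) τ (LinearMap.mul' K (T K V)) := by
  refine IsCrossR.of_recursion (consS := consFst K V (T K V)) eq_top_of_consFst
    (hcons.rTensor.comp .assoc_symm) (g := 0) .zero hcons ?_ ?_
  · intro v s
    rw [LinearMap.zero_apply, zero_add]
    induction s using TensorProduct.induction_on with
    | zero => simp
    | add u v hu hv => simp only [map_add, tmul_add, hu, hv]
    | tmul s t => simp [mul_assoc]
  · rintro _ ⟨t, rfl⟩ z
    have h := IsCrossR.mk (ρA := τ) (ρB := τ) one z t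
    rw [mk_apply] at h
    rw [h, ← LinearMap.rTensor_comp_apply, LinearMap.mul'_apply, one_mul]
    have : LinearMap.mul' K (T K V) ∘ₗ TensorProduct.mk K (T K V) (T K V) 1 = LinearMap.id := by
      ext; simp
    simp [this]

theorem IsCrossR.delta_of_cons : IsCrossR τ (crossR τ τ) (delta K V) := by
  refine IsCrossR.of_recursion (consS := cons K V) eq_top_of_cons_singleton
    hcons (g := TensorProduct.mk K (T K V) (T K V) 1 ∘ₗ cons K V) (φ := consFst K V (T K V))
    ((IsCrossR.mk one).comp hcons) (hcons.rTensor.comp .assoc_symm) ?_ ?_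
  · intro v s
    simp [delta_cons]
  · rintro _ rfl z
    simp [one, crossR_apply]

theorem IsCrossR.projDeg_of_cons (n : ℕ) : IsCrossR τ τ (projDeg K V n) := by
  induction n with
  | zero =>
    refine IsCrossR.of_recursion (consS := cons K V) eq_top_of_cons_singleton hcons (g := 0)
      (φ := 0) .zero .zero (by simp) ?_
    rintro _ rfl z
    simp [one]
  | succ n ih =>
    refine IsCrossR.of_recursion (consS := cons K V) eq_top_of_cons_singleton hcons
      (g := cons K V ∘ₗ (projDeg K V n).lTensor V)
      (φ := 0) (hcons.comp ih.lTensor) .zero (by simp) ?_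
    rintro _ rfl z
    simp [one]

end CrossR

theorem isCrossL_mul :
    IsCrossL (crossL (beta σ) (beta σ)) (beta σ) (LinearMap.mul' K (T K V)) :=
  .mul_of_cons (isExtL_beta σ).one (isExtL_beta σ).cons

theorem isCrossL_delta : IsCrossL (beta σ) (crossL (beta σ) (beta σ)) (delta K V) :=
  .delta_of_cons (isExtL_beta σ).one (isExtL_beta σ).cons

theorem isCrossL_projDeg (n : ℕ) : IsCrossL (beta σ) (beta σ) (projDeg K V n) :=
  .projDeg_of_cons (isExtL_beta σ).one (isExtL_beta σ).cons n

theorem isExtL_crossR_beta :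
    IsExtL (crossR (betaOne σ) (betaOne σ)) (crossR (beta σ) (beta σ)) :=
  (isExtL_beta σ).crossR (isExtL_beta σ)

/-- The right-hand recursion is known for `betaOne` only, so compatibility is first obtained for
moving one vector and then lifted to tensors through `isExtL_beta`. On the left, `beta` has the
recursion directly. -/
theorem isCrossR_mul :
    IsCrossR (crossR (beta σ) (beta σ)) (beta σ) (LinearMap.mul' K (T K V)) :=
  (isExtL_crossR_beta σ).isCrossR (isExtL_beta σ)
    (.mul_of_cons (isExtR_betaOne σ).one (isExtR_betaOne σ).cons)

theorem isCrossR_delta : IsCrossR (beta σ) (crossR (beta σ) (beta σ)) (delta K V) :=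
  (isExtL_beta σ).isCrossR (isExtL_crossR_beta σ)
    (.delta_of_cons (isExtR_betaOne σ).one (isExtR_betaOne σ).cons)

theorem isCrossR_projDeg (n : ℕ) : IsCrossR (beta σ) (beta σ) (projDeg K V n) :=
  (isExtL_beta σ).isCrossR (isExtL_beta σ)
    (.projDeg_of_cons (isExtR_betaOne σ).one (isExtR_betaOne σ).cons n)

variable {σ} (hσ : IsBraiding σ)

include hσ

/-- Rotation turns the Yang-Baxter relation on `V ⊗ V ⊗ T(V)` into the compatibility of `σ` with
moving `T(V)`. That follows from its compatibility with moving `V`, which is the equation for `σ`.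
-/
theorem isCrossR_betaOne :
    IsCrossR (crossR σ (betaOne σ)) (crossR (betaOne σ) σ) (betaOne σ) := by
  rw [isCrossR_iff_isCrossL]
  have h := (isExtR_betaOne σ).crossL (isExtR_betaOne σ)
  refine h.isCrossL h ?_
  rw [← isCrossR_iff_isCrossL, isCrossR_iff_yang_baxter]
  exact hσ.yang_baxter

/-- This is the Yang-Baxter equation for `β`. The factor being moved is reduced to one vector; then
`β` is treated as a recursion on `T(V) ⊗ T(V)` whose step is made of `betaOne` and `cons`, both
compatible. -/
theorem isCrossR_beta :
    IsCrossR (crossR (beta σ) (beta σ)) (crossR (beta σ) (beta σ)) (beta σ) := by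
  refine (isExtL_crossR_beta σ).isCrossR (isExtL_crossR_beta σ) ?_
  have hc := (isExtR_betaOne σ).cons
  refine IsCrossR.of_recursion (consS := consFst K V (T K V)) eq_top_of_consFst
    (hc.rTensor.comp .assoc_symm) (g := 0)
    (φ := (cons K V).lTensor (T K V) ∘ₗ slide (betaOne σ)) .zero
    (hc.lTensor.comp (.slide (isCrossR_betaOne hσ))) ?_ ?_
  · intro v s
    rw [LinearMap.zero_apply, zero_add]
    induction s using TensorProduct.induction_on with
    | zero => simp
    | add u v hu hv => simp only [map_add, tmul_add, hu, hv]
    | tmul s t => simp [(isExtL_beta σ).cons_tmul]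
  · rintro _ ⟨t, rfl⟩ z
    have h := IsCrossR.mk (ρB := betaOne σ) (isExtR_betaOne σ).one z t
    have h' := IsCrossR.mk_flip (ρA := betaOne σ) (isExtR_betaOne σ).one z t
    rw [LinearMap.flip_apply] at h'
    rw [mk_apply] at h h'
    rw [h, ← LinearMap.rTensor_comp_apply, beta_one_tmul, h']
    congr 2
    ext
    simp

theorem isCrossL_beta :
    IsCrossL (crossL (beta σ) (beta σ)) (crossL (beta σ) (beta σ)) (beta σ) :=
  isCrossR_iff_isCrossL.1 (isCrossR_beta hσ)

/-- The inverse is the double extension of `σ⁻¹` with the sides exchanged: left first, inverting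
`betaOne`, then right. -/
theorem exists_beta_inverse : ∃ γ : T K V ⊗[K] T K V →ₗ[K] T K V ⊗[K] T K V,
    (∀ u, γ (beta σ u) = u) ∧ (∀ u, beta σ (γ u) = u) := by
  let e := LinearEquiv.ofBijective σ hσ.bijective
  let s : V ⊗[K] V →ₗ[K] V ⊗[K] V := e.symm.toLinearMap
  have h1 : ∀ u, s (σ u) = u := fun u => e.symm_apply_apply u
  have h2 : ∀ u, σ (s u) = u := fun u => e.apply_symm_apply u
  have hs := isExtL_extL s
  have h3 : ∀ u, extL s (betaOne σ u) = u := hs.comp_isExtR (isExtR_betaOne σ) h1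
  have h4 : ∀ u, betaOne σ (extL s u) = u := (isExtR_betaOne σ).comp_isExtL hs h2
  exact ⟨extR (extL s), (isExtR_extR _).comp_isExtL (isExtL_beta σ) h3,
    (isExtL_beta σ).comp_isExtR (isExtR_extR _) h4⟩

end TensorSpace

/-! ### Coproducts on `A ⊗ B` twisted by a crossing. -/

section TwistedCoproduct

variable {K : Type*} [Field K] {A B C P Q A' B' P' Q' : Type*}
  [AddCommGroup A] [Module K A] [AddCommGroup B] [Module K B] [AddCommGroup C] [Module K C]
  [AddCommGroup P] [Module K P] [AddCommGroup Q] [Module K Q]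
  [AddCommGroup A'] [Module K A'] [AddCommGroup B'] [Module K B']
  [AddCommGroup P'] [Module K P'] [AddCommGroup Q'] [Module K Q']

theorem midCross_map {χ : P ⊗[K] Q →ₗ[K] Q ⊗[K] P} {χ' : P' ⊗[K] Q' →ₗ[K] Q' ⊗[K] P'}
    {p : P →ₗ[K] P'} {q : Q →ₗ[K] Q'}
    (h : ∀ x y, χ' (p x ⊗ₜ q y) = TensorProduct.map q p (χ (x ⊗ₜ y)))
    (a : A →ₗ[K] A') (b : B →ₗ[K] B') (u : (A ⊗[K] P) ⊗[K] (Q ⊗[K] B)) :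
    midCross χ' (TensorProduct.map (TensorProduct.map a p) (TensorProduct.map q b) u) =
      TensorProduct.map (TensorProduct.map a q) (TensorProduct.map p b) (midCross χ u) := by
  suffices H : midCross χ' ∘ₗ TensorProduct.map (TensorProduct.map a p) (TensorProduct.map q b) =
      TensorProduct.map (TensorProduct.map a q) (TensorProduct.map p b) ∘ₗ midCross χ from
    LinearMap.congr_fun H u
  ext a x y b
  simp only [AlgebraTensorModule.curry_apply, LinearMap.restrictScalars_self, curry_apply,
    LinearMap.comp_apply, map_tmul, midCross_tmul, h]
  generalize χ (x ⊗ₜ y) = w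
  induction w using TensorProduct.induction_on with
  | zero => simp
  | add u v hu hv => simp only [map_add, tmul_add, add_tmul, hu, hv]
  | tmul y x => simp

/-- The coproduct of `A ⊗ B` twisted by a crossing `A ⊗ B → B ⊗ A`. -/
def twist (χ : A ⊗[K] B →ₗ[K] B ⊗[K] A) (ΔA : A →ₗ[K] A ⊗[K] A) (ΔB : B →ₗ[K] B ⊗[K] B) :
    A ⊗[K] B →ₗ[K] (A ⊗[K] B) ⊗[K] (A ⊗[K] B) :=
  midCross χ ∘ₗ TensorProduct.map ΔA ΔB

theorem twist_tmul (χ : A ⊗[K] B →ₗ[K] B ⊗[K] A) (ΔA : A →ₗ[K] A ⊗[K] A)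
    (ΔB : B →ₗ[K] B ⊗[K] B) (a : A) (b : B) :
    twist χ ΔA ΔB (a ⊗ₜ b) = midCross χ (ΔA a ⊗ₜ ΔB b) := rfl

theorem twist_map {χ : A ⊗[K] B →ₗ[K] B ⊗[K] A} {ΔA : A →ₗ[K] A ⊗[K] A}
    {ΔB : B →ₗ[K] B ⊗[K] B} {χ' : A' ⊗[K] B' →ₗ[K] B' ⊗[K] A'} {ΔA' : A' →ₗ[K] A' ⊗[K] A'}
    {ΔB' : B' →ₗ[K] B' ⊗[K] B'} {f : A →ₗ[K] A'} {g : B →ₗ[K] B'}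
    (hf : ∀ a, ΔA' (f a) = TensorProduct.map f f (ΔA a))
    (hg : ∀ b, ΔB' (g b) = TensorProduct.map g g (ΔB b))
    (h : ∀ x y, χ' (f x ⊗ₜ g y) = TensorProduct.map g f (χ (x ⊗ₜ y))) (u : A ⊗[K] B) :
    twist χ' ΔA' ΔB' (TensorProduct.map f g u) =
      TensorProduct.map (TensorProduct.map f g) (TensorProduct.map f g) (twist χ ΔA ΔB u) := by
  induction u using TensorProduct.induction_on with
  | zero => simp
  | add u v hu hv => simp only [map_add, hu, hv]
  | tmul a b =>
    rw [map_tmul, twist_tmul, twist_tmul, hf, hg, ← map_tmul, midCross_map h]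

/-- Both sides sort `a₁ a₂ a₃ b₁ b₂ b₃` into `a₁ b₁ a₂ b₂ a₃ b₃` by first crossing `a₃` with `b₁`.
They differ only in the order of the two remaining crossings, which act on disjoint factors, so no
Yang-Baxter equation is needed. -/
theorem midCross_assoc (χ : A ⊗[K] B →ₗ[K] B ⊗[K] A)
    (u : ((A ⊗[K] A) ⊗[K] A) ⊗[K] ((B ⊗[K] B) ⊗[K] B)) :
    TensorProduct.assoc K (A ⊗[K] B) (A ⊗[K] B) (A ⊗[K] B)
        ((midCross χ).rTensor (A ⊗[K] B) (midCross (crossR χ χ) u)) =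
      (midCross χ).lTensor (A ⊗[K] B) (midCross (crossL χ χ) (TensorProduct.map
        (TensorProduct.assoc K A A A).toLinearMap (TensorProduct.assoc K B B B).toLinearMap u)) := by
  suffices H : (TensorProduct.assoc K (A ⊗[K] B) (A ⊗[K] B) (A ⊗[K] B)).toLinearMap ∘ₗ
        (midCross χ).rTensor (A ⊗[K] B) ∘ₗ midCross (crossR χ χ) =
      (midCross χ).lTensor (A ⊗[K] B) ∘ₗ midCross (crossL χ χ) ∘ₗ TensorProduct.map
        (TensorProduct.assoc K A A A).toLinearMap (TensorProduct.assoc K B B B).toLinearMap from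
    LinearMap.congr_fun H u
  ext a₁ a₂ a₃ b₁ b₂ b₃
  simp only [AlgebraTensorModule.curry_apply, LinearMap.restrictScalars_self, curry_apply,
    LinearMap.comp_apply, map_tmul, midCross_tmul, LinearEquiv.coe_coe, assoc_tmul, crossR_apply,
    slide_tmul, crossL_tmul]
  generalize χ (a₃ ⊗ₜ b₁) = w
  induction w using TensorProduct.induction_on with
  | zero => simp
  | add u v hu hv => simp only [map_add, tmul_add, add_tmul, hu, hv]
  | tmul b₁ a₃ =>
    -- Both disjoint crossings are written as finite sums; interchanging the summations expresses
    -- their independence.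
    obtain ⟨m, x, y, h⟩ := TensorProduct.exists_sum_tmul_eq (χ (a₃ ⊗ₜ b₂))
    obtain ⟨n, x', y', h'⟩ := TensorProduct.exists_sum_tmul_eq (χ (a₂ ⊗ₜ b₁))
    simp only [assoc_tmul, assoc_symm_tmul, LinearMap.lTensor_tmul, LinearMap.rTensor_tmul,
      slide_tmul, midCross_tmul, h, h', map_sum, sum_tmul, tmul_sum]
    exact Finset.sum_comm

theorem twist_coassoc {χ : A ⊗[K] B →ₗ[K] B ⊗[K] A} {ΔA : A →ₗ[K] A ⊗[K] A}
    {ΔB : B →ₗ[K] B ⊗[K] B}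
    (hA : ∀ a, TensorProduct.assoc K A A A (ΔA.rTensor A (ΔA a)) = ΔA.lTensor A (ΔA a))
    (hB : ∀ b, TensorProduct.assoc K B B B (ΔB.rTensor B (ΔB b)) = ΔB.lTensor B (ΔB b))
    (hχA : IsCrossL χ (crossL χ χ) ΔA) (hχB : IsCrossR χ (crossR χ χ) ΔB) (u : A ⊗[K] B) :
    TensorProduct.assoc K (A ⊗[K] B) (A ⊗[K] B) (A ⊗[K] B)
        ((twist χ ΔA ΔB).rTensor (A ⊗[K] B) (twist χ ΔA ΔB u)) =
      (twist χ ΔA ΔB).lTensor (A ⊗[K] B) (twist χ ΔA ΔB u) := by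
  induction u using TensorProduct.induction_on with
  | zero => simp
  | add u v hu hv => simp only [map_add, hu, hv]
  | tmul a b =>
    have h1 : ∀ u, (TensorProduct.map ΔA ΔB).rTensor (A ⊗[K] B) (midCross χ u) =
        midCross (crossR χ χ) (TensorProduct.map (ΔA.rTensor A) (ΔB.rTensor B) u) := fun u =>
      (midCross_map (p := LinearMap.id) (q := ΔB) (fun x y => hχB x y) ΔA LinearMap.id u).symm ▸ by
        rw [LinearMap.rTensor, TensorProduct.map_id]
    have h2 : ∀ u, (TensorProduct.map ΔA ΔB).lTensor (A ⊗[K] B) (midCross χ u) =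
        midCross (crossL χ χ) (TensorProduct.map (ΔA.lTensor A) (ΔB.lTensor B) u) := fun u =>
      (midCross_map (p := ΔA) (q := LinearMap.id) (fun x y => hχA x y) LinearMap.id ΔB u).symm ▸ by
        rw [LinearMap.lTensor, TensorProduct.map_id]
    rw [twist_tmul, twist, LinearMap.rTensor_comp_apply, LinearMap.lTensor_comp_apply, h1, h2,
      midCross_assoc, map_tmul, map_tmul, map_tmul]
    simp only [LinearEquiv.coe_coe, hA, hB]

/-- Either bracketing crosses `A'` with `B` and `B'` with `C`, in one order or the other, and then
`A'` with `C`. This is why the two iterated twisted coproducts on a triple tensor product coincide.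
-/
theorem midCross_crossL_crossR {χAB : A' ⊗[K] B →ₗ[K] B ⊗[K] A'}
    {χAC : A' ⊗[K] C →ₗ[K] C ⊗[K] A'} {χBC : B' ⊗[K] C →ₗ[K] C ⊗[K] B'}
    (u : ((A ⊗[K] A') ⊗[K] (B ⊗[K] B')) ⊗[K] (C ⊗[K] P)) :
    TensorProduct.map (TensorProduct.assoc K A B C).toLinearMap
        (TensorProduct.assoc K A' B' P).toLinearMap
        (midCross (crossL χAC χBC) ((midCross χAB).rTensor (C ⊗[K] P) u)) =
      midCross (crossR χAB χAC) ((midCross χBC).lTensor (A ⊗[K] A')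
        (TensorProduct.assoc K _ _ _ u)) := by
  suffices H : TensorProduct.map (TensorProduct.assoc K A B C).toLinearMap
        (TensorProduct.assoc K A' B' P).toLinearMap ∘ₗ
        midCross (crossL χAC χBC) ∘ₗ (midCross χAB).rTensor (C ⊗[K] P) =
      midCross (crossR χAB χAC) ∘ₗ (midCross χBC).lTensor (A ⊗[K] A') ∘ₗ
        (TensorProduct.assoc K _ _ _).toLinearMap from
    LinearMap.congr_fun H u
  ext a₁ a₂ b₁ b₂ c₁ c₂
  simp only [AlgebraTensorModule.curry_apply, LinearMap.restrictScalars_self, curry_apply,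
    LinearMap.comp_apply, LinearMap.rTensor_tmul, LinearMap.lTensor_tmul, midCross_tmul,
    LinearEquiv.coe_coe, assoc_tmul]
  obtain ⟨m, x, y, h⟩ := TensorProduct.exists_sum_tmul_eq (χBC (b₂ ⊗ₜ c₁))
  obtain ⟨n, x', y', h'⟩ := TensorProduct.exists_sum_tmul_eq (χAB (a₂ ⊗ₜ b₁))
  simp only [assoc_tmul, assoc_symm_tmul, midCross_tmul, h, h', map_sum, sum_tmul, tmul_sum,
    crossL_tmul, crossR_apply, slide_tmul, LinearMap.lTensor_tmul]
  rw [Finset.sum_comm]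
  refine Finset.sum_congr rfl fun i _ => Finset.sum_congr rfl fun j _ => ?_
  generalize χAC (y' j ⊗ₜ x i) = w
  induction w using TensorProduct.induction_on with
  | zero => simp
  | add u v hu hv => simp only [map_add, tmul_add, add_tmul, hu, hv]
  | tmul c a => simp

theorem twist_crossL_crossR {χAB : A ⊗[K] B →ₗ[K] B ⊗[K] A} {χAC : A ⊗[K] C →ₗ[K] C ⊗[K] A}
    {χBC : B ⊗[K] C →ₗ[K] C ⊗[K] B} (ΔA : A →ₗ[K] A ⊗[K] A) (ΔB : B →ₗ[K] B ⊗[K] B)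
    (ΔC : C →ₗ[K] C ⊗[K] C) (u : (A ⊗[K] B) ⊗[K] C) :
    twist (crossR χAB χAC) ΔA (twist χBC ΔB ΔC) (TensorProduct.assoc K A B C u) =
      TensorProduct.map (TensorProduct.assoc K A B C).toLinearMap
        (TensorProduct.assoc K A B C).toLinearMap
        (twist (crossL χAC χBC) (twist χAB ΔA ΔB) ΔC u) := by
  induction u using TensorProduct.induction_on with
  | zero => simp
  | add u v hu hv => simp only [map_add, hu, hv]
  | tmul u c =>
  induction u using TensorProduct.induction_on with
  | zero => simp
  | add u v hu hv => simp only [map_add, add_tmul, hu, hv]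
  | tmul a b =>
    have h := midCross_crossL_crossR (χAB := χAB) (χAC := χAC) (χBC := χBC)
      ((ΔA a ⊗ₜ[K] ΔB b) ⊗ₜ[K] ΔC c)
    rw [assoc_tmul, LinearMap.lTensor_tmul, LinearMap.rTensor_tmul] at h
    simp only [assoc_tmul, twist_tmul]
    exact h.symm

/-- Applying the counits to the right copy of `A ⊗ B` undoes both coproducts, provided that the
counit of `A` passes through the crossing; this is the condition `hχ`. -/
theorem rid_twist {χ : A ⊗[K] B →ₗ[K] B ⊗[K] A} {ΔA : A →ₗ[K] A ⊗[K] A}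
    {ΔB : B →ₗ[K] B ⊗[K] B} {εA : A →ₗ[K] K} {εB : B →ₗ[K] K}
    (hA : ∀ a, TensorProduct.rid K A (εA.lTensor A (ΔA a)) = a)
    (hB : ∀ b, TensorProduct.rid K B (εB.lTensor B (ΔB b)) = b)
    (hχ : ∀ a b, TensorProduct.rid K B (εA.lTensor B (χ (a ⊗ₜ b))) = εA a • b)
    (u : A ⊗[K] B) :
    TensorProduct.rid K (A ⊗[K] B) ((LinearMap.mul' K K ∘ₗ TensorProduct.map εA εB).lTensor
      (A ⊗[K] B) (twist χ ΔA ΔB u)) = u := by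
  have key : ∀ (x : A ⊗[K] A) (y : B ⊗[K] B),
      TensorProduct.rid K (A ⊗[K] B) ((LinearMap.mul' K K ∘ₗ TensorProduct.map εA εB).lTensor
        (A ⊗[K] B) (midCross χ (x ⊗ₜ y))) =
      TensorProduct.rid K A (εA.lTensor A x) ⊗ₜ TensorProduct.rid K B (εB.lTensor B y) := by
    intro x y
    induction x using TensorProduct.induction_on with
    | zero => simp
    | add u v hu hv => simp only [map_add, add_tmul, hu, hv]
    | tmul a₁ a₂ =>
    induction y using TensorProduct.induction_on with
    | zero => simp
    | add u v hu hv => simp only [map_add, tmul_add, hu, hv]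
    | tmul b₁ b₂ =>
      have h : ∀ w : B ⊗[K] A, TensorProduct.rid K (A ⊗[K] B)
          ((LinearMap.mul' K K ∘ₗ TensorProduct.map εA εB).lTensor (A ⊗[K] B)
            ((TensorProduct.assoc K A B (A ⊗[K] B)).symm
              (a₁ ⊗ₜ TensorProduct.assoc K B A B (w ⊗ₜ b₂)))) =
          εB b₂ • (a₁ ⊗ₜ[K] TensorProduct.rid K B (εA.lTensor B w)) := by
        intro w
        induction w using TensorProduct.induction_on with
        | zero => simp
        | add u v hu hv => simp only [map_add, tmul_add, add_tmul, smul_add, hu, hv]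
        | tmul b a => simp [smul_smul, mul_comm]
      rw [midCross_tmul, h, hχ]
      simp [smul_tmul]
  induction u using TensorProduct.induction_on with
  | zero => simp
  | add u v hu hv => simp only [map_add, hu, hv]
  | tmul a b => rw [twist_tmul, key, hA, hB]

theorem lid_twist {χ : A ⊗[K] B →ₗ[K] B ⊗[K] A} {ΔA : A →ₗ[K] A ⊗[K] A}
    {ΔB : B →ₗ[K] B ⊗[K] B} {εA : A →ₗ[K] K} {εB : B →ₗ[K] K}
    (hA : ∀ a, TensorProduct.lid K A (εA.rTensor A (ΔA a)) = a)
    (hB : ∀ b, TensorProduct.lid K B (εB.rTensor B (ΔB b)) = b)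
    (hχ : ∀ a b, TensorProduct.lid K A (εB.rTensor A (χ (a ⊗ₜ b))) = εB b • a)
    (u : A ⊗[K] B) :
    TensorProduct.lid K (A ⊗[K] B) ((LinearMap.mul' K K ∘ₗ TensorProduct.map εA εB).rTensor
      (A ⊗[K] B) (twist χ ΔA ΔB u)) = u := by
  have key : ∀ (x : A ⊗[K] A) (y : B ⊗[K] B),
      TensorProduct.lid K (A ⊗[K] B) ((LinearMap.mul' K K ∘ₗ TensorProduct.map εA εB).rTensor
        (A ⊗[K] B) (midCross χ (x ⊗ₜ y))) =
      TensorProduct.lid K A (εA.rTensor A x) ⊗ₜ TensorProduct.lid K B (εB.rTensor B y) := by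
    intro x y
    induction x using TensorProduct.induction_on with
    | zero => simp
    | add u v hu hv => simp only [map_add, add_tmul, hu, hv]
    | tmul a₁ a₂ =>
    induction y using TensorProduct.induction_on with
    | zero => simp
    | add u v hu hv => simp only [map_add, tmul_add, hu, hv]
    | tmul b₁ b₂ =>
      have h : ∀ w : B ⊗[K] A, TensorProduct.lid K (A ⊗[K] B)
          ((LinearMap.mul' K K ∘ₗ TensorProduct.map εA εB).rTensor (A ⊗[K] B)
            ((TensorProduct.assoc K A B (A ⊗[K] B)).symm
              (a₁ ⊗ₜ TensorProduct.assoc K B A B (w ⊗ₜ b₂)))) =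
          εA a₁ • (TensorProduct.lid K A (εB.rTensor A w) ⊗ₜ[K] b₂) := by
        intro w
        induction w using TensorProduct.induction_on with
        | zero => simp
        | add u v hu hv => simp only [map_add, tmul_add, add_tmul, smul_add, hu, hv]
        | tmul b a => simp [smul_smul, ← smul_tmul']
      rw [midCross_tmul, h, hχ]
      simp [smul_tmul, smul_smul, mul_comm]
  induction u using TensorProduct.induction_on with
  | zero => simp
  | add u v hu hv => simp only [map_add, hu, hv]
  | tmul a b => rw [twist_tmul, key, hA, hB]

end TwistedCoproduct

/-! ### Gradings and uniqueness of solutions of coproduct recursions. -/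

section Graded

variable {K : Type*} [Field K] {A B C D X Y : Type*}
  [AddCommGroup A] [Module K A] [AddCommGroup B] [Module K B] [AddCommGroup C] [Module K C]
  [AddCommGroup D] [Module K D] [AddCommGroup X] [Module K X] [AddCommGroup Y] [Module K Y]

/-- The total degree components of a tensor product of two graded spaces. -/
def gr (𝒜 : ℕ → Submodule K A) (ℬ : ℕ → Submodule K B) (n : ℕ) : Submodule K (A ⊗[K] B) :=
  Submodule.span K {x | ∃ i j a b, i + j = n ∧ a ∈ 𝒜 i ∧ b ∈ ℬ j ∧ a ⊗ₜ[K] b = x}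

variable {𝒜 : ℕ → Submodule K A} {ℬ : ℕ → Submodule K B} {𝒞 : ℕ → Submodule K C}
  {𝒟 : ℕ → Submodule K D}

theorem tmul_mem_gr {i j : ℕ} {a : A} {b : B} (ha : a ∈ 𝒜 i) (hb : b ∈ ℬ j) :
    a ⊗ₜ[K] b ∈ gr 𝒜 ℬ (i + j) :=
  Submodule.subset_span ⟨i, j, a, b, rfl, ha, hb, rfl⟩

theorem gr_induction {n : ℕ} {f : A ⊗[K] B →ₗ[K] X} {W : Submodule K X}
    (h : ∀ i j, i + j = n → ∀ a ∈ 𝒜 i, ∀ b ∈ ℬ j, f (a ⊗ₜ b) ∈ W)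
    {u : A ⊗[K] B} (hu : u ∈ gr 𝒜 ℬ n) : f u ∈ W := by
  have : gr 𝒜 ℬ n ≤ W.comap f := by
    rw [gr, Submodule.span_le]
    rintro _ ⟨i, j, a, b, hij, ha, hb, rfl⟩
    exact h i j hij a ha b hb
  exact this hu

theorem gr_eq_zero {n : ℕ} {f : A ⊗[K] B →ₗ[K] X}
    (h : ∀ i j, i + j = n → ∀ a ∈ 𝒜 i, ∀ b ∈ ℬ j, f (a ⊗ₜ b) = 0)
    {u : A ⊗[K] B} (hu : u ∈ gr 𝒜 ℬ n) : f u = 0 :=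
  (Submodule.mem_bot K).1 (gr_induction (fun i j hij a ha b hb => by simp [h i j hij a ha b hb]) hu)

theorem iSup_gr (hA : ⨆ i, 𝒜 i = ⊤) (hB : ⨆ i, ℬ i = ⊤) : ⨆ n, gr 𝒜 ℬ n = ⊤ := by
  rw [Submodule.eq_top_iff']
  intro u
  induction u using TensorProduct.induction_on with
  | zero => exact Submodule.zero_mem _
  | add u v hu hv => exact Submodule.add_mem _ hu hv
  | tmul a b =>
    have ha : a ∈ ⨆ i, 𝒜 i := hA ▸ Submodule.mem_top
    have hb : b ∈ ⨆ i, ℬ i := hB ▸ Submodule.mem_top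
    induction ha using Submodule.iSup_induction' with
    | zero => simp
    | add x y _ _ hx hy => rw [add_tmul]; exact Submodule.add_mem _ hx hy
    | mem i a ha =>
      induction hb using Submodule.iSup_induction' with
      | zero => simp
      | add x y _ _ hx hy => rw [tmul_add]; exact Submodule.add_mem _ hx hy
      | mem j b hb => exact Submodule.mem_iSup_of_mem (i + j) (tmul_mem_gr ha hb)

/-- A degree-preserving linear map. -/
def IsGraded (𝒜 : ℕ → Submodule K A) (ℬ : ℕ → Submodule K B) (f : A →ₗ[K] B) : Prop :=
  ∀ n, ∀ a ∈ 𝒜 n, f a ∈ ℬ n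

namespace IsGraded

theorem id : IsGraded 𝒜 𝒜 LinearMap.id := fun _ _ h => h

theorem comp {g : B →ₗ[K] C} {f : A →ₗ[K] B} (hg : IsGraded ℬ 𝒞 g) (hf : IsGraded 𝒜 ℬ f) :
    IsGraded 𝒜 𝒞 (g ∘ₗ f) := fun n a ha => hg n _ (hf n a ha)

theorem of_tmul {f : A ⊗[K] B →ₗ[K] C}
    (h : ∀ i j, ∀ a ∈ 𝒜 i, ∀ b ∈ ℬ j, f (a ⊗ₜ b) ∈ 𝒞 (i + j)) : IsGraded (gr 𝒜 ℬ) 𝒞 f := by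
  intro n u hu
  exact gr_induction (by rintro i j rfl; exact h i j) hu

theorem map {f : A →ₗ[K] B} {g : C →ₗ[K] D} (hf : IsGraded 𝒜 ℬ f) (hg : IsGraded 𝒞 𝒟 g) :
    IsGraded (gr 𝒜 𝒞) (gr ℬ 𝒟) (TensorProduct.map f g) :=
  of_tmul fun i j a ha c hc => tmul_mem_gr (hf i a ha) (hg j c hc)

theorem lTensor {g : C →ₗ[K] D} (hg : IsGraded 𝒞 𝒟 g) :
    IsGraded (gr 𝒜 𝒞) (gr 𝒜 𝒟) (g.lTensor A) := id.map hg

theorem rTensor {f : A →ₗ[K] B} (hf : IsGraded 𝒜 ℬ f) :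
    IsGraded (gr 𝒜 𝒞) (gr ℬ 𝒞) (f.rTensor C) := hf.map id

theorem assoc : IsGraded (gr (gr 𝒜 ℬ) 𝒞) (gr 𝒜 (gr ℬ 𝒞))
    (TensorProduct.assoc K A B C).toLinearMap := by
  refine of_tmul fun i j u hu c hc => ?_
  refine gr_induction (f := (TensorProduct.assoc K A B C).toLinearMap ∘ₗ
    (TensorProduct.mk K (A ⊗[K] B) C).flip c) ?_ hu
  rintro k l rfl a ha b hb
  rw [add_assoc]
  exact tmul_mem_gr ha (tmul_mem_gr hb hc)

theorem assoc_symm : IsGraded (gr 𝒜 (gr ℬ 𝒞)) (gr (gr 𝒜 ℬ) 𝒞)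
    (TensorProduct.assoc K A B C).symm.toLinearMap := by
  refine of_tmul fun i j a ha u hu => ?_
  refine gr_induction (f := (TensorProduct.assoc K A B C).symm.toLinearMap ∘ₗ
    TensorProduct.mk K A (B ⊗[K] C) a) ?_ hu
  rintro k l rfl b hb c hc
  rw [← add_assoc]
  exact tmul_mem_gr (tmul_mem_gr ha hb) hc

theorem slide {b : A ⊗[K] B →ₗ[K] B ⊗[K] A} (hb : IsGraded (gr 𝒜 ℬ) (gr ℬ 𝒜) b) :
    IsGraded (gr 𝒜 (gr ℬ 𝒞)) (gr ℬ (gr 𝒜 𝒞)) (slide b) :=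
  assoc.comp (hb.rTensor.comp assoc_symm)

theorem crossL {τA : A ⊗[K] C →ₗ[K] C ⊗[K] A} {τB : B ⊗[K] C →ₗ[K] C ⊗[K] B}
    (hA : IsGraded (gr 𝒜 𝒞) (gr 𝒞 𝒜) τA) (hB : IsGraded (gr ℬ 𝒞) (gr 𝒞 ℬ) τB) :
    IsGraded (gr (gr 𝒜 ℬ) 𝒞) (gr 𝒞 (gr 𝒜 ℬ)) (crossL τA τB) :=
  (slide hA).comp (hB.lTensor.comp assoc)

theorem twist {χ : A ⊗[K] B →ₗ[K] B ⊗[K] A} {ΔA : A →ₗ[K] A ⊗[K] A} {ΔB : B →ₗ[K] B ⊗[K] B}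
    (hχ : IsGraded (gr 𝒜 ℬ) (gr ℬ 𝒜) χ) (hA : IsGraded 𝒜 (gr 𝒜 𝒜) ΔA)
    (hB : IsGraded ℬ (gr ℬ ℬ) ΔB) :
    IsGraded (gr 𝒜 ℬ) (gr (gr 𝒜 ℬ) (gr 𝒜 ℬ)) (twist χ ΔA ΔB) :=
  (assoc_symm.comp ((slide hχ).lTensor.comp assoc)).comp (hA.map hB)

end IsGraded

theorem eq_zero_of_mem_graded {D : A →ₗ[K] X} (h : ⨆ n, 𝒜 n = ⊤)
    (hD : ∀ n, ∀ a ∈ 𝒜 n, D a = 0) : D = 0 := by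
  rw [← LinearMap.ker_eq_top, eq_top_iff, ← h]
  exact iSup_le fun n a ha => hD n a ha

/-- The recursion `D = a (D ⊗ φ) Δ` has only the trivial solution if `Δ` preserves degrees and
`φ` vanishes in degree `0`. -/
theorem eq_zero_of_recursion (hC : ⨆ n, 𝒞 n = ⊤) {Δ : C →ₗ[K] C ⊗[K] C}
    (hΔ : IsGraded 𝒞 (gr 𝒞 𝒞) Δ) {φ : C →ₗ[K] Y} (hφ : ∀ c ∈ 𝒞 0, φ c = 0)
    {a : X ⊗[K] Y →ₗ[K] X} {D : C →ₗ[K] X}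
    (hD : ∀ c, D c = a (TensorProduct.map D φ (Δ c))) : D = 0 := by
  refine eq_zero_of_mem_graded hC fun n => ?_
  induction n using Nat.strong_induction_on with
  | _ n ih =>
    intro c hc
    rw [hD, ← LinearMap.comp_apply]
    refine gr_eq_zero ?_ (hΔ n c hc)
    intro i j hij x hx y hy
    rw [LinearMap.comp_apply, map_tmul]
    -- A term of bidegree `(i, j)` either has `j = 0`, where `φ` kills it, or `i < n`, where the
    -- induction hypothesis applies.
    rcases Nat.eq_zero_or_pos j with rfl | hj
    · simp [hφ y hy]
    · simp [ih i (by omega) x hx]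

/-- The inhomogeneous term `b` may be any function: it cancels in `F - G`, which satisfies the
homogeneous recursion. -/
theorem eq_of_recursion (hC : ⨆ n, 𝒞 n = ⊤) {Δ : C →ₗ[K] C ⊗[K] C}
    (hΔ : IsGraded 𝒞 (gr 𝒞 𝒞) Δ) {φ : C →ₗ[K] Y} (hφ : ∀ c ∈ 𝒞 0, φ c = 0)
    {a : X ⊗[K] Y →ₗ[K] X} {F G : C →ₗ[K] X} {b : C → X}
    (hF : ∀ c, F c = b c + a (TensorProduct.map F φ (Δ c)))
    (hG : ∀ c, G c = b c + a (TensorProduct.map G φ (Δ c))) : F = G := by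
  rw [← sub_eq_zero]
  refine eq_zero_of_recursion hC hΔ hφ (a := a) fun c => ?_
  rw [LinearMap.sub_apply, hF, hG, sub_eq_add_neg F G, TensorProduct.map_add_left,
    ← neg_one_smul K G, TensorProduct.map_smul_left]
  simp [sub_eq_add_neg]
  abel

end Graded

/-! ### The graded coalgebra structures on `T(V)` and `T(V) ⊗ T(V)`. -/

section TensorSpace

variable {K : Type*} [Field K] {V : Type*} [AddCommGroup V] [Module K V]

variable (K V) in
/-- The counit of `T(V)`. -/
def counit : T K V →ₗ[K] K := TensorAlgebra.algebraMapInv.toLinearMap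

@[simp]
theorem counit_one : counit K V 1 = 1 := by simp [counit]

@[simp]
theorem counit_cons (v : V) (t : T K V) : counit K V (incl K V v * t) = 0 := by
  simp [counit, TensorAlgebra.algebraMapInv]

theorem projDeg_zero_apply (t : T K V) : projDeg K V 0 t = counit K V t • 1 := by
  induction t using cons_induction with
  | one => simp
  | cons v t ht => simp
  | add s t hs ht => simp only [map_add, add_smul, hs, ht]
  | smul r t ht => simp only [map_smul, ht, smul_assoc]

theorem delta_coassoc (t : T K V) :
    TensorProduct.assoc K (T K V) (T K V) (T K V) ((delta K V).rTensor (T K V) (delta K V t)) =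
      (delta K V).lTensor (T K V) (delta K V t) := by
  have h1 : ∀ (v : V) (w : T K V ⊗[K] T K V), TensorProduct.assoc K (T K V) (T K V) (T K V)
      ((delta K V).rTensor (T K V) (consFst K V (T K V) (v ⊗ₜ w))) =
      1 ⊗ₜ consFst K V (T K V) (v ⊗ₜ w) + consFst K V (T K V ⊗[K] T K V)
        (v ⊗ₜ TensorProduct.assoc K (T K V) (T K V) (T K V) ((delta K V).rTensor (T K V) w)) := by
    intro v w
    induction w using TensorProduct.induction_on with
    | zero => simp
    | add x y hx hy => simp only [tmul_add, map_add, hx, hy]; abel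
    | tmul x y =>
      rw [consFst_tmul, LinearMap.rTensor_tmul, LinearMap.rTensor_tmul, delta_cons, add_tmul,
        map_add, assoc_tmul]
      congr 1
      generalize delta K V x = w
      induction w using TensorProduct.induction_on with
      | zero => simp
      | add x y hx hy => simp only [tmul_add, add_tmul, map_add, hx, hy]
      | tmul x y => simp
  have h2 : ∀ (v : V) (w : T K V ⊗[K] T K V),
      (delta K V).lTensor (T K V) (consFst K V (T K V) (v ⊗ₜ w)) =
      consFst K V (T K V ⊗[K] T K V) (v ⊗ₜ (delta K V).lTensor (T K V) w) := by
    intro v w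
    induction w using TensorProduct.induction_on with
    | zero => simp
    | add x y hx hy => simp only [tmul_add, map_add, hx, hy]
    | tmul x y => simp
  induction t using cons_induction with
  | one => simp
  | add s t hs ht => simp only [map_add, hs, ht]
  | smul r t ht => simp only [map_smul, ht]
  | cons v t ht =>
    rw [delta_cons, map_add, map_add, map_add, h1, h2, ht, LinearMap.rTensor_tmul,
      LinearMap.lTensor_tmul, delta_one, assoc_tmul, delta_cons, tmul_add, add_assoc]

theorem lid_delta (t : T K V) :
    TensorProduct.lid K (T K V) ((counit K V).rTensor (T K V) (delta K V t)) = t := by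
  induction t using cons_induction with
  | one => simp
  | add s t hs ht => simp only [map_add, hs, ht]
  | smul r t ht => simp only [map_smul, ht]
  | cons v t ht =>
    have h : ∀ w : T K V ⊗[K] T K V,
        (counit K V).rTensor (T K V) (consFst K V (T K V) (v ⊗ₜ w)) = 0 := by
      intro w
      induction w using TensorProduct.induction_on with
      | zero => simp
      | add x y hx hy => simp only [tmul_add, map_add, hx, hy, add_zero]
      | tmul x y => simp
    simp [delta_cons, h]

theorem rid_delta (t : T K V) :
    TensorProduct.rid K (T K V) ((counit K V).lTensor (T K V) (delta K V t)) = t := by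
  induction t using cons_induction with
  | one => simp
  | add s t hs ht => simp only [map_add, hs, ht]
  | smul r t ht => simp only [map_smul, ht]
  | cons v t ht =>
    have h : ∀ w : T K V ⊗[K] T K V, TensorProduct.rid K (T K V)
        ((counit K V).lTensor (T K V) (consFst K V (T K V) (v ⊗ₜ w))) =
        incl K V v * TensorProduct.rid K (T K V) ((counit K V).lTensor (T K V) w) := by
      intro w
      induction w using TensorProduct.induction_on with
      | zero => simp
      | add x y hx hy => simp only [tmul_add, map_add, hx, hy, mul_add]
      | tmul x y => simp
    simp [delta_cons, h, ht]

/-- Only the cut before the last letter survives the projection to degree one, and concatenation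
glues that letter back. So the identity solves the recursion which `t ↦ t ∗ 1` and `t ↦ 1 ∗ t`
satisfy. -/
theorem peel_last (t : T K V) :
    t = projDeg K V 0 t +
      LinearMap.mul' K (T K V) (TensorProduct.map LinearMap.id (projDeg K V 1) (delta K V t)) := by
  have h : ∀ (v : V) (w : T K V ⊗[K] T K V), LinearMap.mul' K (T K V)
      (TensorProduct.map LinearMap.id (projDeg K V 1) (consFst K V (T K V) (v ⊗ₜ w))) =
      incl K V v * LinearMap.mul' K (T K V)
        (TensorProduct.map LinearMap.id (projDeg K V 1) w) := by
    intro v w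
    induction w using TensorProduct.induction_on with
    | zero => simp
    | add x y hx hy => simp only [tmul_add, map_add, hx, hy, mul_add]
    | tmul x y => simp [mul_assoc]
  induction t using cons_induction with
  | one => simp [projDeg_succ_one 0]
  | add s t hs ht =>
    nth_rewrite 1 [hs, ht]
    simp only [map_add]
    abel
  | smul r t ht =>
    nth_rewrite 1 [ht]
    simp only [map_smul, smul_add]
  | cons v t ht =>
    nth_rewrite 1 [ht]
    simp [delta_cons, h, projDeg_succ_cons 0, mul_add]

theorem projDeg_mem (n : ℕ) (t : T K V) : projDeg K V n t ∈ deg K V n :=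
  SetLike.coe_mem _

theorem projDeg_of_mem {n : ℕ} {t : T K V} (ht : t ∈ deg K V n) : projDeg K V n t = t :=
  DirectSum.decompose_of_mem_same _ ht

theorem projDeg_of_mem_ne {m n : ℕ} {t : T K V} (ht : t ∈ deg K V n) (h : n ≠ m) :
    projDeg K V m t = 0 :=
  DirectSum.decompose_of_mem_ne _ ht h

theorem iSup_deg : ⨆ n, deg K V n = ⊤ :=
  (DirectSum.Decomposition.isInternal (deg K V)).submodule_iSup_eq_top

theorem one_mem_deg : (1 : T K V) ∈ deg K V 0 := SetLike.GradedOne.one_mem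

theorem cons_mem_deg {n : ℕ} (v : V) {t : T K V} (ht : t ∈ deg K V n) :
    incl K V v * t ∈ deg K V (n + 1) := by
  have h := projDeg_mem (n + 1) (incl K V v * t)
  rwa [projDeg_succ_cons, projDeg_of_mem ht] at h

theorem isGraded_delta : IsGraded (deg K V) (gr (deg K V) (deg K V)) (delta K V) := by
  -- Stating the claim for projections of arbitrary tensors makes the recursion in `t` available,
  -- together with induction on `n`.
  suffices H : ∀ n t, delta K V (projDeg K V n t) ∈ gr (deg K V) (deg K V) n by
    intro n t ht
    have := H n t
    rwa [projDeg_of_mem ht] at this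
  intro n
  induction n with
  | zero =>
    intro t
    rw [projDeg_zero_apply, map_smul, delta_one]
    exact Submodule.smul_mem _ _ (tmul_mem_gr (i := 0) (j := 0) one_mem_deg one_mem_deg)
  | succ n ih =>
    intro t
    induction t using cons_induction with
    | one => simp
    | add s t hs ht => rw [map_add, map_add]; exact Submodule.add_mem _ hs ht
    | smul r t ht => rw [map_smul, map_smul]; exact Submodule.smul_mem _ _ ht
    | cons v t _ =>
      rw [projDeg_succ_cons, delta_cons]
      refine Submodule.add_mem _ ?_ ?_
      · have h := tmul_mem_gr (i := 0) (j := n + 1) (one_mem_deg (K := K) (V := V))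
          (cons_mem_deg v (projDeg_mem n t))
        rwa [zero_add] at h
      · refine gr_induction (f := consFst K V (T K V) ∘ₗ TensorProduct.mk K V _ v) ?_ (ih t)
        rintro i j rfl a ha b hb
        simp only [LinearMap.comp_apply, mk_apply, consFst_tmul]
        rw [add_right_comm]
        exact tmul_mem_gr (cons_mem_deg v ha) hb

theorem map_projDeg_mem (i j : ℕ) (u : T K V ⊗[K] T K V) :
    TensorProduct.map (projDeg K V i) (projDeg K V j) u ∈ gr (deg K V) (deg K V) (i + j) := by
  induction u using TensorProduct.induction_on with
  | zero => simp
  | add u v hu hv => rw [map_add]; exact Submodule.add_mem _ hu hv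
  | tmul a b => exact tmul_mem_gr (projDeg_mem i a) (projDeg_mem j b)

variable (σ : V ⊗[K] V →ₗ[K] V ⊗[K] V)

/-- Naturality of `β` in both arguments at once. Part (a) is the case of the iterated products; for
degree projections it shows that `β` exchanges bidegrees. -/
theorem beta_map {f g : T K V →ₗ[K] T K V} (hf : IsCrossL (beta σ) (beta σ) f)
    (hg : IsCrossR (beta σ) (beta σ) g) (u : T K V ⊗[K] T K V) :
    beta σ (TensorProduct.map f g u) = TensorProduct.map g f (beta σ u) := by
  rw [← LinearMap.rTensor_comp_lTensor, LinearMap.comp_apply, hf.apply, hg.apply,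
    ← LinearMap.lTensor_comp_rTensor]
  rfl

theorem isGraded_beta :
    IsGraded (gr (deg K V) (deg K V)) (gr (deg K V) (deg K V)) (beta σ) := by
  refine .of_tmul fun i j x hx y hy => ?_
  have h := beta_map σ (isCrossL_projDeg σ i) (isCrossR_projDeg σ j) (x ⊗ₜ y)
  rw [map_tmul, projDeg_of_mem hx, projDeg_of_mem hy] at h
  rw [h, add_comm]
  exact map_projDeg_mem j i _

theorem coprod_eq_twist : coprod σ = twist (beta σ) (delta K V) (delta K V) := rfl

theorem isGraded_coprod :
    IsGraded (gr (deg K V) (deg K V))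
      (gr (gr (deg K V) (deg K V)) (gr (deg K V) (deg K V))) (coprod σ) :=
  .twist (isGraded_beta σ) isGraded_delta isGraded_delta

theorem coprod_coassoc (u : T K V ⊗[K] T K V) :
    TensorProduct.assoc K _ _ _ ((coprod σ).rTensor (T K V ⊗[K] T K V) (coprod σ u)) =
      (coprod σ).lTensor (T K V ⊗[K] T K V) (coprod σ u) :=
  twist_coassoc delta_coassoc delta_coassoc (isCrossL_delta σ) (isCrossR_delta σ) u

variable (K V) in
/-- The counit of `T(V) ⊗ T(V)`. -/
def counit₂ : T K V ⊗[K] T K V →ₗ[K] K :=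
  LinearMap.mul' K K ∘ₗ TensorProduct.map (counit K V) (counit K V)

@[simp]
theorem counit₂_tmul (x y : T K V) : counit₂ K V (x ⊗ₜ y) = counit K V x * counit K V y := by
  simp [counit₂]

theorem counit_projDeg_zero : counit K V ∘ₗ projDeg K V 0 = counit K V := by
  ext t
  simp [projDeg_zero_apply]

theorem rid_coprod (u : T K V ⊗[K] T K V) :
    TensorProduct.rid K _ ((counit₂ K V).lTensor (T K V ⊗[K] T K V) (coprod σ u)) = u := by
  refine rid_twist rid_delta rid_delta (fun x y => ?_) u
  -- The projection to degree `0` is `ε` times the unit, so its compatibility with `β` says that `ε`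
  -- passes through the crossing.
  have h := isCrossL_projDeg σ 0 x y
  rw [projDeg_zero_apply, ← smul_tmul', map_smul, beta_one_tmul] at h
  rw [← counit_projDeg_zero, LinearMap.lTensor_comp_apply, ← h]
  simp [projDeg_zero_apply]

theorem lid_coprod (u : T K V ⊗[K] T K V) :
    TensorProduct.lid K _ ((counit₂ K V).rTensor (T K V ⊗[K] T K V) (coprod σ u)) = u := by
  refine lid_twist lid_delta lid_delta (fun x y => ?_) u
  have h := isCrossR_projDeg σ 0 x y
  rw [projDeg_zero_apply, tmul_smul, map_smul, beta_tmul_one] at h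
  rw [← counit_projDeg_zero, LinearMap.rTensor_comp_apply, ← h]
  simp [projDeg_zero_apply]

end TensorSpace

/-! ### The recursion for `∗` and the proof that it is a coalgebra map. -/

section StarProduct

variable {K : Type*} [Field K] {V : Type*} [AddCommGroup V] [Module K V]
  {X Y : Type*} [AddCommGroup X] [Module K X] [AddCommGroup Y] [Module K Y]

theorem hom_ext_deg {f g : T K V →ₗ[K] X} (h : ∀ n, ∀ x ∈ deg K V n, f x = g x) : f = g := by
  rw [← sub_eq_zero]
  exact eq_zero_of_mem_graded iSup_deg fun n x hx => by simp [h n x hx]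

theorem hom_ext_deg₂ {f g : T K V ⊗[K] T K V →ₗ[K] X}
    (h : ∀ i j, ∀ x ∈ deg K V i, ∀ y ∈ deg K V j, f (x ⊗ₜ y) = g (x ⊗ₜ y)) : f = g := by
  rw [← sub_eq_zero]
  exact eq_zero_of_mem_graded (iSup_gr iSup_deg iSup_deg) fun n u hu =>
    gr_eq_zero (fun i j _ x hx y hy => by simp [h i j x hx y hy]) hu

/-- In fixed degrees, cutting inverts concatenation. This translates the axioms on `M`, which read
`M_{ij}` on `V^{⊗ (i+j)}`, back to `T(V) ⊗ T(V)`. -/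
theorem split_mul (i j : ℕ) (x y : T K V) :
    split K V i j (projDeg K V i x * projDeg K V j y) = projDeg K V i x ⊗ₜ projDeg K V j y := by
  induction i generalizing x with
  | zero =>
    have h : ∀ w : T K V ⊗[K] T K V, TensorProduct.map (projDeg K V 0) (projDeg K V j) w =
        1 ⊗ₜ projDeg K V j (TensorProduct.lid K _ ((counit K V).rTensor (T K V) w)) := by
      intro w
      induction w using TensorProduct.induction_on with
      | zero => simp
      | add u v hu hv => simp only [map_add, tmul_add, hu, hv]
      | tmul s t => simp [projDeg_zero_apply, smul_tmul]
    rw [projDeg_zero_apply, smul_mul_assoc, one_mul, map_smul, split, LinearMap.comp_apply, h,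
      lid_delta, projDeg_of_mem (projDeg_mem j y), smul_tmul']
  | succ i ih =>
    induction x using cons_induction with
    | one => simp
    | add s t hs ht => simp only [map_add, add_mul, add_tmul, hs, ht]
    | smul r t ht => simp only [map_smul, smul_mul_assoc, ← smul_tmul', ht]
    | cons v x _ =>
      have h : ∀ w : T K V ⊗[K] T K V,
          TensorProduct.map (projDeg K V (i + 1)) (projDeg K V j) (consFst K V (T K V) (v ⊗ₜ w)) =
          consFst K V (T K V)
            (v ⊗ₜ TensorProduct.map (projDeg K V i) (projDeg K V j) w) := by
        intro w
        induction w using TensorProduct.induction_on with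
        | zero => simp
        | add u v hu hv => simp only [map_add, tmul_add, hu, hv]
        | tmul s t => simp
      have ih' := ih x
      rw [split, LinearMap.comp_apply] at ih'
      rw [projDeg_succ_cons, mul_assoc, split, LinearMap.comp_apply, delta_cons, map_add, h, ih']
      simp

theorem mul_incl_projDeg_one (t : T K V) (v : V) :
    projDeg K V 1 (t * incl K V v) = counit K V t • incl K V v := by
  have hv : incl K V v = incl K V v * 1 := (mul_one _).symm
  induction t using cons_induction with
  | one =>
    rw [one_mul, counit_one, one_smul]
    exact projDeg_of_mem (incl_mem_deg v)
  | add s t hs ht => simp only [map_add, add_mul, add_smul, hs, ht]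
  | smul r t ht => simp only [map_smul, smul_mul_assoc, ht, smul_assoc]
  | cons w t _ =>
    have h0 : projDeg K V 0 (t * incl K V v) = 0 := by
      rw [projDeg_zero_apply]
      simp [counit, TensorAlgebra.algebraMapInv]
    rw [mul_assoc, projDeg_succ_cons, h0, counit_cons]
    simp

/-- The mirror image of `delta_cons`: `∗` builds its output by appending letters on the right. -/
theorem delta_mul_incl (t : T K V) (v : V) :
    delta K V (t * incl K V v) = (t * incl K V v) ⊗ₜ 1 +
      (LinearMap.mul' K (T K V)).lTensor (T K V)
        (TensorProduct.assoc K (T K V) (T K V) (T K V) (delta K V t ⊗ₜ incl K V v)) := by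
  induction t using cons_induction with
  | one =>
    have h := delta_cons v (1 : T K V)
    rw [mul_one, delta_one, consFst_tmul, mul_one] at h
    rw [one_mul, h]
    simp [add_comm]
  | add s t hs ht => simp only [map_add, add_mul, add_tmul, hs, ht]; abel
  | smul r t ht => simp only [map_smul, smul_mul_assoc, ← smul_tmul', ht, smul_add]
  | cons w t ht =>
    have h : ∀ u : T K V ⊗[K] T K V, (LinearMap.mul' K (T K V)).lTensor (T K V)
        (TensorProduct.assoc K (T K V) (T K V) (T K V)
          (consFst K V (T K V) (w ⊗ₜ u) ⊗ₜ incl K V v)) =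
        consFst K V (T K V) (w ⊗ₜ (LinearMap.mul' K (T K V)).lTensor (T K V)
          (TensorProduct.assoc K (T K V) (T K V) (T K V) (u ⊗ₜ incl K V v))) := by
      intro u
      induction u using TensorProduct.induction_on with
      | zero => simp
      | add u v hu hv => simp only [map_add, tmul_add, add_tmul, hu, hv]
      | tmul s t => simp
    rw [mul_assoc, delta_cons, ht, delta_cons, add_tmul, map_add, map_add, h, tmul_add, map_add]
    simp [mul_assoc]
    abel

theorem eq_smul_one_of_mem_deg_zero {t : T K V} (ht : t ∈ deg K V 0) :
    t = counit K V t • (1 : T K V) := by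
  rw [← projDeg_zero_apply, projDeg_of_mem ht]

theorem counit_of_mem_deg {n : ℕ} (hn : 1 ≤ n) {t : T K V} (ht : t ∈ deg K V n) :
    counit K V t = 0 := by
  rw [← counit_projDeg_zero, LinearMap.comp_apply, projDeg_of_mem_ne ht (by omega), map_zero]

theorem sum_Icc_one (f : ℕ → X) (n : ℕ) :
    ∑ k ∈ Finset.Icc 1 n, f k = ∑ k ∈ Finset.range n, f (k + 1) := by
  induction n with
  | zero => simp
  | succ n ih => rw [Finset.sum_Icc_succ_top (by omega), ih, Finset.sum_range_succ]

variable (σ : V ⊗[K] V →ₗ[K] V ⊗[K] V) (M : T K V ⊗[K] T K V →ₗ[K] V)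

/-- Since `β` commutes with degree projections, compatibility may be checked bidegree by bidegree,
against a model map `g` that depends on the bidegree. This suits `∗`, a different finite sum in each
bidegree. -/
theorem isCrossL_of_local {τX : X ⊗[K] T K V →ₗ[K] T K V ⊗[K] X}
    {f : T K V ⊗[K] T K V →ₗ[K] X}
    (h : ∀ i j, ∃ g, IsCrossL (crossL (beta σ) (beta σ)) τX g ∧
      ∀ x ∈ deg K V i, ∀ y ∈ deg K V j, f (x ⊗ₜ y) = g (x ⊗ₜ y)) :
    IsCrossL (crossL (beta σ) (beta σ)) τX f := by
  intro u z
  suffices H : τX ∘ₗ (TensorProduct.mk K X (T K V)).flip z ∘ₗ f =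
      f.lTensor (T K V) ∘ₗ crossL (beta σ) (beta σ) ∘ₗ (TensorProduct.mk K _ (T K V)).flip z from
    LinearMap.congr_fun H u
  refine hom_ext_deg₂ fun i j x hx y hy => ?_
  obtain ⟨g, hg, hfg⟩ := h i j
  simp only [LinearMap.comp_apply, LinearMap.flip_apply, mk_apply]
  have hp := (isCrossL_projDeg σ i).map (isCrossL_projDeg σ j) (x ⊗ₜ y) z
  rw [map_tmul, projDeg_of_mem hx, projDeg_of_mem hy] at hp
  rw [hfg x hx y hy, hg, hp, ← LinearMap.lTensor_comp_apply, ← LinearMap.lTensor_comp_apply]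
  congr 2
  refine TensorProduct.ext' fun x y => ?_
  exact (hfg _ (projDeg_mem i x) _ (projDeg_mem j y)).symm

theorem isCrossR_of_local {ρX : T K V ⊗[K] X →ₗ[K] X ⊗[K] T K V}
    {f : T K V ⊗[K] T K V →ₗ[K] X}
    (h : ∀ i j, ∃ g, IsCrossR (crossR (beta σ) (beta σ)) ρX g ∧
      ∀ x ∈ deg K V i, ∀ y ∈ deg K V j, f (x ⊗ₜ y) = g (x ⊗ₜ y)) :
    IsCrossR (crossR (beta σ) (beta σ)) ρX f := by
  intro z u
  suffices H : ρX ∘ₗ TensorProduct.mk K (T K V) X z ∘ₗ f =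
      f.rTensor (T K V) ∘ₗ crossR (beta σ) (beta σ) ∘ₗ TensorProduct.mk K (T K V) _ z from
    LinearMap.congr_fun H u
  refine hom_ext_deg₂ fun i j x hx y hy => ?_
  obtain ⟨g, hg, hfg⟩ := h i j
  simp only [LinearMap.comp_apply, mk_apply]
  have hp := (isCrossR_projDeg σ i).map (isCrossR_projDeg σ j) z (x ⊗ₜ y)
  rw [map_tmul, projDeg_of_mem hx, projDeg_of_mem hy] at hp
  rw [hfg x hx y hy, hg, hp, ← LinearMap.rTensor_comp_apply, ← LinearMap.rTensor_comp_apply]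
  congr 2
  refine TensorProduct.ext' fun x y => ?_
  exact (hfg _ (projDeg_mem i x) _ (projDeg_mem j y)).symm

/-- The components `M^{⊗ n} Δ̄_β^{(n-1)}` of the product `∗`, including `ε ⊗ ε` for `n = 0`. -/
def component : ℕ → (T K V ⊗[K] T K V →ₗ[K] T K V)
  | 0 => LinearMap.mul' K (T K V) ∘ₗ TensorProduct.map (projDeg K V 0) (projDeg K V 0)
  | n + 1 => multiM σ M (n + 1)

theorem component_zero_apply (u : T K V ⊗[K] T K V) :
    component σ M 0 u = counit₂ K V u • 1 := by
  induction u using TensorProduct.induction_on with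
  | zero => simp
  | add u v hu hv => simp only [map_add, add_smul, hu, hv]
  | tmul x y => simp [component, projDeg_zero_apply, smul_smul, mul_comm]

theorem starProd_of_mem {i j : ℕ} {x y : T K V} (hx : x ∈ deg K V i) (hy : y ∈ deg K V j) :
    starProd σ M (x ⊗ₜ y) = ∑ n ∈ Finset.range (i + j + 1), component σ M n (x ⊗ₜ y) := by
  have h0 : (Algebra.linearMap K (T K V) ∘ₗ TensorAlgebra.algebraMapInv.toLinearMap :
      T K V →ₗ[K] T K V) = projDeg K V 0 := by
    ext t
    rw [projDeg_zero_apply, ← Algebra.algebraMap_eq_smul_one]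
    rfl
  rw [Finset.sum_range_succ', ← sum_Icc_one (fun n => component σ M n (x ⊗ₜ y)), add_comm]
  have hc : ∑ n ∈ Finset.Icc 1 (i + j), component σ M n (x ⊗ₜ y) =
      ∑ n ∈ Finset.Icc 1 (i + j), multiM σ M n (x ⊗ₜ y) := by
    refine Finset.sum_congr rfl fun n hn => ?_
    obtain ⟨m, rfl⟩ : ∃ m, n = m + 1 := ⟨n - 1, by have := (Finset.mem_Icc.1 hn).1; omega⟩
    rfl
  simp only [starProd, lift.tmul, LinearMap.comp_apply, LinearEquiv.coe_coe,
    DirectSum.decomposeLinearEquiv_apply, DirectSum.decompose_of_mem _ hx]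
  rw [← DirectSum.lof_eq_of K, DirectSum.toModule_lof,
    LinearMap.flip_apply, LinearMap.comp_apply, LinearEquiv.coe_coe,
    DirectSum.decomposeLinearEquiv_apply, DirectSum.decompose_of_mem _ hy,
    ← DirectSum.lof_eq_of K, DirectSum.toModule_lof, hc]
  simp only [starHom, h0, component, LinearMap.flip_apply, LinearMap.compl₁₂_apply,
    LinearMap.compr₂_apply, mk_apply, LinearMap.add_apply, LinearMap.sum_apply,
    Submodule.subtype_apply]

theorem redCoprod_apply (u : T K V ⊗[K] T K V) :
    redCoprod σ u = coprod σ u - u ⊗ₜ (1 ⊗ₜ 1) - (1 ⊗ₜ 1) ⊗ₜ u := rfl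

section Recursion

variable {σ M} (hM : M ((1 : T K V) ⊗ₜ (1 : T K V)) = 0)

include hM

/-- With `ε ⊗ ε` as zeroth term, the recursion holds for the full coproduct. For `n ≥ 1` the two
terms subtracted in the reduced coproduct contribute nothing, as `M` and the earlier component
vanish on `1 ⊗ 1`; for `n = 0` the counit law leaves `M`. -/
theorem component_succ (n : ℕ) (u : T K V ⊗[K] T K V) :
    component σ M (n + 1) u = LinearMap.mul' K (T K V)
      (TensorProduct.map (component σ M n) (incl K V ∘ₗ M) (coprod σ u)) := by
  cases n with
  | zero =>
    have h : ∀ w : (T K V ⊗[K] T K V) ⊗[K] (T K V ⊗[K] T K V), LinearMap.mul' K (T K V)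
        (TensorProduct.map (component σ M 0) (incl K V ∘ₗ M) w) =
        incl K V (M (TensorProduct.lid K _ ((counit₂ K V).rTensor _ w))) := by
      intro w
      induction w using TensorProduct.induction_on with
      | zero => simp
      | add u v hu hv => simp only [map_add, hu, hv]
      | tmul s t => simp [component_zero_apply]
    rw [h, lid_coprod]
    rfl
  | succ n =>
    have h1 : multiM σ M (n + 1) (1 ⊗ₜ 1) = 0 := by
      cases n with
      | zero => simp [multiM, hM]
      | succ n =>
        simp [multiM, redCoprod_apply, coprod_eq_twist, twist_tmul, midCross_tmul, hM]
    simp [component, multiM, redCoprod_apply, h1, hM]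

theorem M_eq_zero_of_mem {u : T K V ⊗[K] T K V} (hu : u ∈ gr (deg K V) (deg K V) 0) :
    M u = 0 := by
  refine gr_eq_zero ?_ hu
  intro i j hij x hx y hy
  obtain ⟨rfl, rfl⟩ : i = 0 ∧ j = 0 := by omega
  rw [eq_smul_one_of_mem_deg_zero hx, eq_smul_one_of_mem_deg_zero hy]
  simp [← smul_tmul', hM]

/-- Each of the `n` factors `M` consumes degree at least one, so the sum for `∗` may be cut off at
any bound not below the degree (`starProd_eq_sum`). -/
theorem component_eq_zero {n N : ℕ} (h : N < n) {u : T K V ⊗[K] T K V}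
    (hu : u ∈ gr (deg K V) (deg K V) N) : component σ M n u = 0 := by
  induction n generalizing N u with
  | zero => omega
  | succ n ih =>
    rw [component_succ hM]
    refine gr_eq_zero (f := LinearMap.mul' K (T K V) ∘ₗ
      TensorProduct.map (component σ M n) (incl K V ∘ₗ M)) ?_ (isGraded_coprod σ N u hu)
    intro i j hij a ha b hb
    rw [LinearMap.comp_apply, map_tmul]
    rcases Nat.eq_zero_or_pos j with rfl | hj
    · simp [M_eq_zero_of_mem hM hb]
    · rw [ih (N := i) (by omega) ha]
      simp

theorem starProd_eq_sum {m N : ℕ} (h : m ≤ N) {u : T K V ⊗[K] T K V}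
    (hu : u ∈ gr (deg K V) (deg K V) m) :
    starProd σ M u = ∑ n ∈ Finset.range (N + 1), component σ M n u := by
  rw [← sub_eq_zero, ← LinearMap.sum_apply, ← LinearMap.sub_apply]
  refine gr_eq_zero ?_ hu
  rintro i j rfl x hx y hy
  rw [LinearMap.sub_apply, LinearMap.sum_apply, starProd_of_mem σ M hx hy, sub_eq_zero]
  refine Finset.sum_subset (by simpa using h) fun n _ hn => ?_
  exact component_eq_zero hM (by simpa using hn) (tmul_mem_gr hx hy)

theorem starProd_recursion (u : T K V ⊗[K] T K V) :
    starProd σ M u = counit₂ K V u • 1 + LinearMap.mul' K (T K V)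
      (TensorProduct.map (starProd σ M) (incl K V ∘ₗ M) (coprod σ u)) := by
  suffices H : starProd σ M = component σ M 0 + LinearMap.mul' K (T K V) ∘ₗ
      TensorProduct.map (starProd σ M) (incl K V ∘ₗ M) ∘ₗ coprod σ by
    conv_lhs => rw [H]
    simp [component_zero_apply]
  refine hom_ext_deg₂ fun i j x hx y hy => ?_
  have hu := tmul_mem_gr hx hy
  have h : LinearMap.mul' K (T K V) (TensorProduct.map (starProd σ M) (incl K V ∘ₗ M)
      (coprod σ (x ⊗ₜ y))) = ∑ n ∈ Finset.range (i + j + 1), LinearMap.mul' K (T K V)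
        (TensorProduct.map (component σ M n) (incl K V ∘ₗ M) (coprod σ (x ⊗ₜ y))) := by
    rw [← sub_eq_zero]
    refine gr_eq_zero (f := LinearMap.mul' K (T K V) ∘ₗ
      TensorProduct.map (starProd σ M) (incl K V ∘ₗ M) - ∑ n ∈ Finset.range (i + j + 1),
        LinearMap.mul' K (T K V) ∘ₗ TensorProduct.map (component σ M n) (incl K V ∘ₗ M)) ?_
      (isGraded_coprod σ _ _ hu) |> fun h => by simpa using h
    intro k l hkl a ha b _
    rw [LinearMap.sub_apply, sub_eq_zero, LinearMap.sum_apply]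
    simp only [LinearMap.comp_apply, map_tmul, LinearMap.mul'_apply, ← Finset.sum_mul]
    rw [starProd_eq_sum hM (N := i + j) (by omega) ha]
  -- The left-hand sum is taken one term beyond the degree, a vanishing term, so that after
  -- splitting off `n = 0` and shifting both sums have the same range.
  rw [LinearMap.add_apply, LinearMap.comp_apply, LinearMap.comp_apply, h,
    starProd_eq_sum hM (N := i + j + 1) (by omega) hu, Finset.sum_range_succ', add_comm]
  simp only [component_succ hM]

theorem counit_starProd (u : T K V ⊗[K] T K V) : counit K V (starProd σ M u) = counit₂ K V u := by
  have h : ∀ w : (T K V ⊗[K] T K V) ⊗[K] (T K V ⊗[K] T K V), counit K V (LinearMap.mul' K (T K V)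
      (TensorProduct.map (starProd σ M) (incl K V ∘ₗ M) w)) = 0 := by
    intro w
    induction w using TensorProduct.induction_on with
    | zero => simp
    | add u v hu hv => simp only [map_add, hu, hv, add_zero]
    | tmul s t => simp [counit, TensorAlgebra.algebraMapInv]
  rw [starProd_recursion hM, map_add, h]
  simp

theorem projDeg_one_starProd (u : T K V ⊗[K] T K V) :
    projDeg K V 1 (starProd σ M u) = incl K V (M u) := by
  have h : ∀ w : (T K V ⊗[K] T K V) ⊗[K] (T K V ⊗[K] T K V), projDeg K V 1
      (LinearMap.mul' K (T K V) (TensorProduct.map (starProd σ M) (incl K V ∘ₗ M) w)) =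
      incl K V (M (TensorProduct.lid K _ ((counit₂ K V).rTensor _ w))) := by
    intro w
    induction w using TensorProduct.induction_on with
    | zero => simp
    | add u v hu hv => simp only [map_add, hu, hv]
    | tmul s t => simp [mul_incl_projDeg_one, counit_starProd hM]
  rw [starProd_recursion hM, map_add, h, lid_coprod, map_smul, projDeg_succ_one 0]
  simp

/-- Both composites solve `F(c) = (∗c) ⊗ 1 + (id ⊗ m)(F ⊗ M)(Δ_β c)`, with `m` concatenation, and
uniqueness identifies them. -/
theorem delta_starProd (u : T K V ⊗[K] T K V) :
    delta K V (starProd σ M u) =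
      TensorProduct.map (starProd σ M) (starProd σ M) (coprod σ u) := by
  refine LinearMap.congr_fun (f := delta K V ∘ₗ starProd σ M)
    (g := TensorProduct.map (starProd σ M) (starProd σ M) ∘ₗ coprod σ) ?_ u
  refine eq_of_recursion (iSup_gr iSup_deg iSup_deg) (isGraded_coprod σ) (φ := incl K V ∘ₗ M)
    (fun c hc => by simp [M_eq_zero_of_mem hM hc])
    (a := (LinearMap.mul' K (T K V)).lTensor (T K V) ∘ₗ
      (TensorProduct.assoc K (T K V) (T K V) (T K V)).toLinearMap)
    (b := fun c => starProd σ M c ⊗ₜ 1) ?_ ?_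
  · intro c
    have h : ∀ w : (T K V ⊗[K] T K V) ⊗[K] (T K V ⊗[K] T K V),
        delta K V (LinearMap.mul' K (T K V)
          (TensorProduct.map (starProd σ M) (incl K V ∘ₗ M) w)) =
        LinearMap.mul' K (T K V) (TensorProduct.map (starProd σ M) (incl K V ∘ₗ M) w) ⊗ₜ 1 +
          (LinearMap.mul' K (T K V)).lTensor (T K V) (TensorProduct.assoc K (T K V) (T K V) (T K V)
            (TensorProduct.map (delta K V ∘ₗ starProd σ M) (incl K V ∘ₗ M) w)) := by
      intro w
      induction w using TensorProduct.induction_on with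
      | zero => simp
      | add u v hu hv => simp only [map_add, add_tmul, hu, hv]; abel
      | tmul s t =>
        simp only [map_tmul, LinearMap.mul'_apply, LinearMap.comp_apply, delta_mul_incl]
    have hc := starProd_recursion (σ := σ) hM c
    rw [LinearMap.comp_apply, hc, map_add, h, map_smul, delta_one, ← add_assoc, smul_tmul',
      ← add_tmul, ← hc]
    rfl
  · intro c
    -- The recursion for `∗` is applied in the second tensor factor only: its counit term gives
    -- `(∗c) ⊗ 1`, and coassociativity regroups the rest.
    have h : ∀ w : (T K V ⊗[K] T K V) ⊗[K] (T K V ⊗[K] T K V),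
        TensorProduct.map (starProd σ M) (starProd σ M) w =
        starProd σ M (TensorProduct.rid K _ ((counit₂ K V).lTensor _ w)) ⊗ₜ 1 +
          (LinearMap.mul' K (T K V)).lTensor (T K V) (TensorProduct.assoc K (T K V) (T K V) (T K V)
            (TensorProduct.map (TensorProduct.map (starProd σ M) (starProd σ M)) (incl K V ∘ₗ M)
              ((TensorProduct.assoc K _ _ _).symm ((coprod σ).lTensor _ w)))) := by
      intro w
      induction w using TensorProduct.induction_on with
      | zero => simp
      | add u v hu hv =>
        simp only [map_add, add_tmul]
        rw [hu, hv]
        abel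
      | tmul s t =>
        rw [map_tmul, starProd_recursion hM t, tmul_add, LinearMap.lTensor_tmul,
          LinearMap.lTensor_tmul, rid_tmul, map_smul, tmul_smul, smul_tmul']
        congr 1
        generalize coprod σ t = w
        induction w using TensorProduct.induction_on with
        | zero => simp
        | add u v hu hv => simp only [map_add, tmul_add, hu, hv]
        | tmul a b => simp
    rw [LinearMap.comp_apply, h, rid_coprod, ← coprod_coassoc, LinearEquiv.symm_apply_apply,
      LinearMap.rTensor, ← LinearMap.comp_apply (TensorProduct.map _ _), ← TensorProduct.map_comp]
    rfl

end Recursion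

end StarProduct

/-! ### Naturality of `M` and `∗`, the unit laws and associativity. -/

section StarCrossings

variable {K : Type*} [Field K] {V : Type*} [AddCommGroup V] [Module K V]
  {σ : V ⊗[K] V →ₗ[K] V ⊗[K] V} {M : T K V ⊗[K] T K V →ₗ[K] V}

theorem isCrossL_coprod (hσ : IsBraiding σ) :
    IsCrossL (crossL (beta σ) (beta σ))
      (crossL (crossL (beta σ) (beta σ)) (crossL (beta σ) (beta σ))) (coprod σ) :=
  .comp .assoc_symm (.comp (.lTensor (.slide (isCrossL_beta hσ)))
    (.comp .assoc (.map (isCrossL_delta σ) (isCrossL_delta σ))))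

theorem isCrossR_coprod (hσ : IsBraiding σ) :
    IsCrossR (crossR (beta σ) (beta σ))
      (crossR (crossR (beta σ) (beta σ)) (crossR (beta σ) (beta σ))) (coprod σ) :=
  .comp .assoc_symm (.comp (.lTensor (.slide (isCrossR_beta hσ)))
    (.comp .assoc (.map (isCrossR_delta σ) (isCrossR_delta σ))))

theorem starProd_of_pos {i j : ℕ} (hi : 1 ≤ i) {x y : T K V} (hx : x ∈ deg K V i)
    (hy : y ∈ deg K V j) :
    starProd σ M (x ⊗ₜ y) = ∑ n ∈ Finset.Icc 1 (i + j), multiM σ M n (x ⊗ₜ y) := by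
  rw [starProd_of_mem σ M hx hy, Finset.sum_range_succ', sum_Icc_one, component_zero_apply,
    counit₂_tmul, counit_of_mem_deg hi hx]
  simp [component]

theorem hom_ext_deg₃ {X : Type*} [AddCommGroup X] [Module K X]
    {f g : (T K V ⊗[K] T K V) ⊗[K] T K V →ₗ[K] X}
    (h : ∀ i j k, ∀ x ∈ deg K V i, ∀ y ∈ deg K V j, ∀ z ∈ deg K V k,
      f ((x ⊗ₜ y) ⊗ₜ z) = g ((x ⊗ₜ y) ⊗ₜ z)) : f = g := by
  rw [← sub_eq_zero]
  refine eq_zero_of_mem_graded (iSup_gr (iSup_gr iSup_deg iSup_deg) iSup_deg) fun n u hu =>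
    gr_eq_zero (fun m k _ u hu z hz => ?_) hu
  refine gr_eq_zero (f := (f - g) ∘ₗ (TensorProduct.mk K _ _).flip z) (fun i j _ x hx y hy => ?_) hu
  simp [h i j k x hx y hy z hz]

variable (hM : IsQuantumBInf σ M)

include hM

theorem incl_M_tmul_one (t : T K V) : incl K V (M (t ⊗ₜ 1)) = projDeg K V 1 t := by
  refine LinearMap.congr_fun (f := incl K V ∘ₗ M ∘ₗ (TensorProduct.mk K _ _).flip 1)
    (hom_ext_deg fun n x hx => ?_) t
  simp only [LinearMap.comp_apply, LinearMap.flip_apply, mk_apply]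
  rcases n with _ | _ | n
  · rw [eq_smul_one_of_mem_deg_zero hx, ← smul_tmul', map_smul, hM.M_zero_zero]
    simp [projDeg_succ_one 0]
  · rw [projDeg_of_mem hx]
    rw [deg, zero_add, pow_one] at hx
    obtain ⟨v, rfl⟩ := hx
    rw [hM.M_one_zero]
  · rw [hM.M_n_zero (n + 2) (by omega) x hx, projDeg_of_mem_ne hx (by omega), map_zero]

theorem incl_M_one_tmul (t : T K V) : incl K V (M (1 ⊗ₜ t)) = projDeg K V 1 t := by
  refine LinearMap.congr_fun (f := incl K V ∘ₗ M ∘ₗ TensorProduct.mk K _ _ 1)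
    (hom_ext_deg fun n x hx => ?_) t
  simp only [LinearMap.comp_apply, mk_apply]
  rcases n with _ | _ | n
  · rw [eq_smul_one_of_mem_deg_zero hx, tmul_smul, map_smul, hM.M_zero_zero]
    simp [projDeg_succ_one 0]
  · rw [projDeg_of_mem hx]
    rw [deg, zero_add, pow_one] at hx
    obtain ⟨v, rfl⟩ := hx
    rw [hM.M_zero_one]
  · rw [hM.M_zero_n (n + 2) (by omega) x hx, projDeg_of_mem_ne hx (by omega), map_zero]

theorem isCrossL_M : IsCrossL (crossL (beta σ) (beta σ)) (beta σ) (incl K V ∘ₗ M) := by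
  refine isCrossL_of_local σ fun i j => ?_
  rcases Nat.eq_zero_or_pos i with rfl | hi
  · refine ⟨LinearMap.mul' K (T K V) ∘ₗ TensorProduct.map (projDeg K V 0) (projDeg K V 1),
      .comp (isCrossL_mul σ) (.map (isCrossL_projDeg σ 0) (isCrossL_projDeg σ 1)), ?_⟩
    intro x hx y _
    rw [eq_smul_one_of_mem_deg_zero hx]
    simp [← smul_tmul', incl_M_one_tmul hM]
  rcases Nat.eq_zero_or_pos j with rfl | hj
  · refine ⟨LinearMap.mul' K (T K V) ∘ₗ TensorProduct.map (projDeg K V 1) (projDeg K V 0),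
      .comp (isCrossL_mul σ) (.map (isCrossL_projDeg σ 1) (isCrossL_projDeg σ 0)), ?_⟩
    intro x _ y hy
    rw [eq_smul_one_of_mem_deg_zero hy]
    simp [incl_M_tmul_one hM]
  -- In positive bidegree `M` factors as concatenation followed by `M_{ij}` read on `V^{⊗ (i+j)}`,
  -- and the second axiom speaks about the latter.
  refine ⟨(incl K V ∘ₗ M ∘ₗ split K V i j ∘ₗ projDeg K V (i + j)) ∘ₗ LinearMap.mul' K (T K V),
    .comp ?_ (isCrossL_mul σ), ?_⟩
  · intro x z
    suffices H : beta σ ∘ₗ TensorProduct.mk K _ _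
          ((incl K V ∘ₗ M ∘ₗ split K V i j ∘ₗ projDeg K V (i + j)) x) =
        (incl K V ∘ₗ M ∘ₗ split K V i j).lTensor (T K V) ∘ₗ beta σ ∘ₗ
          TensorProduct.mk K _ _ (projDeg K V (i + j) x) by
      have h := LinearMap.congr_fun H z
      simp only [LinearMap.comp_apply, mk_apply, isCrossL_projDeg σ (i + j) x z] at h
      rw [LinearMap.comp_apply, LinearMap.comp_apply, LinearMap.comp_apply, h,
        ← LinearMap.lTensor_comp_apply]
      rfl
    refine hom_ext_deg fun k z hz => ?_
    -- The axiom covers only `k ≥ 1`; for `k = 0` the crossing with a scalar is the flip.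
    rcases Nat.eq_zero_or_pos k with rfl | hk
    · rw [eq_smul_one_of_mem_deg_zero hz]
      simp
    · exact hM.yang_baxter_left i j k hi hj hk _ (projDeg_mem _ x) z hz
  · intro x hx y hy
    have hxy : x * y ∈ deg K V (i + j) := SetLike.GradedMul.mul_mem hx hy
    have h := split_mul i j x y
    rw [projDeg_of_mem hx, projDeg_of_mem hy] at h
    simp [projDeg_of_mem hxy, h]

theorem isCrossR_M : IsCrossR (crossR (beta σ) (beta σ)) (beta σ) (incl K V ∘ₗ M) := by
  refine isCrossR_of_local σ fun i j => ?_
  rcases Nat.eq_zero_or_pos i with rfl | hi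
  · refine ⟨LinearMap.mul' K (T K V) ∘ₗ TensorProduct.map (projDeg K V 0) (projDeg K V 1),
      .comp (isCrossR_mul σ) (.map (isCrossR_projDeg σ 0) (isCrossR_projDeg σ 1)), ?_⟩
    intro x hx y _
    rw [eq_smul_one_of_mem_deg_zero hx]
    simp [← smul_tmul', incl_M_one_tmul hM]
  rcases Nat.eq_zero_or_pos j with rfl | hj
  · refine ⟨LinearMap.mul' K (T K V) ∘ₗ TensorProduct.map (projDeg K V 1) (projDeg K V 0),
      .comp (isCrossR_mul σ) (.map (isCrossR_projDeg σ 1) (isCrossR_projDeg σ 0)), ?_⟩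
    intro x _ y hy
    rw [eq_smul_one_of_mem_deg_zero hy]
    simp [incl_M_tmul_one hM]
  refine ⟨(incl K V ∘ₗ M ∘ₗ split K V i j ∘ₗ projDeg K V (i + j)) ∘ₗ LinearMap.mul' K (T K V),
    .comp ?_ (isCrossR_mul σ), ?_⟩
  · intro z x
    suffices H : beta σ ∘ₗ (TensorProduct.mk K _ _).flip
          ((incl K V ∘ₗ M ∘ₗ split K V i j ∘ₗ projDeg K V (i + j)) x) =
        (incl K V ∘ₗ M ∘ₗ split K V i j).rTensor (T K V) ∘ₗ beta σ ∘ₗ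
          (TensorProduct.mk K _ _).flip (projDeg K V (i + j) x) by
      have h := LinearMap.congr_fun H z
      simp only [LinearMap.comp_apply, LinearMap.flip_apply, mk_apply,
        isCrossR_projDeg σ (i + j) z x] at h
      rw [LinearMap.comp_apply, LinearMap.comp_apply, LinearMap.comp_apply, h,
        ← LinearMap.rTensor_comp_apply]
      rfl
    refine hom_ext_deg fun k z hz => ?_
    rcases Nat.eq_zero_or_pos k with rfl | hk
    · rw [eq_smul_one_of_mem_deg_zero hz]
      simp
    · exact hM.yang_baxter_right k i j hk hi hj z hz _ (projDeg_mem _ x)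
  · intro x hx y hy
    have hxy : x * y ∈ deg K V (i + j) := SetLike.GradedMul.mul_mem hx hy
    have h := split_mul i j x y
    rw [projDeg_of_mem hx, projDeg_of_mem hy] at h
    simp [projDeg_of_mem hxy, h]

theorem isCrossL_component (n : ℕ) :
    IsCrossL (crossL (beta σ) (beta σ)) (beta σ) (component σ M n) := by
  induction n with
  | zero => exact .comp (isCrossL_mul σ) (.map (isCrossL_projDeg σ 0) (isCrossL_projDeg σ 0))
  | succ n ih =>
    have h : component σ M (n + 1) = LinearMap.mul' K (T K V) ∘ₗ
        TensorProduct.map (component σ M n) (incl K V ∘ₗ M) ∘ₗ coprod σ :=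
      LinearMap.ext (component_succ hM.M_zero_zero n)
    rw [h]
    exact .comp (isCrossL_mul σ) (.comp (ih.map (isCrossL_M hM)) (isCrossL_coprod hM.braiding))

theorem isCrossR_component (n : ℕ) :
    IsCrossR (crossR (beta σ) (beta σ)) (beta σ) (component σ M n) := by
  induction n with
  | zero => exact .comp (isCrossR_mul σ) (.map (isCrossR_projDeg σ 0) (isCrossR_projDeg σ 0))
  | succ n ih =>
    have h : component σ M (n + 1) = LinearMap.mul' K (T K V) ∘ₗ
        TensorProduct.map (component σ M n) (incl K V ∘ₗ M) ∘ₗ coprod σ :=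
      LinearMap.ext (component_succ hM.M_zero_zero n)
    rw [h]
    exact .comp (isCrossR_mul σ) (.comp (ih.map (isCrossR_M hM)) (isCrossR_coprod hM.braiding))

theorem isCrossL_starProd : IsCrossL (crossL (beta σ) (beta σ)) (beta σ) (starProd σ M) :=
  isCrossL_of_local σ fun i j => ⟨∑ n ∈ Finset.range (i + j + 1), component σ M n,
    .sum _ fun n _ => isCrossL_component hM n, fun x hx y hy => by
      rw [starProd_of_mem σ M hx hy, LinearMap.sum_apply]⟩

theorem isCrossR_starProd : IsCrossR (crossR (beta σ) (beta σ)) (beta σ) (starProd σ M) :=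
  isCrossR_of_local σ fun i j => ⟨∑ n ∈ Finset.range (i + j + 1), component σ M n,
    .sum _ fun n _ => isCrossR_component hM n, fun x hx y hy => by
      rw [starProd_of_mem σ M hx hy, LinearMap.sum_apply]⟩

theorem isCrossL_starPow (n : ℕ) : IsCrossL (beta σ) (beta σ) (starPow σ M n) := by
  induction n with
  | zero => exact isCrossL_projDeg σ 1
  | succ n ih => exact .comp (isCrossL_starProd hM) (.comp ih.lTensor
      (.comp (.map (isCrossL_projDeg σ 1) (isCrossL_projDeg σ (n + 1))) (isCrossL_delta σ)))

theorem isCrossR_starPow (n : ℕ) : IsCrossR (beta σ) (beta σ) (starPow σ M n) := by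
  induction n with
  | zero => exact isCrossR_projDeg σ 1
  | succ n ih => exact .comp (isCrossR_starProd hM) (.comp ih.lTensor
      (.comp (.map (isCrossR_projDeg σ 1) (isCrossR_projDeg σ (n + 1))) (isCrossR_delta σ)))

theorem starProd_tmul_one (t : T K V) : starProd σ M (t ⊗ₜ 1) = t := by
  refine LinearMap.congr_fun (f := starProd σ M ∘ₗ (TensorProduct.mk K _ _).flip 1)
    (g := LinearMap.id) ?_ t
  refine eq_of_recursion iSup_deg isGraded_delta (φ := projDeg K V 1)
    (fun c hc => projDeg_of_mem_ne hc (by omega)) (a := LinearMap.mul' K (T K V))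
    (b := fun c => projDeg K V 0 c) (fun c => ?_) peel_last
  have h : ∀ w : T K V ⊗[K] T K V, TensorProduct.map (starProd σ M) (incl K V ∘ₗ M)
      (midCross (beta σ) (w ⊗ₜ (1 ⊗ₜ 1))) = TensorProduct.map
        (starProd σ M ∘ₗ (TensorProduct.mk K _ _).flip 1) (projDeg K V 1) w := by
    intro w
    induction w using TensorProduct.induction_on with
    | zero => simp
    | add u v hu hv => simp only [map_add, add_tmul, hu, hv]
    | tmul s t => simp [midCross_tmul, incl_M_tmul_one hM]
  rw [LinearMap.comp_apply, LinearMap.flip_apply, mk_apply, starProd_recursion hM.M_zero_zero,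
    coprod_eq_twist, twist_tmul, delta_one, h]
  simp [projDeg_zero_apply]

theorem starProd_one_tmul (t : T K V) : starProd σ M (1 ⊗ₜ t) = t := by
  refine LinearMap.congr_fun (f := starProd σ M ∘ₗ TensorProduct.mk K _ _ 1)
    (g := LinearMap.id) ?_ t
  refine eq_of_recursion iSup_deg isGraded_delta (φ := projDeg K V 1)
    (fun c hc => projDeg_of_mem_ne hc (by omega)) (a := LinearMap.mul' K (T K V))
    (b := fun c => projDeg K V 0 c) (fun c => ?_) peel_last
  have h : ∀ w : T K V ⊗[K] T K V, TensorProduct.map (starProd σ M) (incl K V ∘ₗ M)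
      (midCross (beta σ) ((1 ⊗ₜ 1) ⊗ₜ w)) = TensorProduct.map
        (starProd σ M ∘ₗ TensorProduct.mk K _ _ 1) (projDeg K V 1) w := by
    intro w
    induction w using TensorProduct.induction_on with
    | zero => simp
    | add u v hu hv => simp only [map_add, tmul_add, hu, hv]
    | tmul s t => simp [midCross_tmul, incl_M_one_tmul hM]
  rw [LinearMap.comp_apply, mk_apply, starProd_recursion hM.M_zero_zero,
    coprod_eq_twist, twist_tmul, delta_one, h]
  simp [projDeg_zero_apply]

/-- If all degrees are positive, the counit terms of the inner products vanish and this is the third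
axiom. If a factor is scalar, the unit laws suffice, since `M` is the degree-one part of `∗` and
`M(1 ⊗ -)`, `M(- ⊗ 1)` are the projection to degree one. -/
theorem M_starProd_assoc (x y z : T K V) :
    incl K V (M (starProd σ M (x ⊗ₜ y) ⊗ₜ z)) = incl K V (M (x ⊗ₜ starProd σ M (y ⊗ₜ z))) := by
  have hp := projDeg_one_starProd (σ := σ) hM.M_zero_zero
  suffices H : incl K V ∘ₗ M ∘ₗ (starProd σ M).rTensor (T K V) =
      incl K V ∘ₗ M ∘ₗ (starProd σ M).lTensor (T K V) ∘ₗ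
        (TensorProduct.assoc K (T K V) (T K V) (T K V)).toLinearMap by
    simpa using LinearMap.congr_fun H ((x ⊗ₜ y) ⊗ₜ z)
  refine hom_ext_deg₃ fun i j k x hx y hy z hz => ?_
  simp only [LinearMap.comp_apply, LinearMap.rTensor_tmul, LinearEquiv.coe_coe, assoc_tmul,
    LinearMap.lTensor_tmul]
  rcases Nat.eq_zero_or_pos i with rfl | hi
  · rw [eq_smul_one_of_mem_deg_zero hx]
    simp only [← smul_tmul', map_smul, starProd_one_tmul hM, incl_M_one_tmul hM, hp]
  rcases Nat.eq_zero_or_pos j with rfl | hj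
  · rw [eq_smul_one_of_mem_deg_zero hy]
    simp only [← smul_tmul', tmul_smul, map_smul, starProd_one_tmul hM, starProd_tmul_one hM]
  rcases Nat.eq_zero_or_pos k with rfl | hk
  · rw [eq_smul_one_of_mem_deg_zero hz]
    simp only [tmul_smul, map_smul, starProd_tmul_one hM, incl_M_tmul_one hM, hp]
  rw [starProd_of_pos hi hx hy, starProd_of_pos hj hy hz, sum_tmul, tmul_sum, map_sum M, map_sum M,
    hM.associativity i j k hi hj hk x hx y hy z hz]

theorem starProd_assoc (x y z : T K V) :
    starProd σ M (starProd σ M (x ⊗ₜ y) ⊗ₜ z) = starProd σ M (x ⊗ₜ starProd σ M (y ⊗ₜ z)) := by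
  have h0 := hM.M_zero_zero
  have hφ : (incl K V ∘ₗ M) ∘ₗ TensorProduct.map LinearMap.id (starProd σ M) ∘ₗ
      (TensorProduct.assoc K (T K V) (T K V) (T K V)).toLinearMap =
      (incl K V ∘ₗ M) ∘ₗ TensorProduct.map (starProd σ M) LinearMap.id := by
    ext x y z : 6
    simpa using (M_starProd_assoc hM x y z).symm
  have hε : ∀ w : (T K V ⊗[K] T K V) ⊗[K] T K V,
      counit₂ K V (TensorProduct.map LinearMap.id (starProd σ M)
        (TensorProduct.assoc K (T K V) (T K V) (T K V) w)) =
      counit₂ K V (TensorProduct.map (starProd σ M) LinearMap.id w) := by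
    intro w
    induction w using TensorProduct.induction_on with
    | zero => simp
    | add u v hu hv => simp only [map_add, hu, hv]
    | tmul u z =>
    induction u using TensorProduct.induction_on with
    | zero => simp
    | add u v hu hv => simp only [map_add, add_tmul, hu, hv]
    | tmul x y => simp [counit_starProd h0, mul_assoc]
  suffices H : starProd σ M ∘ₗ TensorProduct.map (starProd σ M) LinearMap.id =
      starProd σ M ∘ₗ TensorProduct.map LinearMap.id (starProd σ M) ∘ₗ
        (TensorProduct.assoc K (T K V) (T K V) (T K V)).toLinearMap by
    simpa using LinearMap.congr_fun H ((x ⊗ₜ y) ⊗ₜ z)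
  have hid : ∀ b : T K V, delta K V ((LinearMap.id : T K V →ₗ[K] T K V) b) =
      TensorProduct.map LinearMap.id LinearMap.id (delta K V b) := fun b => by
    simp [TensorProduct.map_id]
  refine eq_of_recursion (iSup_gr (iSup_gr iSup_deg iSup_deg) iSup_deg)
    (Δ := twist (crossL (beta σ) (beta σ)) (coprod σ) (delta K V))
    (.twist ((isGraded_beta σ).crossL (isGraded_beta σ)) (isGraded_coprod σ) isGraded_delta)
    (φ := (incl K V ∘ₗ M) ∘ₗ TensorProduct.map (starProd σ M) LinearMap.id) ?_
    (a := LinearMap.mul' K (T K V))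
    (b := fun w => counit₂ K V (TensorProduct.map (starProd σ M) LinearMap.id w) • (1 : T K V)) ?_ ?_
  -- The map `φ = M(∗ ⊗ id)` vanishes in degree `0`, where `∗` is a multiple of the unit and `M(1 ⊗
  -- 1) = 0`.
  · intro u hu
    refine gr_eq_zero (fun i j hij u hu z hz => ?_) hu
    obtain ⟨rfl, rfl⟩ : i = 0 ∧ j = 0 := by omega
    have h1 : starProd σ M u = counit₂ K V u • 1 := by
      rw [starProd_eq_sum h0 le_rfl hu]
      simp [component_zero_apply]
    rw [eq_smul_one_of_mem_deg_zero hz]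
    simp [h1, ← smul_tmul', h0]
  · intro w
    -- As `∗` is a coalgebra map natural for `β`, `∗ ⊗ id` carries the twisted coproduct of `(T ⊗ T)
    -- ⊗ T` to `Δ_β`; the outer recursion thus pulls back.
    rw [LinearMap.comp_apply, starProd_recursion h0, coprod_eq_twist,
      twist_map (χ := crossL (beta σ) (beta σ)) (delta_starProd h0) hid
        (fun u z => isCrossL_starProd hM u z),
      ← LinearMap.comp_apply (TensorProduct.map _ _), ← TensorProduct.map_comp, ← coprod_eq_twist]
  · intro w
    -- The same pullback along `id ⊗ ∗` yields the coproduct of `T ⊗ (T ⊗ T)`. It is identified with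
    -- the former one by `twist_crossL_crossR`, and `hφ` matches the degree-one parts.
    rw [LinearMap.comp_apply, LinearMap.comp_apply, starProd_recursion h0, LinearEquiv.coe_coe, hε,
      coprod_eq_twist,
      twist_map (χ := crossR (beta σ) (beta σ)) hid (delta_starProd h0)
        (fun z u => isCrossR_starProd hM z u), coprod_eq_twist, twist_crossL_crossR,
      ← LinearMap.comp_apply (TensorProduct.map _ _), ← TensorProduct.map_comp,
      ← LinearMap.comp_apply (TensorProduct.map _ _), ← TensorProduct.map_comp,
      LinearMap.comp_assoc, LinearMap.comp_assoc, hφ, ← coprod_eq_twist]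

theorem isUnitalAlgebra_starProd : IsUnitalAlgebra (starProd σ M) 1 where
  assoc := starProd_assoc hM
  one_mul := starProd_one_tmul hM
  mul_one := starProd_tmul_one hM

end StarCrossings

/-! ### Restriction of `β` to `Q_σ(V)` and its Yang-Baxter algebra structure. -/

section Subalgebra

variable {K : Type*} [Field K] {V : Type*} [AddCommGroup V] [Module K V]
  {σ : V ⊗[K] V →ₗ[K] V ⊗[K] V} {M : T K V ⊗[K] T K V →ₗ[K] V}

theorem tmul_mem_range_mapIncl {S R : Submodule K (T K V)} {x y : T K V} (hx : x ∈ S)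
    (hy : y ∈ R) : x ⊗ₜ[K] y ∈ LinearMap.range (TensorProduct.mapIncl S R) :=
  ⟨⟨x, hx⟩ ⊗ₜ ⟨y, hy⟩, rfl⟩

theorem incl_mem_Q (v : V) : incl K V v ∈ Q σ M :=
  Submodule.mem_sInf.2 fun _ hS => hS.2.1 v

theorem deg_one_le_Q : deg K V 1 ≤ Q σ M := fun x hx => by
  rw [deg, pow_one] at hx
  obtain ⟨v, rfl⟩ := hx
  exact incl_mem_Q v

theorem Q_induction {p : T K V → Prop} (zero : p 0) (one : p 1) (incl : ∀ v, p (incl K V v))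
    (add : ∀ x y, p x → p y → p (x + y)) (smul : ∀ (r : K) x, p x → p (r • x))
    (star : ∀ x ∈ Q σ M, ∀ y ∈ Q σ M, p x → p y → p (starProd σ M (x ⊗ₜ y)))
    {x : T K V} (hx : x ∈ Q σ M) : p x := by
  let S : Submodule K (T K V) :=
    { carrier := {x | x ∈ Q σ M ∧ p x}
      add_mem' := fun ha hb => ⟨add_mem ha.1 hb.1, add _ _ ha.2 hb.2⟩
      zero_mem' := ⟨zero_mem _, zero⟩
      smul_mem' := fun r x hx => ⟨Submodule.smul_mem _ r hx.1, smul r x hx.2⟩ }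
  have hS : x ∈ S := Submodule.mem_sInf.1 hx S
    ⟨⟨one_mem_Q σ M, one⟩, fun v => ⟨incl_mem_Q v, incl v⟩, fun x hx y hy =>
      ⟨star_mem_Q σ M hx.1 hy.1, star x hx.1 y hy.1 hx.2 hy.2⟩⟩
  exact hS.2

section Stable

variable {τ : T K V ⊗[K] T K V →ₗ[K] T K V ⊗[K] T K V}
  (oneL : ∀ z, τ (1 ⊗ₜ z) = z ⊗ₜ 1) (oneR : ∀ z, τ (z ⊗ₜ 1) = 1 ⊗ₜ z)
  (starL : IsCrossL (crossL τ τ) τ (starProd σ M))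
  (starR : IsCrossR (crossR τ τ) τ (starProd σ M))
  (projL : IsCrossL τ τ (projDeg K V 1)) (projR : IsCrossR τ τ (projDeg K V 1))

include projL projR in
theorem crossing_incl_tmul_incl_mem (v w : V) : τ (incl K V v ⊗ₜ incl K V w) ∈
    LinearMap.range (TensorProduct.mapIncl (Q σ M) (deg K V 1)) := by
  have h1 := projL (incl K V v) (incl K V w)
  have h2 := projR.apply (incl K V v ⊗ₜ incl K V w)
  rw [LinearMap.lTensor_tmul] at h2
  rw [projDeg_of_mem (incl_mem_deg _)] at h1 h2
  rw [h1, h2]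
  generalize τ _ = u
  induction u using TensorProduct.induction_on with
  | zero => simp
  | add u v hu hv => simp only [map_add]; exact Submodule.add_mem _ hu hv
  | tmul x y => exact tmul_mem_range_mapIncl (deg_one_le_Q (projDeg_mem 1 x)) (projDeg_mem 1 y)

include oneR starR projL projR in
-- Keeping the second factor in `V`, and not just in `Q`, is what makes the induction work: after
-- passing `x`, the moving factor is still a vector and can be sent past `y`. The crossing `τ` is
-- left general so that both `β` and its inverse are covered.
theorem crossing_incl_tmul_mem (v : V) {y : T K V} (hy : y ∈ Q σ M) : τ (incl K V v ⊗ₜ y) ∈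
    LinearMap.range (TensorProduct.mapIncl (Q σ M) (deg K V 1)) := by
  refine Q_induction (p := fun y => ∀ v, τ (incl K V v ⊗ₜ y) ∈
    LinearMap.range (TensorProduct.mapIncl (Q σ M) (deg K V 1))) ?_ ?_ ?_ ?_ ?_ ?_ hy v
  · simp
  · intro v
    rw [oneR]
    exact tmul_mem_range_mapIncl (one_mem_Q σ M) (incl_mem_deg v)
  · exact fun w v => crossing_incl_tmul_incl_mem projL projR v w
  · intro x y hx hy v
    rw [tmul_add, map_add]
    exact Submodule.add_mem _ (hx v) (hy v)
  · intro r x hx v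
    rw [tmul_smul, map_smul]
    exact Submodule.smul_mem _ r (hx v)
  · intro x _ y _ hx hy v
    rw [starR, crossR_apply, slide_tmul]
    obtain ⟨u, hu⟩ := hx v
    rw [← hu]
    clear hu
    induction u using TensorProduct.induction_on with
    | zero => simp
    | add u v hu hv => simp only [map_add, add_tmul]; exact Submodule.add_mem _ hu hv
    | tmul q w =>
      obtain ⟨w, hw⟩ := w
      rw [deg, pow_one] at hw
      obtain ⟨w, rfl⟩ := hw
      obtain ⟨u, hu⟩ := hy w
      simp only [mapIncl, map_tmul, Submodule.subtype_apply, assoc_tmul, LinearMap.lTensor_tmul]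
      rw [← hu]
      clear hu
      induction u using TensorProduct.induction_on with
      | zero => simp
      | add u v hu hv => simp only [map_add, tmul_add]; exact Submodule.add_mem _ hu hv
      | tmul q' w' =>
        simp only [mapIncl, map_tmul, Submodule.subtype_apply, assoc_symm_tmul,
          LinearMap.rTensor_tmul]
        exact tmul_mem_range_mapIncl (star_mem_Q σ M q.2 q'.2) w'.2

include oneL oneR starL starR projL projR in
-- Induction on the left factor. For a product `x ∗ x'`, first `x'` passes `y`, leaving terms `q ⊗
-- q'` in `Q ⊗ Q`; then `x` passes `q`, and the leftover of `x` is multiplied by `q'`.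
theorem crossing_tmul_mem {x y : T K V} (hx : x ∈ Q σ M) (hy : y ∈ Q σ M) :
    τ (x ⊗ₜ y) ∈ LinearMap.range (inclQ σ M) := by
  refine Q_induction (p := fun x => ∀ y ∈ Q σ M, τ (x ⊗ₜ y) ∈ LinearMap.range (inclQ σ M))
    ?_ ?_ ?_ ?_ ?_ ?_ hx y hy
  · simp
  · intro y hy
    rw [oneL]
    exact tmul_mem_range_mapIncl hy (one_mem_Q σ M)
  · exact fun v y hy => range_mapIncl_mono le_rfl deg_one_le_Q
      (crossing_incl_tmul_mem oneR starR projL projR v hy)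
  · intro x x' hx hx' y hy
    rw [add_tmul, map_add]
    exact Submodule.add_mem _ (hx y hy) (hx' y hy)
  · intro r x hx y hy
    rw [← smul_tmul', map_smul]
    exact Submodule.smul_mem _ r (hx y hy)
  · intro x _ x' _ hx hx' y hy
    rw [starL, crossL_tmul]
    obtain ⟨u, hu⟩ := hx' y hy
    rw [← hu]
    clear hu
    induction u using TensorProduct.induction_on with
    | zero => simp
    | add u v hu hv => simp only [map_add, tmul_add]; exact Submodule.add_mem _ hu hv
    | tmul q q' =>
      obtain ⟨u, hu⟩ := hx q q.2
      simp only [inclQ, map_tmul, Submodule.subtype_apply, slide_tmul]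
      rw [← hu]
      clear hu
      induction u using TensorProduct.induction_on with
      | zero => simp
      | add u v hu hv => simp only [map_add, add_tmul]; exact Submodule.add_mem _ hu hv
      | tmul s t =>
        simp only [inclQ, map_tmul, Submodule.subtype_apply, assoc_tmul, LinearMap.lTensor_tmul]
        exact tmul_mem_range_mapIncl s.2 (star_mem_Q σ M t.2 q'.2)

include oneL oneR starL starR projL projR in
theorem crossing_inclQ_mem (u : Q σ M ⊗[K] Q σ M) :
    τ (inclQ σ M u) ∈ LinearMap.range (inclQ σ M) := by
  induction u using TensorProduct.induction_on with
  | zero => simp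
  | add u v hu hv => simp only [map_add]; exact Submodule.add_mem _ hu hv
  | tmul x y => exact crossing_tmul_mem oneL oneR starL starR projL projR x.2 y.2

end Stable

theorem inclQ_injective : Function.Injective (inclQ σ M) :=
  TensorProduct.map_injective_of_flat_flat _ _ (Submodule.subtype_injective _)
    (Submodule.subtype_injective _)

variable (σ M) in
/-- The inclusion of the threefold tensor power of `Q_σ(V)`. -/
def inclQ₃ : Q σ M ⊗[K] (Q σ M ⊗[K] Q σ M) →ₗ[K] T K V ⊗[K] (T K V ⊗[K] T K V) :=
  TensorProduct.map (Q σ M).subtype (inclQ σ M)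

theorem inclQ₃_injective : Function.Injective (inclQ₃ σ M) :=
  TensorProduct.map_injective_of_flat_flat _ _ (Submodule.subtype_injective _) inclQ_injective

theorem inclQ₃_assoc (w : Q σ M ⊗[K] Q σ M) (z : Q σ M) :
    inclQ₃ σ M (TensorProduct.assoc K _ _ _ (w ⊗ₜ z)) =
      TensorProduct.assoc K _ _ _ (inclQ σ M w ⊗ₜ[K] (z : T K V)) := by
  induction w using TensorProduct.induction_on with
  | zero => simp
  | add u v hu hv => simp only [map_add, add_tmul, hu, hv]
  | tmul x y => rfl

section Restriction

variable {b : Q σ M ⊗[K] Q σ M →ₗ[K] Q σ M ⊗[K] Q σ M}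
  (hb : inclQ σ M ∘ₗ b = beta σ ∘ₗ inclQ σ M)

include hb

theorem inclQ₃_op₁ : inclQ₃ σ M ∘ₗ op₁ b = op₁ (beta σ) ∘ₗ inclQ₃ σ M := by
  refine TensorProduct.ext_threefold' fun x y z => ?_
  have h := LinearMap.congr_fun hb (x ⊗ₜ y)
  simp only [LinearMap.comp_apply] at h
  simp only [op₁, LinearMap.comp_apply, LinearEquiv.coe_coe, assoc_symm_tmul,
    LinearMap.rTensor_tmul, inclQ₃_assoc, h]
  rfl

theorem inclQ₃_op₂ : inclQ₃ σ M ∘ₗ op₂ b = op₂ (beta σ) ∘ₗ inclQ₃ σ M := by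
  rw [inclQ₃, op₂, op₂, LinearMap.lTensor, LinearMap.lTensor, ← TensorProduct.map_comp,
    ← TensorProduct.map_comp, hb, LinearMap.comp_id, LinearMap.id_comp]

theorem yang_baxter_of_inclQ (hσ : IsBraiding σ) : op₁ b ∘ₗ op₂ b ∘ₗ op₁ b =
    op₂ b ∘ₗ op₁ b ∘ₗ op₂ b := by
  have h1 := fun u => LinearMap.congr_fun (inclQ₃_op₁ hb) u
  have h2 := fun u => LinearMap.congr_fun (inclQ₃_op₂ hb) u
  have h := fun u => LinearMap.congr_fun
    ((isCrossR_iff_yang_baxter (beta σ)).1 (isCrossR_beta hσ)) u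
  simp only [LinearMap.comp_apply] at h1 h2 h
  refine LinearMap.ext fun u => inclQ₃_injective ?_
  simp only [LinearMap.comp_apply, h1, h2, h]

/-- On `T(V)` the identity is the naturality of `∗` for moving `T(V)` from the right; it descends
because the inclusions intertwine all the maps and `inclQ` is injective. -/
theorem mulLeft_of_inclQ (hM : IsQuantumBInf σ M) :
    b ∘ₗ mulLeft (mulQ σ M) = mulRight (mulQ σ M) ∘ₗ op₁ b ∘ₗ op₂ b := by
  have h1 := fun u => LinearMap.congr_fun (inclQ₃_op₁ hb) u
  have h2 := fun u => LinearMap.congr_fun (inclQ₃_op₂ hb) u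
  have h := fun u => LinearMap.congr_fun hb u
  have h3 : ∀ u, mulLeft (starProd σ M) (inclQ₃ σ M u) = inclQ σ M (mulLeft (mulQ σ M) u) :=
    LinearMap.congr_fun (TensorProduct.ext_threefold' fun x y z => rfl :
      mulLeft (starProd σ M) ∘ₗ inclQ₃ σ M = inclQ σ M ∘ₗ mulLeft (mulQ σ M))
  have h4 : ∀ u, mulRight (starProd σ M) (inclQ₃ σ M u) = inclQ σ M (mulRight (mulQ σ M) u) :=
    LinearMap.congr_fun (TensorProduct.ext_threefold' fun x y z => rfl :
      mulRight (starProd σ M) ∘ₗ inclQ₃ σ M = inclQ σ M ∘ₗ mulRight (mulQ σ M))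
  have h5 : ∀ u, beta σ (mulLeft (starProd σ M) u) =
      mulRight (starProd σ M) (op₁ (beta σ) (op₂ (beta σ) u)) :=
    LinearMap.congr_fun (TensorProduct.ext_threefold' fun x y z =>
        isCrossL_starProd hM (x ⊗ₜ y) z :
      beta σ ∘ₗ mulLeft (starProd σ M) =
        mulRight (starProd σ M) ∘ₗ op₁ (beta σ) ∘ₗ op₂ (beta σ))
  simp only [LinearMap.comp_apply] at h h1 h2
  refine LinearMap.ext fun u => inclQ_injective ?_
  simp only [LinearMap.comp_apply, h, ← h3, h5, ← h4, h1, h2]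

theorem mulRight_of_inclQ (hM : IsQuantumBInf σ M) :
    b ∘ₗ mulRight (mulQ σ M) = mulLeft (mulQ σ M) ∘ₗ op₂ b ∘ₗ op₁ b := by
  have h1 := fun u => LinearMap.congr_fun (inclQ₃_op₁ hb) u
  have h2 := fun u => LinearMap.congr_fun (inclQ₃_op₂ hb) u
  have h := fun u => LinearMap.congr_fun hb u
  have h3 : ∀ u, mulLeft (starProd σ M) (inclQ₃ σ M u) = inclQ σ M (mulLeft (mulQ σ M) u) :=
    LinearMap.congr_fun (TensorProduct.ext_threefold' fun x y z => rfl :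
      mulLeft (starProd σ M) ∘ₗ inclQ₃ σ M = inclQ σ M ∘ₗ mulLeft (mulQ σ M))
  have h4 : ∀ u, mulRight (starProd σ M) (inclQ₃ σ M u) = inclQ σ M (mulRight (mulQ σ M) u) :=
    LinearMap.congr_fun (TensorProduct.ext_threefold' fun x y z => rfl :
      mulRight (starProd σ M) ∘ₗ inclQ₃ σ M = inclQ σ M ∘ₗ mulRight (mulQ σ M))
  have h5 : ∀ u, beta σ (mulRight (starProd σ M) u) =
      mulLeft (starProd σ M) (op₂ (beta σ) (op₁ (beta σ) u)) :=
    LinearMap.congr_fun (TensorProduct.ext_threefold' fun x y z =>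
        isCrossR_starProd hM x (y ⊗ₜ z) :
      beta σ ∘ₗ mulRight (starProd σ M) =
        mulLeft (starProd σ M) ∘ₗ op₂ (beta σ) ∘ₗ op₁ (beta σ))
  simp only [LinearMap.comp_apply] at h h1 h2
  refine LinearMap.ext fun u => inclQ_injective ?_
  simp only [LinearMap.comp_apply, h, ← h3, h5, ← h4, h1, h2]

end Restriction

theorem isUnitalAlgebra_mulQ (hM : IsQuantumBInf σ M) :
    IsUnitalAlgebra (mulQ σ M) (oneQ σ M) where
  assoc a b c := Subtype.ext ((isUnitalAlgebra_starProd hM).assoc a b c)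
  one_mul a := Subtype.ext ((isUnitalAlgebra_starProd hM).one_mul a)
  mul_one a := Subtype.ext ((isUnitalAlgebra_starProd hM).mul_one a)

theorem exists_restriction {τ : T K V ⊗[K] T K V →ₗ[K] T K V ⊗[K] T K V}
    (hτ : ∀ u, τ (inclQ σ M u) ∈ LinearMap.range (inclQ σ M)) :
    ∃ b : Q σ M ⊗[K] Q σ M →ₗ[K] Q σ M ⊗[K] Q σ M, inclQ σ M ∘ₗ b = τ ∘ₗ inclQ σ M := by
  let e := LinearEquiv.ofInjective (inclQ σ M) inclQ_injective
  refine ⟨e.symm.toLinearMap ∘ₗ (τ ∘ₗ inclQ σ M).codRestrict _ hτ, LinearMap.ext fun u => ?_⟩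
  exact congrArg Subtype.val (e.apply_symm_apply ⟨τ (inclQ σ M u), hτ u⟩)

theorem exists_braiding_Q (hM : IsQuantumBInf σ M) :
    ∃ b : Q σ M ⊗[K] Q σ M →ₗ[K] Q σ M ⊗[K] Q σ M,
      inclQ σ M ∘ₗ b = beta σ ∘ₗ inclQ σ M ∧ IsYBAlgebra (mulQ σ M) (oneQ σ M) b := by
  obtain ⟨γ, hγ, hγ'⟩ := exists_beta_inverse hM.braiding
  obtain ⟨b, hb⟩ := exists_restriction (σ := σ) (M := M) (τ := beta σ)
    (crossing_inclQ_mem (beta_one_tmul σ) (beta_tmul_one σ) (isCrossL_starProd hM)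
      (isCrossR_starProd hM) (isCrossL_projDeg σ 1) (isCrossR_projDeg σ 1))
  -- The inverse `γ` of `β` also preserves `Q ⊗ Q`: each compatibility of `γ` is the opposite-sided
  -- one of `β`, inverted. Its restriction `c` is a two-sided inverse of `b`.
  obtain ⟨c, hc⟩ := exists_restriction (σ := σ) (M := M) (τ := γ)
    (crossing_inclQ_mem (fun z => by rw [← beta_tmul_one σ z, hγ])
      (fun z => by rw [← beta_one_tmul σ z, hγ])
      ((isCrossR_starProd hM).inv (crossR_comp_crossL hγ' hγ') hγ)
      ((isCrossL_starProd hM).inv (crossL_comp_crossR hγ' hγ') hγ)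
      ((isCrossR_projDeg σ 1).inv hγ' hγ) ((isCrossL_projDeg σ 1).inv hγ' hγ))
  have h := fun u => LinearMap.congr_fun hb u
  have h' := fun u => LinearMap.congr_fun hc u
  simp only [LinearMap.comp_apply] at h h'
  refine ⟨b, hb, isUnitalAlgebra_mulQ hM, ⟨⟨?_, ?_⟩, yang_baxter_of_inclQ hb hM.braiding⟩,
    mulLeft_of_inclQ hb hM, mulRight_of_inclQ hb hM, fun a => ?_, fun a => ?_⟩
  · exact Function.LeftInverse.injective (g := c) fun u => inclQ_injective (by rw [h', h, hγ])
  · exact Function.RightInverse.surjective (g := c) fun u => inclQ_injective (by rw [h, h', hγ'])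
  · exact inclQ_injective ((h _).trans (beta_one_tmul σ _))
  · exact inclQ_injective ((h _).trans (beta_tmul_one σ _))

end Subalgebra

end QuantumBInf

end

theorem proposition4p20 {K : Type*} [Field K] {V : Type*} [AddCommGroup V] [Module K V]
    (σ : V ⊗[K] V →ₗ[K] V ⊗[K] V)
    (M : TensorAlgebra K V ⊗[K] TensorAlgebra K V →ₗ[K] V)
    (hM : QuantumBInf.IsQuantumBInf σ M) :
    QuantumBInf.IsUnitalAlgebra (QuantumBInf.starProd σ M) (1 : TensorAlgebra K V) ∧
    (∀ k l : ℕ, ∀ x ∈ QuantumBInf.deg K V (k + 1), ∀ y ∈ QuantumBInf.deg K V (l + 1),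
      QuantumBInf.beta σ (QuantumBInf.starPow σ M k x ⊗ₜ[K] QuantumBInf.starPow σ M l y) =
        TensorProduct.map (QuantumBInf.starPow σ M l) (QuantumBInf.starPow σ M k)
          (QuantumBInf.beta σ (x ⊗ₜ[K] y))) ∧
    ∃ βQ : QuantumBInf.Q σ M ⊗[K] QuantumBInf.Q σ M →ₗ[K]
        QuantumBInf.Q σ M ⊗[K] QuantumBInf.Q σ M,
      QuantumBInf.inclQ σ M ∘ₗ βQ = QuantumBInf.beta σ ∘ₗ QuantumBInf.inclQ σ M ∧
      QuantumBInf.IsYBAlgebra (QuantumBInf.mulQ σ M) (QuantumBInf.oneQ σ M) βQ :=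
  ⟨QuantumBInf.isUnitalAlgebra_starProd hM,
    fun k l x _ y _ => QuantumBInf.beta_map σ (QuantumBInf.isCrossL_starPow hM k)
      (QuantumBInf.isCrossR_starPow hM l) (x ⊗ₜ y),
    QuantumBInf.exists_braiding_Q hM⟩
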